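/- **Theorem (A posteriori error bound).** *Setting.* Let $\mathcal U\subset\mathbb R^m$ be open, $g\in C^2(\mathcal U,\mathbb R^m)$, and let $\eta,q\in C^1(\mathcal U,\mathbb R)$ be an entropy/entropy-flux pair, $D\eta\,Dg=Dq$, with $\eta$ strictly convex. Let $\mathfrak K\subset\mathcal U$ be compact and convex, assume that the Hessian of $\eta$ exists on $\mathfrak K$, and let $C_{\overline g}\ge 0$, $C_{\underline\eta},C_{\overline\eta}>0$ be constants with $$|v^{T}\mathrm Hg(a)v|\le C_{\overline g}|v|^2,\qquad C_{\underline\eta}|v|^2\le v^{T}\mathrm H\eta(a)v\le C_{\overline\eta}|v|^2\qquad\forall v\in\mathbb R^m,\ a\in\mathfrak K .$$ Let $\mathbb T=[-1,1]$ with end points identified, let $u_0\in L^\infty(\mathbb T)$ take values in $\mathcal U$, and let $u\in L^\infty((0,T)\times\mathbb T,\mathcal U)$ be an entropy solution of $\partial_t u+\partial_x g(u)=0$, $u(0,\cdot)=u_0$, i.e. a weak solution satisfying $\partial_t\eta(u)+\partial_x q(u)\le 0$ weakly (both with the initial datum, against test functions in $C_c^\infty([0,T)\times\mathbb T)$, non-negative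 ones for the inequality). As usual, $u$ is the representative for which $t\mapsto u(t,\cdot)$ is weak-* continuous from $[0,T]$ to $L^\infty(\mathbb T)$. *Scheme.* Let $-1=x_0<\dots<x_M=1$ and $0=t_0<\dots<t_N=T$, let $h$ be the maximal size of the cells $(x_{i-1},x_i)$, and let $\mathbb V^s_k$ be the space of $\mathbb R^m$-valued functions that are polynomial of degree $\le k$ on each cell ($\mathbb V^s_{-1}=\{0\}$). Traces $v(x_i^\pm)$ are one-sided limits, with $x_0$ and $x_M$ identified, and $[\![\psi]\!]_i=\psi(x_i^-)-\psi(x_i^+)$. Let $w:\mathcal U\times\mathcal U\to\mathcal U$ be locally Lipschitz such that for each compact $K\subset\mathcal U$ there is $C_w(K)>0$ with $|w(a,b)-a|+|w(a,b)-b|\le C_w(K)|a-b|$ for $a,b\in K$. Let the numerical flux be either $G(a,b)=g(w(a,b))$, or $G(a,b)=g(w(a,b))-\mu(a,b;h)h^\nu(b-a)$ with $\nu\in\mathbb N_0$ and a matrix-valued $\mu$ such that for each compact $K\subset\mathcal U$ there is $\mu_K>0$ with $|\mu(a,b;h')|\le\mu_K(1+|b-a|/h')$ for $a,b\in K$ and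 all small $h'>0$. The DG operator $f$ on $\mathbb V^s_k$ is given by $$\int_{\mathbb T} f(v)\cdot\psi\,dx=-\sum_{i=1}^M\int_{x_{i-1}}^{x_i}g(v)\cdot\partial_x\psi\,dx+\sum_{i=0}^{M-1}G(v(x_i^-),v(x_i^+))\cdot[\![\psi]\!]_i\qquad\forall\psi\in\mathbb V_k^s .$$ Let $u_h^0,\dots,u_h^N\in\mathbb V^s_k$ be the fully discrete solution, computed by any single- or multi-step discretization in time of $\partial_t u_h=-f(u_h)$. *Reconstruction.* Let $p,d,r\in\mathbb N_0$, and let $\hat u^t$ be the $H(p,d,r)$ Hermite reconstruction in time: on $[t_n,t_{n+1}]$ it equals a polynomial $\hat u^{t,n}$ in $t$ of degree $\le(d+2)(p+1)+r+1$ with values in $\mathbb V^s_k$ such that $\partial_t^l\hat u^{t,n}(t_j)=F_l^j$ for $0\le l\le d+1$, $n-p\le j\le n$, and $\partial_t^l\hat u^{t,n}(t_{n+1})=F_l^{n+1}$ for $0\le l\le r+1$. Here $F_0^j=u_h^j$, $F_1^j=-f(u_h^j)$, and, for $l\ge2$, $F_l^j\in\mathbb V^s_k$ is the $l$-th time derivative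 obtained from the semi-discrete scheme or any approximation of it. (For $n<p$ only the degree and the values $u_h^n,u_h^{n+1}$ at $t_n,t_{n+1}$ are prescribed.) The space-time reconstruction $\hat u^{st}(t,\cdot)\in\mathbb V^s_{k+1}$, $t\in[0,T]$, is given by $$\int_{\mathbb T}(\hat u^{st}(t,\cdot)-\hat u^t(t,\cdot))\cdot\psi\,dx=0\quad\forall\psi\in\mathbb V^s_{k-1},\qquad \hat u^{st}(t,x_i^\pm)=w(\hat u^t(t,x_i^-),\hat u^t(t,x_i^+))\quad\forall i,$$ and its residual is $R^{st}=\partial_t\hat u^{st}+\partial_x g(\hat u^{st})$. *Claim.* If $u$, $\hat u^t$ and $\hat u^{st}$ take only values in $\mathfrak K$, then for $n=0,\dots,N$ $$\begin{aligned}\|u(t_n,\cdot)-u_h^n\|_{L^2(\mathbb T)}^2\le{}&2\|\hat u^{st}(t_n,\cdot)-u_h^n\|_{L^2(\mathbb T)}^2\\&+2C_{\underline\eta}^{-1}\Big(\|R^{st}\|^2_{L^2((0,t_n)\times\mathbb T)}+C_{\overline\eta}\|u_0-\hat u^{st}(0,\cdot)\|^2_{L^2(\mathbb T)}\Big)\\&\quad\times\exp\Big(\int_0^{t_n}\frac{C_{\overline\eta}C_{\overline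 g}\|\partial_x\hat u^{st}(s,\cdot)\|_{L^\infty(\mathbb T)}+C_{\overline\eta}^2}{C_{\underline\eta}}\,ds\Big).\end{aligned}$$ -/

import Mathlib

open MeasureTheory Set

noncomputable section

namespace DGRec

/-- State vectors in `ℝ^m`, with the Euclidean norm. -/
abbrev State (m : ℕ) := EuclideanSpace ℝ (Fin m)

/-- The open fundamental cell `(-1, 1)` of the flat torus `𝕋 = ℝ / 2ℤ`. -/
def cellT : Set ℝ := Ioo (-1) 1

/-- The square of the norm of `L²(𝕋)`. -/
def l2sq {m : ℕ} (f : ℝ → State m) : ℝ := ∫ x in cellT, ‖f x‖ ^ 2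

/-- The norm of `L^∞(𝕋)`. -/
def linf {m : ℕ} (f : ℝ → State m) : ℝ :=
  (eLpNorm f ⊤ (volume.restrict cellT)).toReal

/-! ### The conservation law, entropy pairs and entropy solutions -/

/-- `(η, q)` is a strictly convex entropy, entropy flux pair of class `C¹` for the flux `g` on the
open set `U` (for a set `U` that is not convex, strict convexity is meant on its convex subsets). -/
structure IsEntropyPair {m : ℕ} (U : Set (State m)) (g : State m → State m)
    (η q : State m → ℝ) : Prop where
  contDiff_entropy : ContDiffOn ℝ 1 η U
  contDiff_flux : ContDiffOn ℝ 1 q U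
  strictConvex : ∀ S : Set (State m), S ⊆ U → Convex ℝ S → StrictConvexOn ℝ S η
  compatible : ∀ a ∈ U, (fderiv ℝ η a).comp (fderiv ℝ g a) = fderiv ℝ q a

/-- Bounds for the Hessians of `g` and `η` on `K`; the Hessian of `η` is required to exist
at the points of `K`. -/
structure HessianBounds {m : ℕ} (K : Set (State m)) (g : State m → State m) (η : State m → ℝ)
    (Cg cη Cη : ℝ) : Prop where
  flux_nonneg : 0 ≤ Cg
  lower_pos : 0 < cη
  upper_pos : 0 < Cη
  flux_bound : ∀ a ∈ K, ∀ v : State m, ‖fderiv ℝ (fderiv ℝ g) a v v‖ ≤ Cg * ‖v‖ ^ 2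
  hessian_exists : ∀ a ∈ K, DifferentiableAt ℝ (fderiv ℝ η) a
  lower_bound : ∀ a ∈ K, ∀ v : State m, cη * ‖v‖ ^ 2 ≤ fderiv ℝ (fderiv ℝ η) a v v
  upper_bound : ∀ a ∈ K, ∀ v : State m, fderiv ℝ (fderiv ℝ η) a v v ≤ Cη * ‖v‖ ^ 2

/-- Test functions in `C_c^∞([0, T) × 𝕋)`: restrictions of smooth functions of `(t, x)` that are
2-periodic in `x` and vanish for `t` near and beyond `T`. -/
structure IsTestFunction {V : Type*} [NormedAddCommGroup V] [NormedSpace ℝ V]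
    (T : ℝ) (φ : ℝ → ℝ → V) : Prop where
  smooth : ContDiff ℝ (⊤ : ℕ∞) (fun z : ℝ × ℝ => φ z.1 z.2)
  periodic : ∀ t x, φ t (x + 2) = φ t x
  support : ∃ t₁ < T, ∀ t, t₁ ≤ t → ∀ x, φ t x = 0

/-- The space-time cylinder `(0, t) × 𝕋`. -/
def cylinder (t : ℝ) : Set (ℝ × ℝ) := Ioo 0 t ×ˢ cellT

/-- Initial data: bounded, measurable, with values in `U`. -/
structure IsInitialDatum {m : ℕ} (U : Set (State m)) (u₀ : ℝ → State m) : Prop where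
  meas : AEStronglyMeasurable u₀ (volume.restrict cellT)
  bounded : ∃ C : ℝ, ∀ᵐ x ∂(volume.restrict cellT), ‖u₀ x‖ ≤ C
  mem : ∀ x ∈ cellT, u₀ x ∈ U

/-- `u` is a weak solution of `∂ₜ u + ∂ₓ g(u) = 0` on `(0, T) × 𝕋` with `u(0, ·) = u₀`, bounded and
with values in `U`.  As usual, `u` denotes the representative for which `t ↦ u(t, ·)` is weak-*
continuous from `[0, T]` to `L^∞(𝕋)`, which gives a meaning to `u(t, ·)` for every single `t`. -/
structure IsWeakSolution {m : ℕ} (U : Set (State m)) (g : State m → State m) (T : ℝ)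
    (u₀ : ℝ → State m) (u : ℝ → ℝ → State m) : Prop where
  meas : AEStronglyMeasurable (fun z : ℝ × ℝ => u z.1 z.2) (volume.restrict (cylinder T))
  meas_slice : ∀ t ∈ Icc 0 T, AEStronglyMeasurable (u t) (volume.restrict cellT)
  bounded : ∃ C : ℝ, ∀ t ∈ Icc 0 T, ∀ᵐ x ∂(volume.restrict cellT), ‖u t x‖ ≤ C
  mem : ∀ᵐ z ∂(volume.restrict (cylinder T)), u z.1 z.2 ∈ U
  flux_integrable : IntegrableOn (fun z : ℝ × ℝ => g (u z.1 z.2)) (cylinder T)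
  weakStar_continuous : ∀ ψ : ℝ → State m, IntegrableOn ψ cellT →
    ContinuousOn (fun t => ∫ x in cellT, inner ℝ (u t x) (ψ x)) (Icc 0 T)
  weak_form : ∀ φ : ℝ → ℝ → State m, IsTestFunction T φ →
    (∫ z in cylinder T, (inner ℝ (u z.1 z.2) (deriv (fun s => φ s z.2) z.1)
        + inner ℝ (g (u z.1 z.2)) (deriv (φ z.1) z.2)))
      + ∫ x in cellT, inner ℝ (u₀ x) (φ 0 x) = 0

/-- `u` is an entropy solution with respect to `(η, q)`: a weak solution for which
`∂ₜ η(u) + ∂ₓ q(u) ≤ 0` holds weakly, with initial datum `η(u₀)`. -/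
structure IsEntropySolution {m : ℕ} (U : Set (State m)) (g : State m → State m)
    (η q : State m → ℝ) (T : ℝ) (u₀ : ℝ → State m) (u : ℝ → ℝ → State m) : Prop
    extends IsWeakSolution U g T u₀ u where
  entropy_integrable : IntegrableOn (fun z : ℝ × ℝ => η (u z.1 z.2)) (cylinder T)
  entropyFlux_integrable : IntegrableOn (fun z : ℝ × ℝ => q (u z.1 z.2)) (cylinder T)
  initial_integrable : IntegrableOn (fun x => η (u₀ x)) cellT
  entropy_ineq : ∀ φ : ℝ → ℝ → ℝ, IsTestFunction T φ → (∀ t x, 0 ≤ φ t x) →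
    0 ≤ (∫ z in cylinder T, (η (u z.1 z.2) * deriv (fun s => φ s z.2) z.1
        + q (u z.1 z.2) * deriv (φ z.1) z.2))
      + ∫ x in cellT, η (u₀ x) * φ 0 x

/-! ### Meshes, discontinuous Galerkin spaces and the semi-discrete operator -/

/-- `a = x 0 < x 1 < ⋯ < x M = b`. -/
structure IsPartition (x : ℕ → ℝ) (M : ℕ) (a b : ℝ) : Prop where
  left : x 0 = a
  right : x M = b
  lt_succ : ∀ i < M, x i < x (i + 1)

/-- The union of the open mesh cells. -/
def meshInterior (x : ℕ → ℝ) (M : ℕ) : Set ℝ := ⋃ i ∈ Finset.range M, Ioo (x i) (x (i + 1))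

/-- The maximal mesh size. -/
def meshSize (x : ℕ → ℝ) (M : ℕ) : ℝ := ⨆ i : Fin M, (x (i + 1) - x i)

/-- Functions that are on each open mesh cell polynomial of degree `< n` (so that
the space of degree `≤ k` is `dgSpace x M (k + 1)`, and `dgSpace x M 0` is the zero space). -/
def dgSpace {m : ℕ} (x : ℕ → ℝ) (M n : ℕ) : Set (ℝ → State m) :=
  {v | ∀ i < M, ∃ p : Fin m → Polynomial ℝ, (∀ j, (p j).degree < n) ∧
    ∀ y ∈ Ioo (x i) (x (i + 1)), ∀ j, v y j = (p j).eval y}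

/-- The trace `v(x_i^-)`, where the nodes `x 0` and `x M` are identified. -/
def traceL {m : ℕ} (x : ℕ → ℝ) (M : ℕ) (v : ℝ → State m) (i : ℕ) : State m :=
  if i = 0 then Function.leftLim v (x M) else Function.leftLim v (x i)

/-- The trace `v(x_i^+)`, for `i < M`. -/
def traceR {m : ℕ} (x : ℕ → ℝ) (v : ℝ → State m) (i : ℕ) : State m :=
  Function.rightLim v (x i)

/-- The conditions on the function `w` that underlies the numerical flux. -/
structure IsFluxState {m : ℕ} (U : Set (State m)) (w : State m → State m → State m) : Prop where
  mapsTo : ∀ a ∈ U, ∀ b ∈ U, w a b ∈ U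
  locallyLipschitz : LocallyLipschitzOn (U ×ˢ U) (fun z : State m × State m => w z.1 z.2)
  consistent : ∀ K : Set (State m), IsCompact K → K ⊆ U → ∃ C : ℝ, 0 < C ∧
    ∀ a ∈ K, ∀ b ∈ K, ‖w a b - a‖ + ‖w a b - b‖ ≤ C * ‖a - b‖

/-- The numerical flux `G` (on a mesh of size `h`) has one of the two forms
(i) `G(a, b) = g(w(a, b))`, (ii) `G(a, b) = g(w(a, b)) - μ(a, b; h) h^ν (b - a)`. -/
def IsNumericalFlux {m : ℕ} (U : Set (State m)) (g : State m → State m)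
    (w : State m → State m → State m) (h : ℝ) (G : State m → State m → State m) : Prop :=
  (∀ a ∈ U, ∀ b ∈ U, G a b = g (w a b)) ∨
  ∃ (ν : ℕ) (μ : State m → State m → ℝ → (State m →L[ℝ] State m)),
    (∀ K : Set (State m), IsCompact K → K ⊆ U → ∃ C : ℝ, 0 < C ∧ ∃ h₀ : ℝ, 0 < h₀ ∧
      ∀ h' : ℝ, 0 < h' → h' < h₀ → ∀ a ∈ K, ∀ b ∈ K, ‖μ a b h'‖ ≤ C * (1 + ‖b - a‖ / h')) ∧
    ∀ a ∈ U, ∀ b ∈ U, G a b = g (w a b) - h ^ ν • μ a b h (b - a)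

/-- `fv = f(v)` for the spatial DG operator `f` on piecewise polynomials of degree `≤ k`. -/
def IsDGOperator {m : ℕ} (x : ℕ → ℝ) (M k : ℕ) (g : State m → State m)
    (G : State m → State m → State m) (v fv : ℝ → State m) : Prop :=
  fv ∈ dgSpace x M (k + 1) ∧ ∀ ψ ∈ dgSpace (m := m) x M (k + 1),
    ∫ y in cellT, inner ℝ (fv y) (ψ y) =
      - (∑ i ∈ Finset.range M, ∫ y in x i..x (i + 1), inner ℝ (g (v y)) (deriv ψ y))
      + ∑ i ∈ Finset.range M,
          inner ℝ (G (traceL x M v i) (traceR x v i)) (traceL x M ψ i - traceR x ψ i)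

/-! ### Reconstruction in time and in space-time -/

/-- Data for Hermite interpolation in time of the discrete solution `uh`: `F l j` is the value
prescribed for the `l`-th time derivative at the `j`-th time level.  The values for `l = 0` and
`l = 1` are `uh j` and `- f (uh j)`; those for `l ≥ 2` are the higher derivatives determined by
the semi-discrete scheme or any approximations of these, hence arbitrary here. -/
structure IsHermiteData {m : ℕ} (x : ℕ → ℝ) (M k N : ℕ) (g : State m → State m)
    (G : State m → State m → State m) (uh : ℕ → ℝ → State m) (F : ℕ → ℕ → ℝ → State m) :
    Prop where
  mem : ∀ l, ∀ j ≤ N, F l j ∈ dgSpace x M (k + 1)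
  zero : ∀ j ≤ N, F 0 j = uh j
  one : ∀ j ≤ N, IsDGOperator x M k g G (uh j) (fun y => - F 1 j y)

/-- `P` is a polynomial in time of degree `≤ deg` with values in the DG space of degree `≤ k`. -/
def IsTimePolynomial {m : ℕ} (x : ℕ → ℝ) (M k deg : ℕ) (P : ℝ → ℝ → State m) : Prop :=
  ∃ c : ℕ → ℝ → State m, (∀ l, c l ∈ dgSpace x M (k + 1)) ∧
    ∀ s y, P s y = ∑ l ∈ Finset.range (deg + 1), s ^ l • c l y

/-- `ut` is an `H(p, d, r)` reconstruction in time with data `F`: on `[tₙ, tₙ₊₁]` it is a polynomial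
of degree `≤ (d + 2) (p + 1) + r + 1` which (when extended to `ℝ`) has the prescribed values and
first `d + 1` derivatives at `tₙ₋ₚ, …, tₙ` and the prescribed value and first `r + 1` derivatives
at `tₙ₊₁`.  On the first `p` intervals, where there are not enough previous time levels, only the
degree and the values at the end points are fixed. -/
def IsTimeReconstruction {m : ℕ} (x : ℕ → ℝ) (M k : ℕ) (t : ℕ → ℝ) (N p d r : ℕ)
    (F : ℕ → ℕ → ℝ → State m) (ut : ℝ → ℝ → State m) : Prop :=
  ∀ n < N, ∃ P : ℝ → ℝ → State m,
    IsTimePolynomial x M k ((d + 2) * (p + 1) + r + 1) P ∧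
    (∀ s ∈ Icc (t n) (t (n + 1)), ∀ y ∈ meshInterior x M, ut s y = P s y) ∧
    (∀ y ∈ meshInterior x M, P (t n) y = F 0 n y ∧ P (t (n + 1)) y = F 0 (n + 1) y) ∧
    (p ≤ n → ∀ y ∈ meshInterior x M,
      (∀ j, n - p ≤ j → j ≤ n → ∀ l ≤ d + 1,
        iteratedDeriv l (fun s => P s y) (t j) = F l j y) ∧
      (∀ l ≤ r + 1, iteratedDeriv l (fun s => P s y) (t (n + 1)) = F l (n + 1) y))

/-- `ust` is the space-time reconstruction belonging to `ut` and `w`. -/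
structure IsSpaceTimeReconstruction {m : ℕ} (x : ℕ → ℝ) (M k : ℕ) (T : ℝ)
    (w : State m → State m → State m) (ut ust : ℝ → ℝ → State m) : Prop where
  mem : ∀ s ∈ Icc 0 T, ust s ∈ dgSpace x M (k + 2)
  orthogonal : ∀ s ∈ Icc 0 T, ∀ ψ ∈ dgSpace (m := m) x M k,
    ∫ y in cellT, inner ℝ (ust s y - ut s y) (ψ y) = 0
  trace_left : ∀ s ∈ Icc 0 T, ∀ i < M,
    traceL x M (ust s) i = w (traceL x M (ut s) i) (traceR x (ut s) i)
  trace_right : ∀ s ∈ Icc 0 T, ∀ i < M,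
    traceR x (ust s) i = w (traceL x M (ut s) i) (traceR x (ut s) i)

/-- The residual `∂ₜ v + ∂ₓ g(v)` (defined almost everywhere for Lipschitz continuous `v`). -/
def residual {m : ℕ} (g : State m → State m) (v : ℝ → ℝ → State m) (z : ℝ × ℝ) : State m :=
  deriv (fun s => v s z.2) z.1 + deriv (fun y => g (v z.1 y)) z.2

end DGRec

end

/-! The proof is the relative entropy method. Let `V` be Lipschitz, periodic in space, with values
in `K`. Test the entropy inequality with `θ(t) ≥ 0`, test the weak form with the covector field `θ
Dη(V)`, and subtract: this is an inequality for η(u | V) = η(u) - η(V) - Dη(V)(u - V). Its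
right-hand side contains the derivatives of `V` only through Hη(V)(V_t, u - V) + Hη(V)(V_x, g(u) -
g(V)). Since Hη symmetrizes Dg (`hessian_compatible`), this equals Hη(V)(R, u - V) plus Hη(V)
applied to V_x and the quadratic Taylor remainder of `g`, where R = V_t + Dg(V) V_x. By Taylor's
formula on the convex set `K`, η(u | V) is comparable to |u - V|², so Young's inequality bounds
everything by b(t) η(u | V) + |R|²/2 (`relEntropy_production_le`). Gronwall's argument, with the
weight exp(-∫ b) built into `θ`, gives `IsEntropySolution.stability`.

The space-time reconstruction is an admissible `V`. Its two traces at each node are the same value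
of `w`, so it is continuous and piecewise polynomial in space. On each cell, its difference to the
time reconstruction is a fixed linear expression in the differences of the end point values
(`exists_endpoint_basis`), which are Lipschitz in time because `w` is Lipschitz on `K × K`. Thus
`exists_lipschitzWith_extension` applies, and the triangle inequality gives the bound.

Low regularity has to be handled at three places. (1) `θ` and Dη(V) are only Lipschitz, while test
functions are smooth. Mollification keeps gradients bounded and makes them converge almost
everywhere (`tendsto_weakFunctional_mollify`). (2) The values of `u` are in `K` for almost every (t,
x), and `u₀` is only known to be in `U`. The upper bound for the relative entropy at time 0 needs
`u₀` in `K`, which follows from the weak form and convexity of `K` (`IsWeakSolution.initial_mem`).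
(3) `u` is only weak-* continuous in time, so |u - V|² is replaced by an affine minorant touching it
at the time of interest, for which averages in time converge. -/

noncomputable section

namespace DGRec

open Filter Topology
open scoped NNReal

/-! ### Pointwise estimates for entropies -/

section Taylor

/-- Second order Taylor bound on the unit interval. -/
lemma taylor_unit_le {φ φ' φ'' : ℝ → ℝ} {C : ℝ}
    (h : ∀ t ∈ Icc (0 : ℝ) 1, HasDerivAt φ (φ' t) t)
    (h' : ∀ t ∈ Icc (0 : ℝ) 1, HasDerivAt φ' (φ'' t) t)
    (hC : ∀ t ∈ Icc (0 : ℝ) 1, φ'' t ≤ C) : φ 1 - φ 0 - φ' 0 ≤ C / 2 := by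
  have h0 : (0 : ℝ) ∈ Icc (0 : ℝ) 1 := by simp
  have h1 : (1 : ℝ) ∈ Icc (0 : ℝ) 1 := by simp
  have key : ∀ {f f' : ℝ → ℝ}, (∀ t ∈ Icc (0 : ℝ) 1, HasDerivAt f (f' t) t) →
      (∀ t ∈ Icc (0 : ℝ) 1, f' t ≤ 0) → AntitoneOn f (Icc 0 1) := by
    intro f f' hf hf'
    refine antitoneOn_of_deriv_nonpos (convex_Icc 0 1)
      (fun t ht => (hf t ht).continuousAt.continuousWithinAt)
      (fun t ht => (hf t (interior_subset ht)).differentiableAt.differentiableWithinAt) ?_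
    intro t ht
    rw [(hf t (interior_subset ht)).deriv]
    exact hf' t (interior_subset ht)
  -- Monotonicity, used twice, replaces the integral remainder: `φ''` exists but need not be
  -- integrable, as the Hessian of the entropy is not assumed continuous.
  have a1 : AntitoneOn (fun t => φ' t - C * t) (Icc 0 1) := by
    refine key (f' := fun t => φ'' t - C) (fun t ht => ?_) (fun t ht => by linarith [hC t ht])
    convert! (h' t ht).sub ((hasDerivAt_id t).const_mul C) using 1
    simp
  have a2 : AntitoneOn (fun t => φ t - φ' 0 * t - C / 2 * t ^ 2) (Icc 0 1) := by
    refine key (f' := fun t => φ' t - φ' 0 - C * t) (fun t ht => ?_) (fun t ht => ?_)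
    · have := ((h t ht).sub ((hasDerivAt_id t).const_mul (φ' 0))).sub
        (((hasDerivAt_id t).pow 2).const_mul (C / 2))
      convert! this using 1
      simp; ring
    · have := a1 h0 ht ht.1
      simp at this
      linarith
  have := a2 h0 h1 zero_le_one
  simp at this
  linarith

lemma taylor_le {E : Type*} [NormedAddCommGroup E] [NormedSpace ℝ E] {K : Set E}
    (hK : Convex ℝ K) {f : E → ℝ} {f' : E → E →L[ℝ] ℝ} {f'' : E → E →L[ℝ] E →L[ℝ] ℝ}
    (h : ∀ c ∈ K, HasFDerivAt f (f' c) c) (h' : ∀ c ∈ K, HasFDerivAt f' (f'' c) c)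
    {a b : E} (ha : a ∈ K) (hb : b ∈ K) {C : ℝ} (hC : ∀ c ∈ K, f'' c (b - a) (b - a) ≤ C) :
    f b - f a - f' a (b - a) ≤ C / 2 := by
  have hmem : ∀ t ∈ Icc (0 : ℝ) 1, a + t • (b - a) ∈ K := fun t ht =>
    hK.add_smul_sub_mem ha hb ht
  have hline : ∀ t : ℝ, HasDerivAt (fun t : ℝ => a + t • (b - a)) (b - a) t := fun t => by
    simpa using ((hasDerivAt_id t).smul_const (b - a)).const_add a
  have := taylor_unit_le (φ := fun t => f (a + t • (b - a)))
    (φ' := fun t => f' (a + t • (b - a)) (b - a))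
    (φ'' := fun t => f'' (a + t • (b - a)) (b - a) (b - a)) (C := C)
    (fun t ht => (h _ (hmem t ht)).comp_hasDerivAt t (hline t))
    (fun t ht => by
      have h1 := (h' _ (hmem t ht)).comp_hasDerivAt t (hline t)
      have := h1.clm_apply (hasDerivAt_const t (b - a))
      simpa using this)
    (fun t ht => hC _ (hmem t ht))
  simpa using this

end Taylor

/-- The relative entropy `η(a | b)`. -/
def relEntropy {m : ℕ} (η : State m → ℝ) (a b : State m) : ℝ :=
  η a - η b - fderiv ℝ η b (a - b)

section Pointwise

variable {m : ℕ} {U K : Set (State m)} {g : State m → State m} {η q : State m → ℝ}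
  {Cg cη Cη : ℝ}

lemma IsEntropyPair.hasFDerivAt (hη : IsEntropyPair U g η q) (hU : IsOpen U) {a : State m}
    (ha : a ∈ U) : HasFDerivAt η (fderiv ℝ η a) a :=
  ((hη.contDiff_entropy.contDiffAt (hU.mem_nhds ha)).differentiableAt one_ne_zero).hasFDerivAt

lemma IsEntropyPair.hasFDerivAt_flux (hη : IsEntropyPair U g η q) (hU : IsOpen U) {a : State m}
    (ha : a ∈ U) : HasFDerivAt q (fderiv ℝ q a) a :=
  ((hη.contDiff_flux.contDiffAt (hU.mem_nhds ha)).differentiableAt one_ne_zero).hasFDerivAt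

lemma hasFDerivAt_of_contDiffOn_two (hU : IsOpen U) (hg : ContDiffOn ℝ 2 g U) {a : State m}
    (ha : a ∈ U) : HasFDerivAt g (fderiv ℝ g a) a :=
  ((hg.contDiffAt (hU.mem_nhds ha)).differentiableAt two_ne_zero).hasFDerivAt

lemma hasFDerivAt_fderiv_of_contDiffOn_two (hU : IsOpen U) (hg : ContDiffOn ℝ 2 g U)
    {a : State m} (ha : a ∈ U) :
    HasFDerivAt (fderiv ℝ g) (fderiv ℝ (fderiv ℝ g) a) a := by
  have h := (hg.contDiffAt (hU.mem_nhds ha)).fderiv_right (m := 1) (by norm_num)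
  exact (h.differentiableAt one_ne_zero).hasFDerivAt

/-- Symmetry needs only differentiability of η near `a` and of its derivative at the single point
`a`; η is not C². -/
lemma hessian_symm (hU : IsOpen U) (hη : IsEntropyPair U g η q) (hKU : K ⊆ U)
    (hC : HessianBounds K g η Cg cη Cη) {a : State m} (ha : a ∈ K) (v w : State m) :
    fderiv ℝ (fderiv ℝ η) a v w = fderiv ℝ (fderiv ℝ η) a w v := by
  refine second_derivative_symmetric_of_eventually_of_real (f := η) (f' := fderiv ℝ η) ?_
    (hC.hessian_exists a ha).hasFDerivAt v w
  filter_upwards [hU.mem_nhds (hKU ha)] with y hy using hη.hasFDerivAt hU hy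

/-- Cauchy-Schwarz for the nonnegative symmetric form H, read off from the discriminant of x ↦ H(v +
x w, v + x w). This passes from the assumed bound on the diagonal to mixed arguments with the same
constant. -/
lemma abs_hessian_le (hU : IsOpen U) (hη : IsEntropyPair U g η q) (hKU : K ⊆ U)
    (hC : HessianBounds K g η Cg cη Cη) {a : State m} (ha : a ∈ K) (v w : State m) :
    |fderiv ℝ (fderiv ℝ η) a v w| ≤ Cη * ‖v‖ * ‖w‖ := by
  set H := fderiv ℝ (fderiv ℝ η) a
  have hpos : ∀ z, 0 ≤ H z z := fun z =>
    (mul_nonneg hC.lower_pos.le (sq_nonneg _)).trans (hC.lower_bound a ha z)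
  have hq : ∀ x : ℝ, 0 ≤ H w w * (x * x) + 2 * H v w * x + H v v := by
    intro x
    have h1 := hpos (v + x • w)
    have h2 := hessian_symm hU hη hKU hC ha w v
    simp only [map_add, map_smul, add_apply, smul_apply,
      smul_eq_mul] at h1
    change H w v = H v w at h2
    rw [h2] at h1
    linarith
  have hd := discrim_le_zero hq
  unfold discrim at hd
  have h3 : H v v * H w w ≤ (Cη * ‖v‖ ^ 2) * (Cη * ‖w‖ ^ 2) :=
    mul_le_mul (hC.upper_bound a ha v) (hC.upper_bound a ha w) (hpos w)
      (mul_nonneg hC.upper_pos.le (sq_nonneg _))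
  have h0 : 0 ≤ Cη * ‖v‖ * ‖w‖ :=
    mul_nonneg (mul_nonneg hC.upper_pos.le (norm_nonneg _)) (norm_nonneg _)
  refine abs_le_of_sq_le_sq ?_ h0
  nlinarith

lemma norm_hessian_le (hU : IsOpen U) (hη : IsEntropyPair U g η q) (hKU : K ⊆ U)
    (hC : HessianBounds K g η Cg cη Cη) {a : State m} (ha : a ∈ K) :
    ‖fderiv ℝ (fderiv ℝ η) a‖ ≤ Cη :=
  ContinuousLinearMap.opNorm_le_bound₂ _ hC.upper_pos.le (fun v w => abs_hessian_le hU hη hKU hC ha v w)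

/-- Mean value inequality on the convex set `K`. This is what makes Dη(V) a Lipschitz, hence
admissible, test field. -/
lemma exists_lipschitzOnWith_fderiv_entropy (hU : IsOpen U) (hη : IsEntropyPair U g η q)
    (hK : Convex ℝ K) (hKU : K ⊆ U) (hC : HessianBounds K g η Cg cη Cη) :
    ∃ L, LipschitzOnWith L (fderiv ℝ η) K :=
  ⟨Cη.toNNReal, hK.lipschitzOnWith_of_nnnorm_fderiv_le (𝕜 := ℝ) hC.hessian_exists (fun a ha => by
    rw [← NNReal.coe_le_coe, coe_nnnorm, Real.coe_toNNReal _ hC.upper_pos.le]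
    exact norm_hessian_le hU hη hKU hC ha)⟩

/-- The Hessian of the entropy symmetrizes the Jacobian of the flux. -/
lemma hessian_compatible (hU : IsOpen U) (hg : ContDiffOn ℝ 2 g U) (hη : IsEntropyPair U g η q)
    (hKU : K ⊆ U) (hC : HessianBounds K g η Cg cη Cη) {a : State m} (ha : a ∈ K)
    (v w : State m) :
    fderiv ℝ (fderiv ℝ η) a v (fderiv ℝ g a w) = fderiv ℝ (fderiv ℝ η) a w (fderiv ℝ g a v) := by
  have hU' := hU.mem_nhds (hKU ha)
  have hcomp := (hC.hessian_exists a ha).hasFDerivAt.clm_comp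
    (hasFDerivAt_fderiv_of_contDiffOn_two hU hg (hKU ha))
  have hq : HasFDerivAt (fderiv ℝ q) _ a := hcomp.congr_of_eventuallyEq (by
    filter_upwards [hU'] with y hy using (hη.compatible y hy).symm)
  -- Differentiating Dη Dg = Dq gives D²q(v, w) = Dη D²g(v, w) + Hη(v, Dg w). The left side and the
  -- first term on the right are symmetric in v, w, so the last term is too.
  have s1 := second_derivative_symmetric_of_eventually_of_real (f := q) (by
    filter_upwards [hU'] with y hy using hη.hasFDerivAt_flux hU hy) hq v w
  have s2 := second_derivative_symmetric_of_eventually_of_real (f := g) (by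
    filter_upwards [hU'] with y hy using hasFDerivAt_of_contDiffOn_two hU hg hy)
    (hasFDerivAt_fderiv_of_contDiffOn_two hU hg (hKU ha)) v w
  simp [s2] at s1
  exact s1

lemma relEntropy_le (hU : IsOpen U) (hη : IsEntropyPair U g η q) (hK : Convex ℝ K) (hKU : K ⊆ U)
    (hC : HessianBounds K g η Cg cη Cη) {a b : State m} (ha : a ∈ K) (hb : b ∈ K) :
    relEntropy η a b ≤ Cη / 2 * ‖a - b‖ ^ 2 := by
  have := taylor_le hK (fun c hc => hη.hasFDerivAt hU (hKU hc))
    (fun c hc => (hC.hessian_exists c hc).hasFDerivAt) hb ha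
    (fun c hc => hC.upper_bound c hc (a - b))
  unfold relEntropy
  linarith

lemma le_relEntropy (hU : IsOpen U) (hη : IsEntropyPair U g η q) (hK : Convex ℝ K) (hKU : K ⊆ U)
    (hC : HessianBounds K g η Cg cη Cη) {a b : State m} (ha : a ∈ K) (hb : b ∈ K) :
    cη / 2 * ‖a - b‖ ^ 2 ≤ relEntropy η a b := by
  have := taylor_le (C := -(cη * ‖a - b‖ ^ 2)) hK (fun c hc => (hη.hasFDerivAt hU (hKU hc)).neg)
    (fun c hc => (hC.hessian_exists c hc).hasFDerivAt.neg) hb ha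
    (fun c hc => by
      rw [neg_apply, neg_apply, neg_le_neg_iff]
      exact hC.lower_bound c hc (a - b))
  unfold relEntropy
  simp only [neg_apply, Pi.neg_apply] at this
  linarith

/-- Taylor's bound is scalar, so it is applied to c ↦ ⟨z, g(c)⟩ with z the remainder itself. It
yields |z|² ≤ |z| (Cg/2) |a - b|², and |z| is divided out. -/
lemma norm_relFlux_le (hU : IsOpen U) (hg : ContDiffOn ℝ 2 g U) (hK : Convex ℝ K) (hKU : K ⊆ U)
    (hC : HessianBounds K g η Cg cη Cη) {a b : State m} (ha : a ∈ K) (hb : b ∈ K) :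
    ‖g a - g b - fderiv ℝ g b (a - b)‖ ≤ Cg / 2 * ‖a - b‖ ^ 2 := by
  set z := g a - g b - fderiv ℝ g b (a - b) with hz
  have key := taylor_le (f := fun c => innerSL ℝ z (g c))
    (f' := fun c => (innerSL ℝ z).comp (fderiv ℝ g c))
    (f'' := fun c => ((ContinuousLinearMap.compL ℝ (State m) (State m) ℝ) (innerSL ℝ z)).comp
      (fderiv ℝ (fderiv ℝ g) c)) hK
    (fun c hc => ((innerSL ℝ z).hasFDerivAt).comp c (hasFDerivAt_of_contDiffOn_two hU hg (hKU hc)))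
    (fun c hc => (((ContinuousLinearMap.compL ℝ (State m) (State m) ℝ)
      (innerSL ℝ z)).hasFDerivAt).comp c
      (hasFDerivAt_fderiv_of_contDiffOn_two hU hg (hKU hc)))
    hb ha (C := ‖z‖ * (Cg * ‖a - b‖ ^ 2)) (fun c hc => by
      simp only [ContinuousLinearMap.comp_apply, ContinuousLinearMap.compL_apply,
        innerSL_apply_apply]
      exact (real_inner_le_norm _ _).trans
        (mul_le_mul_of_nonneg_left (hC.flux_bound c hc _) (norm_nonneg _)))
  simp only [ContinuousLinearMap.comp_apply, innerSL_apply_apply, ← inner_sub_right, ← hz] at key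
  rw [real_inner_self_eq_norm_sq] at key
  rcases (norm_nonneg z).eq_or_lt with h0 | h0
  · rw [← h0]
    exact mul_nonneg (by linarith [hC.flux_nonneg]) (sq_nonneg _)
  · nlinarith

/-- The pointwise estimate behind the relative entropy inequality. -/
lemma relEntropy_production_le (hU : IsOpen U) (hg : ContDiffOn ℝ 2 g U)
    (hη : IsEntropyPair U g η q) (hK : Convex ℝ K) (hKU : K ⊆ U)
    (hC : HessianBounds K g η Cg cη Cη) {a b : State m} (ha : a ∈ K) (hb : b ∈ K)
    (vt vx : State m) {β : ℝ} (hβ : ‖vx‖ ≤ β) :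
    -(fderiv ℝ (fderiv ℝ η) b vt (a - b) + fderiv ℝ (fderiv ℝ η) b vx (g a - g b)) ≤
      (Cη * Cg * β + Cη ^ 2) / cη * relEntropy η a b + 1 / 2 * ‖vt + fderiv ℝ g b vx‖ ^ 2 := by
  set H := fderiv ℝ (fderiv ℝ η) b
  set r := vt + fderiv ℝ g b vx with hr
  set e := g a - g b - fderiv ℝ g b (a - b) with he
  -- Moving Dg from one slot of H to the other lets `vt` and `Dg vx` combine into the residual `r`,
  -- leaving only the quadratic remainder `e`.
  have hsymm : H (fderiv ℝ g b vx) (a - b) = H vx (fderiv ℝ g b (a - b)) := by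
    rw [hessian_symm hU hη hKU hC hb, hessian_compatible hU hg hη hKU hC hb]
  have e1 : -(H vt (a - b) + H vx (g a - g b)) = -(H r (a - b)) - H vx e := by
    rw [hr, he]
    simp only [map_add, map_sub, add_apply] at hsymm ⊢
    linarith
  rw [e1]
  have b1 : -(H r (a - b)) ≤ Cη * ‖r‖ * ‖a - b‖ :=
    (neg_le_abs _).trans (abs_hessian_le hU hη hKU hC hb _ _)
  have hCη := hC.upper_pos
  have hCg := hC.flux_nonneg
  have hcη := hC.lower_pos
  have hβ0 : 0 ≤ β := (norm_nonneg _).trans hβ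
  have b2 : -(H vx e) ≤ Cη * β * (Cg / 2 * ‖a - b‖ ^ 2) := by
    refine ((neg_le_abs _).trans (abs_hessian_le hU hη hKU hC hb _ _)).trans ?_
    have := norm_relFlux_le hU hg hK hKU hC ha hb
    gcongr
  have b3 := le_relEntropy hU hη hK hKU hC ha hb
  have b4 : ‖a - b‖ ^ 2 / 2 ≤ relEntropy η a b / cη := by
    rw [le_div_iff₀ hcη]; linarith
  have b5 : (Cη * Cg * β + Cη ^ 2) / cη * relEntropy η a b =
      (Cη * Cg * β + Cη ^ 2) * (relEntropy η a b / cη) := by ring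
  have b6 : (Cη * Cg * β + Cη ^ 2) * (‖a - b‖ ^ 2 / 2) ≤
      (Cη * Cg * β + Cη ^ 2) * (relEntropy η a b / cη) :=
    mul_le_mul_of_nonneg_left b4 (by positivity)
  rw [b5]
  -- Young: Cη |r| |a - b| ≤ |r|²/2 + Cη² |a - b|²/2. With `b4`, the last term produces the summand
  -- Cη²/cη of the Gronwall coefficient.
  nlinarith [sq_nonneg (‖r‖ - Cη * ‖a - b‖)]

end Pointwise

/-! ### Mollification of Lipschitz functions -/

section Mollify

variable {F : Type*} [NormedAddCommGroup F] [NormedSpace ℝ F]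

/-- A sequence of bump functions on the plane whose supports shrink to the origin. -/
def mollBump (δ : ℝ) (hδ : 0 < δ) (n : ℕ) : ContDiffBump (0 : ℝ × ℝ) where
  rIn := δ / (n + 1)
  rOut := 2 * δ / (n + 1)
  rIn_pos := by positivity
  rIn_lt_rOut := by
    have : (0 : ℝ) < n + 1 := by positivity
    gcongr
    linarith

lemma mollBump_rOut_le {δ : ℝ} (hδ : 0 < δ) (n : ℕ) : (mollBump δ hδ n).rOut ≤ 2 * δ := by
  change 2 * δ / (n + 1) ≤ 2 * δ
  apply div_le_self (by positivity)
  linarith [(Nat.cast_nonneg n : (0 : ℝ) ≤ n)]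

lemma tendsto_mollBump_rOut {δ : ℝ} (hδ : 0 < δ) :
    Tendsto (fun n => (mollBump δ hδ n).rOut) atTop (𝓝 0) := by
  have := (tendsto_one_div_add_atTop_nhds_zero_nat (𝕜 := ℝ)).const_mul (2 * δ)
  simpa [mollBump, div_eq_mul_inv] using this

/-- The mollifications of a function on the plane. -/
def mollify (δ : ℝ) (hδ : 0 < δ) (n : ℕ) (φ : ℝ × ℝ → F) (z : ℝ × ℝ) : F :=
  ∫ w, (mollBump δ hδ n).normed volume w • φ (z - w)

lemma mollify_eq_convolution (δ : ℝ) (hδ : 0 < δ) (n : ℕ) (φ : ℝ × ℝ → F) (z : ℝ × ℝ) :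
    mollify δ hδ n φ z = MeasureTheory.convolution ((mollBump δ hδ n).normed volume) φ
      (ContinuousLinearMap.lsmul ℝ ℝ) volume z := rfl

lemma normed_mollBump_eq_zero {δ : ℝ} (hδ : 0 < δ) (n : ℕ) {w : ℝ × ℝ} (hw : 2 * δ ≤ ‖w‖) :
    (mollBump δ hδ n).normed volume w = 0 := by
  rw [← Function.notMem_support, ContDiffBump.support_normed_eq]
  simp only [Metric.mem_ball, dist_zero_right, not_lt]
  exact (mollBump_rOut_le hδ n).trans hw

variable {φ : ℝ × ℝ → F} {L : ℝ≥0} {δ : ℝ}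

lemma contDiff_mollify (hδ : 0 < δ) (n : ℕ) (hφ : LipschitzWith L φ) :
    ContDiff ℝ (⊤ : ℕ∞) (mollify δ hδ n φ) :=
  (mollBump δ hδ n).hasCompactSupport_normed.contDiff_convolution_left
    (ContinuousLinearMap.lsmul ℝ ℝ) (ContDiffBump.contDiff_normed _)
    hφ.continuous.locallyIntegrable

/-- Convolution commutes with translations, so periodicity survives; the kernel has radius at most
2δ, so the support in time grows by at most 2δ and still ends before `T`. -/
lemma isTestFunction_mollify {T t₁ : ℝ} (hδ : 0 < δ) (hT : t₁ + 2 * δ < T) (n : ℕ)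
    (hφ : LipschitzWith L φ) (hper : ∀ t x, φ (t, x + 2) = φ (t, x))
    (hsupp : ∀ t x, t₁ ≤ t → φ (t, x) = 0) :
    IsTestFunction T (fun t x => mollify δ hδ n φ (t, x)) where
  smooth := contDiff_mollify hδ n hφ
  periodic t x := by
    unfold mollify
    congr 1 with w
    congr 1
    have := hper (t - w.1) (x - w.2)
    rwa [sub_add_eq_add_sub] at this
  support := by
    refine ⟨t₁ + 2 * δ, hT, fun t ht x => ?_⟩
    unfold mollify
    refine integral_eq_zero_of_ae (Eventually.of_forall fun w => ?_)
    by_cases hw : 2 * δ ≤ ‖w‖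
    · simp [normed_mollBump_eq_zero hδ n hw]
    · have h1 : w.1 ≤ ‖w‖ := (le_abs_self _).trans (norm_fst_le w)
      have : φ ((t, x) - w) = 0 := hsupp (t - w.1) (x - w.2) (by linarith)
      simp [this]

variable [CompleteSpace F]

lemma norm_mollify_sub_le (hδ : 0 < δ) (n : ℕ) (hφ : LipschitzWith L φ) (z : ℝ × ℝ) :
    ‖mollify δ hδ n φ z - φ z‖ ≤ L * (2 * δ) := by
  rw [← dist_eq_norm, mollify_eq_convolution]
  refine ContDiffBump.dist_normed_convolution_le hφ.continuous.aestronglyMeasurable ?_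
  intro x hx
  refine (hφ.dist_le_mul x z).trans ?_
  gcongr
  exact (Metric.mem_ball.1 hx).le.trans (mollBump_rOut_le hδ n)

lemma tendsto_mollify (hδ : 0 < δ) (hφ : LipschitzWith L φ) (z : ℝ × ℝ) :
    Tendsto (fun n => mollify δ hδ n φ z) atTop (𝓝 (φ z)) :=
  ContDiffBump.convolution_tendsto_right_of_continuous (tendsto_mollBump_rOut hδ) hφ.continuous z

variable [FiniteDimensional ℝ F]

/-- The derivative is put on `φ` instead of the kernel: by Rademacher `φ` is differentiable at
almost every z - w, and its Lipschitz constant dominates the difference quotients. Gradients of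
mollifications are thus averages of the gradient of `φ`. -/
lemma hasFDerivAt_mollify (hδ : 0 < δ) (n : ℕ) (hφ : LipschitzWith L φ) (z : ℝ × ℝ) :
    HasFDerivAt (mollify δ hδ n φ) (mollify δ hδ n (fderiv ℝ φ) z) z := by
  set ρ := (mollBump δ hδ n).normed (volume : Measure (ℝ × ℝ)) with hρ
  have hρc : Continuous ρ := (mollBump δ hδ n).continuous_normed
  have hint : Integrable ρ := (mollBump δ hδ n).integrable_normed
  have hcont : ∀ x : ℝ × ℝ, Continuous (fun w => ρ w • φ (x - w)) := fun x =>
    hρc.smul (hφ.continuous.comp (continuous_const.sub continuous_id))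
  refine (hasFDerivAt_integral_of_dominated_loc_of_lip (s := univ) (bound := fun w => ρ w * L)
    (F := fun x w => ρ w • φ (x - w)) (F' := fun w => ρ w • fderiv ℝ φ (z - w))
    univ_mem (Eventually.of_forall fun x => (hcont x).aestronglyMeasurable) ?_ ?_ ?_
    (hint.mul_const _) ?_).2
  · exact (hcont z).integrable_of_hasCompactSupport
      ((mollBump δ hδ n).hasCompactSupport_normed.smul_right)
  · exact hρc.aestronglyMeasurable.smul
      ((measurable_fderiv ℝ φ).comp (measurable_const.sub measurable_id)).aestronglyMeasurable
  · refine Eventually.of_forall fun w => ?_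
    rw [lipschitzOnWith_univ]
    refine LipschitzWith.of_dist_le_mul fun x y => ?_
    have h0 : 0 ≤ ρ w * L := mul_nonneg (ContDiffBump.nonneg_normed _ _) L.2
    rw [Real.coe_nnabs, abs_of_nonneg h0, dist_eq_norm, ← smul_sub, norm_smul, ← dist_eq_norm,
      Real.norm_of_nonneg (ContDiffBump.nonneg_normed _ _), mul_assoc]
    refine mul_le_mul_of_nonneg_left ?_ (ContDiffBump.nonneg_normed _ _)
    simpa using hφ.dist_le_mul (x - w) (y - w)
  · have h := (Measure.measurePreserving_sub_left (volume : Measure (ℝ × ℝ)) z).quasiMeasurePreserving.ae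
      (hφ.ae_differentiableAt)
    filter_upwards [h] with w hw
    have h1 : HasFDerivAt (fun x => φ (x - w)) (fderiv ℝ φ (z - w)) z := by
      have := hw.hasFDerivAt.comp z ((hasFDerivAt_id z).sub_const w)
      rwa [ContinuousLinearMap.comp_id] at this
    exact h1.const_smul (ρ w)

/-- The average differs from the gradient at `z` by at most 2L, and that gradient is at most L. The
factor 3 is crude; only uniformity in `n` matters, for dominated convergence. -/
lemma norm_fderiv_mollify_le (hδ : 0 < δ) (n : ℕ) (hφ : LipschitzWith L φ) (z : ℝ × ℝ) :
    ‖fderiv ℝ (mollify δ hδ n φ) z‖ ≤ 3 * L := by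
  rw [(hasFDerivAt_mollify hδ n hφ z).fderiv]
  have hb : ∀ x, ‖fderiv ℝ φ x‖ ≤ L := fun x => norm_fderiv_le_of_lipschitz ℝ hφ
  have h : dist (mollify δ hδ n (fderiv ℝ φ) z) (fderiv ℝ φ z) ≤ 2 * L := by
    rw [mollify_eq_convolution]
    refine ContDiffBump.dist_normed_convolution_le
      (measurable_fderiv ℝ φ).aestronglyMeasurable fun x _ => ?_
    rw [dist_eq_norm]
    linarith [norm_sub_le (fderiv ℝ φ x) (fderiv ℝ φ z), hb x, hb z]
  rw [dist_eq_norm] at h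
  linarith [norm_le_norm_sub_add (mollify δ hδ n (fderiv ℝ φ) z) (fderiv ℝ φ z), hb z]

lemma ae_tendsto_fderiv_mollify (hδ : 0 < δ) (hφ : LipschitzWith L φ) :
    ∀ᵐ z, Tendsto (fun n => fderiv ℝ (mollify δ hδ n φ) z) atTop (𝓝 (fderiv ℝ φ z)) := by
  have hloc : LocallyIntegrable (fderiv ℝ φ) (volume : Measure (ℝ × ℝ)) :=
    (locallyIntegrable_const (L : ℝ)).mono (measurable_fderiv ℝ φ).aestronglyMeasurable
      (Eventually.of_forall fun x => by
        simpa using norm_fderiv_le_of_lipschitz ℝ hφ)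
  -- Lebesgue differentiation; it needs a bounded ratio of outer to inner radii of the bumps, here
  -- always 2.
  have := ContDiffBump.ae_convolution_tendsto_right_of_locallyIntegrable (K := 2)
    (tendsto_mollBump_rOut hδ) (Eventually.of_forall fun n => by
      change 2 * δ / (n + 1) ≤ 2 * (δ / (n + 1))
      rw [mul_div_assoc]) hloc
  filter_upwards [this] with z hz
  simp_rw [fun n => (hasFDerivAt_mollify hδ n hφ z).fderiv]
  exact hz

lemma mollify_nonneg {φ : ℝ × ℝ → ℝ} (hδ : 0 < δ) (n : ℕ) (hφ : ∀ z, 0 ≤ φ z) (z : ℝ × ℝ) :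
    0 ≤ mollify δ hδ n φ z :=
  integral_nonneg fun _ => mul_nonneg (ContDiffBump.nonneg_normed _ _) (hφ _)

end Mollify

/-! ### Integration over the space-time cylinder -/

instance isFiniteMeasure_cellT : IsFiniteMeasure (volume.restrict cellT) := by
  unfold cellT; infer_instance

lemma measurableSet_cellT : MeasurableSet cellT := measurableSet_Ioo

lemma measurableSet_cylinder (T : ℝ) : MeasurableSet (cylinder T) :=
  measurableSet_Ioo.prod measurableSet_cellT

lemma restrict_cylinder (T : ℝ) : (volume : Measure (ℝ × ℝ)).restrict (cylinder T) =
    (volume.restrict (Ioo 0 T)).prod (volume.restrict cellT) := by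
  unfold cylinder
  rw [Measure.prod_restrict]
  rfl

instance isFiniteMeasure_cylinder (T : ℝ) :
    IsFiniteMeasure ((volume : Measure (ℝ × ℝ)).restrict (cylinder T)) := by
  rw [restrict_cylinder]; infer_instance

lemma aestronglyMeasurable_clm_apply {α E F : Type*} [MeasurableSpace α] {μ : Measure α}
    [NormedAddCommGroup E] [NormedSpace ℝ E] [NormedAddCommGroup F] [NormedSpace ℝ F]
    {A : α → E →L[ℝ] F} {v : α → E} (hA : AEStronglyMeasurable A μ)
    (hv : AEStronglyMeasurable v μ) : AEStronglyMeasurable (fun z => A z (v z)) μ :=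
  isBoundedBilinearMap_apply.continuous.comp_aestronglyMeasurable (hA.prodMk hv)

lemma ae_prod_swap {P : ℝ × ℝ → Prop} (h : ∀ᵐ z : ℝ × ℝ, P z) :
    ∀ᵐ x : ℝ, ∀ᵐ t : ℝ, P (t, x) := by
  have h2 := (Measure.measurePreserving_swap (μ := (volume : Measure ℝ))
    (ν := (volume : Measure ℝ))).quasiMeasurePreserving.ae h
  exact Measure.ae_ae_of_ae_prod h2

lemma hasDerivAt_fst_of_hasFDerivAt {F : Type*} [NormedAddCommGroup F] [NormedSpace ℝ F]
    {f : ℝ × ℝ → F} {f' : ℝ × ℝ →L[ℝ] F} {t x : ℝ} (h : HasFDerivAt f f' (t, x)) :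
    HasDerivAt (fun s => f (s, x)) (f' (1, 0)) t :=
  HasFDerivAt.comp_hasDerivAt (f := fun s => (s, x)) t h ((hasDerivAt_id t).prodMk (hasDerivAt_const t x))

lemma hasDerivAt_snd_of_hasFDerivAt {F : Type*} [NormedAddCommGroup F] [NormedSpace ℝ F]
    {f : ℝ × ℝ → F} {f' : ℝ × ℝ →L[ℝ] F} {t x : ℝ} (h : HasFDerivAt f f' (t, x)) :
    HasDerivAt (fun y => f (t, y)) (f' (0, 1)) x :=
  HasFDerivAt.comp_hasDerivAt (f := fun y => (t, y)) x h ((hasDerivAt_const x t).prodMk (hasDerivAt_id x))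

lemma integrable_fderiv_apply {F : Type*} [NormedAddCommGroup F] [NormedSpace ℝ F]
    [FiniteDimensional ℝ F]
    {f : ℝ × ℝ → F} {L : ℝ≥0} (hf : LipschitzWith L f) (v : ℝ × ℝ) (T : ℝ) :
    IntegrableOn (fun z => fderiv ℝ f z v) (cylinder T) := by
  have : CompleteSpace F := FiniteDimensional.complete ℝ F
  let _ : MeasurableSpace F := borel F
  have : BorelSpace F := ⟨rfl⟩
  refine Integrable.of_bound (C := L * ‖v‖)
    (measurable_fderiv_apply_const ℝ f v).aestronglyMeasurable
    (Eventually.of_forall fun z => ?_)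
  exact (ContinuousLinearMap.le_opNorm _ _).trans
    (mul_le_mul_of_nonneg_right (norm_fderiv_le_of_lipschitz ℝ hf) (norm_nonneg _))

lemma integral_deriv_Ioo_of_lipschitz {f : ℝ → ℝ} {L : ℝ≥0} (hf : LipschitzWith L f) {a b : ℝ}
    (hab : a ≤ b) : ∫ t in Ioo a b, deriv f t = f b - f a := by
  rw [← integral_Ioc_eq_integral_Ioo, ← intervalIntegral.integral_of_le hab]
  exact ((hf.lipschitzOnWith (s := uIcc a b)).absolutelyContinuousOnInterval).integral_deriv_eq_sub

lemma LipschitzWith.comp_prodMk_left {F : Type*} [PseudoEMetricSpace F] {f : ℝ × ℝ → F} {L : ℝ≥0}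
    (hf : LipschitzWith L f) (x : ℝ) : LipschitzWith L (fun t => f (t, x)) := by
  have := hf.comp (LipschitzWith.prodMk_right x)
  rwa [mul_one] at this

lemma LipschitzWith.comp_prodMk_right {F : Type*} [PseudoEMetricSpace F] {f : ℝ × ℝ → F} {L : ℝ≥0}
    (hf : LipschitzWith L f) (t : ℝ) : LipschitzWith L (fun x => f (t, x)) := by
  have := hf.comp (LipschitzWith.prodMk_left t)
  rwa [mul_one] at this

/-- Fubini with time innermost. By Rademacher almost every line is differentiable at almost every
time, and a Lipschitz function of one variable is absolutely continuous, so the fundamental theorem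
of calculus applies. -/
lemma integral_cylinder_fderiv_time {f : ℝ × ℝ → ℝ} {L : ℝ≥0} (hf : LipschitzWith L f) {T : ℝ}
    (hT : 0 ≤ T) :
    ∫ z in cylinder T, fderiv ℝ f z (1, 0) = ∫ x in cellT, (f (T, x) - f (0, x)) := by
  have hint := integrable_fderiv_apply hf (1, 0) T
  unfold IntegrableOn at hint
  rw [restrict_cylinder] at hint ⊢
  rw [integral_prod_symm _ hint]
  refine integral_congr_ae (ae_restrict_of_ae ?_)
  filter_upwards [ae_prod_swap hf.ae_differentiableAt] with x hx
  rw [← integral_deriv_Ioo_of_lipschitz (LipschitzWith.comp_prodMk_left hf x) hT]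
  refine integral_congr_ae (ae_restrict_of_ae ?_)
  filter_upwards [hx] with t ht
  exact (hasDerivAt_fst_of_hasFDerivAt ht.hasFDerivAt).deriv.symm

lemma integral_cylinder_fderiv_space {f : ℝ × ℝ → ℝ} {L : ℝ≥0} (hf : LipschitzWith L f)
    (hper : ∀ t x, f (t, x + 2) = f (t, x)) (T : ℝ) :
    ∫ z in cylinder T, fderiv ℝ f z (0, 1) = 0 := by
  have hint := integrable_fderiv_apply hf (0, 1) T
  unfold IntegrableOn at hint
  rw [restrict_cylinder] at hint ⊢
  rw [integral_prod _ hint]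
  refine integral_eq_zero_of_ae (ae_restrict_of_ae ?_)
  filter_upwards [Measure.ae_ae_of_ae_prod (hf.ae_differentiableAt (μ := volume))] with t ht
  have h1 := integral_deriv_Ioo_of_lipschitz (LipschitzWith.comp_prodMk_right hf t)
    (show (-1 : ℝ) ≤ 1 by norm_num)
  have h2 : f (t, 1) - f (t, -1) = 0 := by
    have := hper t (-1)
    norm_num at this
    rw [this, sub_self]
  rw [h2] at h1
  rw [Pi.zero_apply]
  refine Eq.trans ?_ h1
  refine integral_congr_ae (ae_restrict_of_ae ?_)
  filter_upwards [ht] with x hx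
  exact (hasDerivAt_snd_of_hasFDerivAt hx.hasFDerivAt).deriv.symm

/-! ### Weak formulations with Lipschitz continuous test functions -/

section WeakFunctional

variable {F : Type*} [NormedAddCommGroup F] [NormedSpace ℝ F]

/-- The functional on test functions that defines a weak formulation. -/
def weakFunctional (T : ℝ) (A₁ A₂ : ℝ × ℝ → F →L[ℝ] ℝ) (A₀ : ℝ → F →L[ℝ] ℝ) (φ : ℝ × ℝ → F) : ℝ :=
  (∫ z in cylinder T, (A₁ z (fderiv ℝ φ z (1, 0)) + A₂ z (fderiv ℝ φ z (0, 1))))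
    + ∫ x in cellT, A₀ x (φ (0, x))

variable [FiniteDimensional ℝ F]

/-- Dominated convergence: gradients are bounded uniformly in `n` and converge almost everywhere,
initial values converge everywhere. Identities and inequalities for smooth test functions thus pass
to Lipschitz ones. -/
lemma tendsto_weakFunctional_mollify {T δ : ℝ} (hδ : 0 < δ) {A₁ A₂ : ℝ × ℝ → F →L[ℝ] ℝ}
    {A₀ : ℝ → F →L[ℝ] ℝ} (h₁ : IntegrableOn A₁ (cylinder T)) (h₂ : IntegrableOn A₂ (cylinder T))
    (h₀ : IntegrableOn A₀ cellT) {φ : ℝ × ℝ → F} {L : ℝ≥0} (hφ : LipschitzWith L φ) :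
    Tendsto (fun n => weakFunctional T A₁ A₂ A₀ (mollify δ hδ n φ)) atTop
      (𝓝 (weakFunctional T A₁ A₂ A₀ φ)) := by
  have : CompleteSpace F := FiniteDimensional.complete ℝ F
  let _ : MeasurableSpace F := borel F
  have : BorelSpace F := ⟨rfl⟩
  have hm : ∀ (f : ℝ × ℝ → F) (v : ℝ × ℝ), AEStronglyMeasurable (fun z => fderiv ℝ f z v)
      (volume.restrict (cylinder T)) := fun f v =>
    (measurable_fderiv_apply_const ℝ f v).aestronglyMeasurable
  have hb : ∀ n z (v : ℝ × ℝ), ‖v‖ = 1 → ‖fderiv ℝ (mollify δ hδ n φ) z v‖ ≤ 3 * L := by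
    intro n z v hv
    refine (ContinuousLinearMap.le_opNorm _ _).trans ?_
    rw [hv, mul_one]
    exact norm_fderiv_mollify_le hδ n hφ z
  have e1 : ‖((1 : ℝ), (0 : ℝ))‖ = 1 := by simp [Prod.norm_def]
  have e2 : ‖((0 : ℝ), (1 : ℝ))‖ = 1 := by simp [Prod.norm_def]
  refine Tendsto.add ?_ ?_
  · refine tendsto_integral_of_dominated_convergence (fun z => ‖A₁ z‖ * (3 * L) + ‖A₂ z‖ * (3 * L))
      (fun n => ?_) ((h₁.norm.mul_const _).add (h₂.norm.mul_const _)) (fun n => ?_) ?_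
    · exact (aestronglyMeasurable_clm_apply h₁.aestronglyMeasurable (hm _ _)).add
        (aestronglyMeasurable_clm_apply h₂.aestronglyMeasurable (hm _ _))
    · refine Eventually.of_forall fun z => (norm_add_le _ _).trans (add_le_add ?_ ?_)
      · exact (ContinuousLinearMap.le_opNorm _ _).trans
          (mul_le_mul_of_nonneg_left (hb n z _ e1) (norm_nonneg _))
      · exact (ContinuousLinearMap.le_opNorm _ _).trans
          (mul_le_mul_of_nonneg_left (hb n z _ e2) (norm_nonneg _))
    · refine ae_restrict_of_ae ?_
      filter_upwards [ae_tendsto_fderiv_mollify hδ hφ] with z hz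
      have hv : ∀ v, Tendsto (fun n => fderiv ℝ (mollify δ hδ n φ) z v) atTop
          (𝓝 (fderiv ℝ φ z v)) := fun v =>
        ((ContinuousLinearMap.apply ℝ F v).continuous.tendsto _).comp hz
      exact (((A₁ z).continuous.tendsto _).comp (hv _)).add
        (((A₂ z).continuous.tendsto _).comp (hv _))
  · refine tendsto_integral_of_dominated_convergence
      (fun x => ‖A₀ x‖ * (L * (2 * δ) + L + ‖φ (0, 0)‖))
      (fun n => ?_) (h₀.norm.mul_const _) (fun n => ?_) ?_
    · exact aestronglyMeasurable_clm_apply h₀.aestronglyMeasurable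
        ((contDiff_mollify hδ n hφ).continuous.comp (by fun_prop)).aestronglyMeasurable
    · filter_upwards [ae_restrict_mem measurableSet_cellT] with x hx
      refine (ContinuousLinearMap.le_opNorm _ _).trans
          (mul_le_mul_of_nonneg_left ?_ (norm_nonneg _))
      have h1 := norm_mollify_sub_le hδ n hφ (0, x)
      have h2 := hφ.dist_le_mul (0, x) (0, 0)
      rw [dist_eq_norm, dist_eq_norm] at h2
      have h3 : ‖((0 : ℝ), x) - (0, 0)‖ ≤ 1 := by
        have hx' := abs_le.2 ⟨hx.1.le, hx.2.le⟩
        simpa [Prod.norm_def] using hx'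
      have h4 : (L : ℝ) * ‖((0 : ℝ), x) - (0, 0)‖ ≤ L * 1 := by gcongr
      have h5 := norm_le_norm_sub_add (mollify δ hδ n φ (0, x)) (φ (0, x))
      have h6 := norm_le_norm_sub_add (φ (0, x)) (φ (0, 0))
      linarith
    · exact Eventually.of_forall fun x =>
        ((A₀ x).continuous.tendsto _).comp (tendsto_mollify hδ hφ _)

end WeakFunctional

section WeakForms

variable {m : ℕ} {U K : Set (State m)} {g : State m → State m} {η q : State m → ℝ}
  {T : ℝ} {u₀ : ℝ → State m} {u : ℝ → ℝ → State m}

/-- The vector representing a linear functional. -/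
def rieszVec (m : ℕ) : (State m →L[ℝ] ℝ) →L[ℝ] State m :=
  ∑ i, (ContinuousLinearMap.apply ℝ ℝ (EuclideanSpace.basisFun (Fin m) ℝ i)).smulRight
    (EuclideanSpace.basisFun (Fin m) ℝ i)

lemma inner_rieszVec (v : State m) (ℓ : State m →L[ℝ] ℝ) : inner ℝ v (rieszVec m ℓ) = ℓ v := by
  unfold rieszVec
  simp only [sum_apply, ContinuousLinearMap.smulRight_apply,
    ContinuousLinearMap.apply_apply, inner_sum, inner_smul_right]
  conv_rhs => rw [← (EuclideanSpace.basisFun (Fin m) ℝ).sum_repr v]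
  simp only [map_sum, map_smul, smul_eq_mul, OrthonormalBasis.repr_apply_apply]
  refine Finset.sum_congr rfl fun i _ => ?_
  rw [mul_comm, real_inner_comm]

lemma IsTestFunction.hasDerivAt_time {V : Type*} [NormedAddCommGroup V] [NormedSpace ℝ V]
    {φ : ℝ × ℝ → V} (hφ : IsTestFunction T (fun t x => φ (t, x))) (z : ℝ × ℝ) :
    HasDerivAt (fun s => φ (s, z.2)) (fderiv ℝ φ z (1, 0)) z.1 :=
  hasDerivAt_fst_of_hasFDerivAt (t := z.1) (x := z.2)
    ((hφ.smooth.differentiable (by simp)) z).hasFDerivAt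

lemma IsTestFunction.hasDerivAt_space {V : Type*} [NormedAddCommGroup V] [NormedSpace ℝ V]
    {φ : ℝ × ℝ → V} (hφ : IsTestFunction T (fun t x => φ (t, x))) (z : ℝ × ℝ) :
    HasDerivAt (fun y => φ (z.1, y)) (fderiv ℝ φ z (0, 1)) z.2 :=
  hasDerivAt_snd_of_hasFDerivAt (t := z.1) (x := z.2)
    ((hφ.smooth.differentiable (by simp)) z).hasFDerivAt

lemma integrable_of_ae_mem_compact (hK : IsCompact K)
    (hmeas : AEStronglyMeasurable (fun z : ℝ × ℝ => u z.1 z.2) (volume.restrict (cylinder T)))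
    (huK : ∀ᵐ z ∂(volume.restrict (cylinder T)), u z.1 z.2 ∈ K) :
    IntegrableOn (fun z : ℝ × ℝ => u z.1 z.2) (cylinder T) := by
  obtain ⟨C, hC⟩ := hK.isBounded.exists_norm_le
  exact Integrable.of_bound (C := C) hmeas (huK.mono fun z hz => hC _ hz)

lemma IsInitialDatum.integrable (hu₀ : IsInitialDatum U u₀) : IntegrableOn u₀ cellT := by
  obtain ⟨C, hC⟩ := hu₀.bounded
  exact Integrable.of_bound (C := C) hu₀.meas hC

lemma exists_pos_add_lt {a b : ℝ} (h : a < b) : ∃ δ : ℝ, 0 < δ ∧ a + 2 * δ < b :=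
  ⟨(b - a) / 4, by linarith, by linarith⟩

/-- The weak formulation, tested with a Lipschitz continuous function. -/
lemma IsWeakSolution.weak_form_lipschitz (hu : IsWeakSolution U g T u₀ u)
    (hu₀ : IsInitialDatum U u₀) (hint : IntegrableOn (fun z : ℝ × ℝ => u z.1 z.2) (cylinder T))
    {φ : ℝ × ℝ → State m} {L : ℝ≥0} (hφ : LipschitzWith L φ)
    (hper : ∀ t x, φ (t, x + 2) = φ (t, x)) {t₁ : ℝ} (ht₁ : t₁ < T)
    (hsupp : ∀ t x, t₁ ≤ t → φ (t, x) = 0) :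
    (∫ z in cylinder T, (inner ℝ (u z.1 z.2) (fderiv ℝ φ z (1, 0))
      + inner ℝ (g (u z.1 z.2)) (fderiv ℝ φ z (0, 1))))
      + ∫ x in cellT, inner ℝ (u₀ x) (φ (0, x)) = 0 := by
  obtain ⟨δ, hδ, hδT⟩ := exists_pos_add_lt ht₁
  have hlim := tendsto_weakFunctional_mollify (T := T) hδ
    (A₁ := fun z => innerSL ℝ (u z.1 z.2)) (A₂ := fun z => innerSL ℝ (g (u z.1 z.2)))
    (A₀ := fun x => innerSL ℝ (u₀ x))
    ((innerSL ℝ (E := State m)).integrable_comp hint)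
    ((innerSL ℝ (E := State m)).integrable_comp hu.flux_integrable)
    ((innerSL ℝ (E := State m)).integrable_comp hu₀.integrable) hφ
  refine tendsto_nhds_unique hlim ?_
  refine tendsto_const_nhds.congr fun n => ?_
  have htest := isTestFunction_mollify hδ hδT n hφ hper hsupp
  have h := hu.weak_form _ htest
  have hd1 : ∀ z : ℝ × ℝ, deriv (fun s => mollify δ hδ n φ (s, z.2)) z.1 =
      fderiv ℝ (mollify δ hδ n φ) z (1, 0) := fun z => (htest.hasDerivAt_time z).deriv
  have hd2 : ∀ z : ℝ × ℝ, deriv (fun y => mollify δ hδ n φ (z.1, y)) z.2 =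
      fderiv ℝ (mollify δ hδ n φ) z (0, 1) := fun z => (htest.hasDerivAt_space z).deriv
  simp only [hd1, hd2] at h
  exact h.symm

/-- The weak formulation, tested with a Lipschitz continuous field of linear functionals. -/
lemma IsWeakSolution.weak_form_dual (hu : IsWeakSolution U g T u₀ u)
    (hu₀ : IsInitialDatum U u₀) (hint : IntegrableOn (fun z : ℝ × ℝ => u z.1 z.2) (cylinder T))
    {Φ : ℝ × ℝ → State m →L[ℝ] ℝ} {L : ℝ≥0} (hΦ : LipschitzWith L Φ)
    (hper : ∀ t x, Φ (t, x + 2) = Φ (t, x)) {t₁ : ℝ} (ht₁ : t₁ < T)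
    (hsupp : ∀ t x, t₁ ≤ t → Φ (t, x) = 0) :
    (∫ z in cylinder T, (fderiv ℝ Φ z (1, 0) (u z.1 z.2)
      + fderiv ℝ Φ z (0, 1) (g (u z.1 z.2)))) + ∫ x in cellT, Φ (0, x) (u₀ x) = 0 := by
  have h := hu.weak_form_lipschitz hu₀ hint ((rieszVec m).lipschitz.comp hΦ)
    (fun t x => by simp only [Function.comp_apply, hper]) ht₁
    (fun t x ht => by simp only [Function.comp_apply, hsupp t x ht, map_zero])
  simp only [Function.comp_apply, inner_rieszVec] at h
  refine Eq.trans ?_ h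
  congr 1
  refine integral_congr_ae (ae_restrict_of_ae ?_)
  filter_upwards [hΦ.ae_differentiableAt] with z hz
  have hd : fderiv ℝ (⇑(rieszVec m) ∘ Φ) z = (rieszVec m).comp (fderiv ℝ Φ z) :=
    ((rieszVec m).hasFDerivAt.comp z hz.hasFDerivAt).fderiv
  simp only [hd, ContinuousLinearMap.comp_apply, inner_rieszVec]

/-- The entropy inequality, tested with a Lipschitz continuous function. -/
lemma IsEntropySolution.entropy_ineq_lipschitz (hu : IsEntropySolution U g η q T u₀ u)
    {φ : ℝ × ℝ → ℝ} {L : ℝ≥0} (hφ : LipschitzWith L φ) (hpos : ∀ z, 0 ≤ φ z)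
    (hper : ∀ t x, φ (t, x + 2) = φ (t, x)) {t₁ : ℝ} (ht₁ : t₁ < T)
    (hsupp : ∀ t x, t₁ ≤ t → φ (t, x) = 0) :
    0 ≤ (∫ z in cylinder T, (η (u z.1 z.2) * fderiv ℝ φ z (1, 0)
      + q (u z.1 z.2) * fderiv ℝ φ z (0, 1))) + ∫ x in cellT, η (u₀ x) * φ (0, x) := by
  obtain ⟨δ, hδ, hδT⟩ := exists_pos_add_lt ht₁
  let ev := ContinuousLinearMap.lsmul ℝ ℝ (E := ℝ)
  have hlim := tendsto_weakFunctional_mollify (T := T) hδ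
    (A₁ := fun z => ev (η (u z.1 z.2))) (A₂ := fun z => ev (q (u z.1 z.2)))
    (A₀ := fun x => ev (η (u₀ x)))
    (ev.integrable_comp hu.entropy_integrable) (ev.integrable_comp hu.entropyFlux_integrable)
    (ev.integrable_comp hu.initial_integrable) hφ
  refine ge_of_tendsto' hlim fun n => ?_
  have htest := isTestFunction_mollify hδ hδT n hφ hper hsupp
  have h := hu.entropy_ineq _ htest (fun t x => mollify_nonneg hδ n hpos _)
  have hd1 : ∀ z : ℝ × ℝ, deriv (fun s => mollify δ hδ n φ (s, z.2)) z.1 =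
      fderiv ℝ (mollify δ hδ n φ) z (1, 0) := fun z => (htest.hasDerivAt_time z).deriv
  have hd2 : ∀ z : ℝ × ℝ, deriv (fun y => mollify δ hδ n φ (z.1, y)) z.2 =
      fderiv ℝ (mollify δ hδ n φ) z (0, 1) := fun z => (htest.hasDerivAt_space z).deriv
  simp only [hd1, hd2] at h
  exact h

end WeakForms

/-! ### Gluing and periodic extension of Lipschitz functions -/

section Glue

variable {F : Type*} [PseudoMetricSpace F] {f : ℝ → F} {L : ℝ≥0}

lemma LipschitzOnWith.glue {a b c : ℝ}
    (h₁ : LipschitzOnWith L f (Icc a b)) (h₂ : LipschitzOnWith L f (Icc b c)) :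
    LipschitzOnWith L f (Icc a c) := by
  have key : ∀ y ∈ Icc a c, ∀ z ∈ Icc a c, y ≤ z → dist (f y) (f z) ≤ L * dist y z := by
    intro y hy z hz hyz
    rcases le_total z b with h | h
    · exact h₁.dist_le_mul _ ⟨hy.1, hyz.trans h⟩ _ ⟨hz.1, h⟩
    rcases le_total b y with h' | h'
    · exact h₂.dist_le_mul _ ⟨h', hy.2⟩ _ ⟨h, hz.2⟩
    have d1 := h₁.dist_le_mul y ⟨hy.1, h'⟩ b ⟨hy.1.trans h', le_rfl⟩
    have d2 := h₂.dist_le_mul b ⟨le_rfl, h.trans hz.2⟩ z ⟨h, hz.2⟩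
    rw [Real.dist_eq, abs_of_nonpos (by linarith)] at d1 d2 ⊢
    have := dist_triangle (f y) (f b) (f z)
    nlinarith
  refine LipschitzOnWith.of_dist_le_mul fun y hy z hz => ?_
  rcases le_total y z with h | h
  · exact key y hy z hz h
  · rw [dist_comm (f y), dist_comm y]
    exact key z hz y hy h

lemma IsPartition.lipschitzOnWith {x : ℕ → ℝ} {M : ℕ} {a b : ℝ} (hx : IsPartition x M a b)
    (h : ∀ i < M, LipschitzOnWith L f (Icc (x i) (x (i + 1)))) :
    LipschitzOnWith L f (Icc a b) := by
  have : ∀ i ≤ M, LipschitzOnWith L f (Icc (x 0) (x i)) := by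
    intro i
    induction i with
    | zero => intro _; rw [Icc_self]; simp [LipschitzOnWith]
    | succ i ih => intro hi; exact LipschitzOnWith.glue (ih (by omega)) (h i (by omega))
  have := this M le_rfl
  rwa [hx.left, hx.right] at this

/-- The 2-periodic extension of a function on `[-1, 1)`. -/
def periodize (f : ℝ → F) (y : ℝ) : F := f (toIcoMod (two_pos : (0 : ℝ) < 2) (-1) y)

lemma periodize_add_two {F : Type*} (f : ℝ → F) (y : ℝ) : periodize f (y + 2) = periodize f y := by
  unfold periodize
  rw [toIcoMod_add_right]

lemma periodize_eq {F : Type*} (f : ℝ → F) {y : ℝ} (hy : y ∈ Ico (-1 : ℝ) 1) : periodize f y = f y := by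
  unfold periodize
  rw [(toIcoMod_eq_self _).2]
  rwa [show (-1 : ℝ) + 2 = 1 by norm_num]

lemma lipschitzWith_periodize (hf : LipschitzOnWith L f (Icc (-1) 1)) (h : f 1 = f (-1)) :
    LipschitzWith L (periodize f) := by
  have hp2 : (0 : ℝ) < 2 := two_pos
  have key : ∀ y z : ℝ, y ≤ z → dist (periodize f y) (periodize f z) ≤ L * dist y z := by
    intro y z hyz
    unfold periodize
    have my := toIcoMod_mem_Ico hp2 (-1) y
    have mz := toIcoMod_mem_Ico hp2 (-1) z
    have ey := toIcoMod_add_toIcoDiv_zsmul hp2 (-1) y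
    have ez := toIcoMod_add_toIcoDiv_zsmul hp2 (-1) z
    set p := toIcoMod hp2 (-1) y
    set r := toIcoMod hp2 (-1) z
    set k := toIcoDiv hp2 (-1) y
    set l := toIcoDiv hp2 (-1) z
    simp only [zsmul_eq_mul] at ey ez
    have e1 : (-1 : ℝ) + 2 = 1 := by norm_num
    rw [e1] at my mz
    rw [Real.dist_eq y z, abs_of_nonpos (by linarith)]
    have hkl : k ≤ l := by
      by_contra hlt
      have : (l : ℝ) + 1 ≤ k := by exact_mod_cast (not_le.1 hlt)
      linarith [my.1, mz.2]
    rcases hkl.eq_or_lt with hkl | hkl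
    · have d := hf.dist_le_mul p ⟨my.1, my.2.le⟩ r ⟨mz.1, mz.2.le⟩
      rw [hkl] at ey
      rwa [Real.dist_eq, abs_of_nonpos (by linarith), show -(p - r) = -(y - z) by linarith] at d
    -- The points are in different periods: go from `p` to the end point 1, identify it with -1, go
    -- on to `r`. This path is no longer than z - y because at least one full period separates the
    -- representatives.
    · have hkl' : (k : ℝ) + 1 ≤ l := by exact_mod_cast hkl
      have d1 := hf.dist_le_mul p ⟨my.1, my.2.le⟩ 1 ⟨by norm_num, le_rfl⟩
      have d2 := hf.dist_le_mul (-1) ⟨le_rfl, by norm_num⟩ r ⟨mz.1, mz.2.le⟩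
      rw [Real.dist_eq, abs_of_nonpos (by linarith [my.2])] at d1
      rw [Real.dist_eq, abs_of_nonpos (by linarith [mz.1])] at d2
      have tri := dist_triangle (f p) (f 1) (f r)
      rw [h] at tri d1
      have : (L : ℝ) * (-(p - 1) + -(-1 - r)) ≤ L * -(y - z) :=
        mul_le_mul_of_nonneg_left (by linarith) L.2
      linarith
  refine LipschitzWith.of_dist_le_mul fun y z => ?_
  rcases le_total y z with h | h
  · exact key y z h
  · rw [dist_comm (periodize f y), dist_comm y]
    exact key z y h

end Glue

/-! ### Cut-off functions in time -/

/-- The piecewise linear function that is `1` on `(-∞, a]` and `0` on `[b, ∞)`. -/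
def cutoff (a b t : ℝ) : ℝ := max 0 (min 1 ((b - t) / (b - a)))

section Cutoff

variable {a b : ℝ}

lemma cutoff_nonneg (a b t : ℝ) : 0 ≤ cutoff a b t := le_max_left _ _

lemma cutoff_le_one (a b t : ℝ) : cutoff a b t ≤ 1 := max_le zero_le_one (min_le_left _ _)

lemma lipschitzWith_cutoff (hab : a < b) : LipschitzWith (1 / (b - a)).toNNReal (cutoff a b) := by
  have h0 : 0 < b - a := by linarith
  have : LipschitzWith (1 / (b - a)).toNNReal (fun t => (b - t) / (b - a)) := by
    refine LipschitzWith.of_dist_le_mul fun s t => ?_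
    rw [Real.coe_toNNReal _ (by positivity), Real.dist_eq, Real.dist_eq, ← sub_div, abs_div,
      abs_of_pos h0, abs_sub_comm s t]
    ring_nf
    exact le_rfl
  exact (this.const_min 1).const_max 0

lemma cutoff_eq_one (hab : a < b) {t : ℝ} (ht : t ≤ a) : cutoff a b t = 1 := by
  have h0 : 0 < b - a := by linarith
  unfold cutoff
  rw [min_eq_left, max_eq_right zero_le_one]
  rw [le_div_iff₀ h0]; linarith

lemma cutoff_eq_zero (hab : a < b) {t : ℝ} (ht : b ≤ t) : cutoff a b t = 0 := by
  have h0 : 0 < b - a := by linarith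
  unfold cutoff
  refine max_eq_left ((min_le_right _ _).trans ?_)
  exact div_nonpos_of_nonpos_of_nonneg (by linarith) h0.le

lemma cutoff_eq_div {t : ℝ} (ht : t ∈ Ioo a b) : cutoff a b t = (b - t) / (b - a) := by
  have h0 : 0 < b - a := by linarith [ht.1, ht.2]
  unfold cutoff
  rw [min_eq_right, max_eq_right]
  · exact div_nonneg (by linarith [ht.2]) h0.le
  · rw [div_le_one h0]; linarith [ht.1]

lemma hasDerivAt_cutoff (hab : a < b) {t : ℝ} (ha : t ≠ a) (hb : t ≠ b) :
    HasDerivAt (cutoff a b) (indicator (Ioo a b) (fun _ => -(b - a)⁻¹) t) t := by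
  rcases lt_or_gt_of_ne ha with h | h
  · rw [indicator_of_notMem (fun hm => absurd hm.1 (not_lt.2 h.le))]
    refine (hasDerivAt_const t (1 : ℝ)).congr_of_eventuallyEq ?_
    filter_upwards [Iio_mem_nhds h] with s hs using cutoff_eq_one hab (le_of_lt hs)
  rcases lt_or_gt_of_ne hb with h' | h'
  · rw [indicator_of_mem (show t ∈ Ioo a b from ⟨h, h'⟩)]
    have : HasDerivAt (fun s => (b - s) / (b - a)) (-(b - a)⁻¹) t := by
      have := ((hasDerivAt_id t).const_sub b).div_const (b - a)
      convert! this using 1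
      rw [neg_div, one_div]
    refine this.congr_of_eventuallyEq ?_
    filter_upwards [Ioo_mem_nhds h h'] with s hs using cutoff_eq_div hs
  · rw [indicator_of_notMem (fun hm => absurd hm.2 (not_lt.2 h'.le))]
    refine (hasDerivAt_const t (0 : ℝ)).congr_of_eventuallyEq ?_
    filter_upwards [Ioi_mem_nhds h'] with s hs using cutoff_eq_zero hab (le_of_lt hs)

end Cutoff

/-! ### Products of bounded Lipschitz functions -/

lemma lipschitzWith_bilin {X E F G : Type*} [PseudoMetricSpace X] [NormedAddCommGroup E]
    [NormedSpace ℝ E] [NormedAddCommGroup F] [NormedSpace ℝ F] [NormedAddCommGroup G]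
    [NormedSpace ℝ G] (B : E →L[ℝ] F →L[ℝ] G) {f : X → E} {h : X → F} {L₁ L₂ : ℝ≥0} {C₁ C₂ : ℝ}
    (hf : LipschitzWith L₁ f) (hh : LipschitzWith L₂ h) (bf : ∀ x, ‖f x‖ ≤ C₁)
    (bh : ∀ x, ‖h x‖ ≤ C₂) : ∃ L, LipschitzWith L (fun x => B (f x) (h x)) := by
  refine ⟨(‖B‖ * (C₁ * L₂ + L₁ * C₂)).toNNReal, LipschitzWith.of_dist_le_mul fun x y => ?_⟩
  have hC₁ : 0 ≤ C₁ := (norm_nonneg _).trans (bf x)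
  have hC₂ : 0 ≤ C₂ := (norm_nonneg _).trans (bh x)
  rw [Real.coe_toNNReal _ (by positivity), dist_eq_norm]
  have e : B (f x) (h x) - B (f y) (h y) = B (f x) (h x - h y) + B (f x - f y) (h y) := by
    simp only [map_sub, sub_apply]; abel
  rw [e]
  have d1 : ‖B (f x) (h x - h y)‖ ≤ ‖B‖ * C₁ * (L₂ * dist x y) := by
    refine (B.le_opNorm₂ _ _).trans ?_
    have := bf x
    have := hh.dist_le_mul x y
    rw [dist_eq_norm] at this
    gcongr
  have d2 : ‖B (f x - f y) (h y)‖ ≤ ‖B‖ * (L₁ * dist x y) * C₂ := by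
    refine (B.le_opNorm₂ _ _).trans ?_
    have := bh y
    have := hf.dist_le_mul x y
    rw [dist_eq_norm] at this
    gcongr
  refine (norm_add_le _ _).trans ?_
  linarith

/-! ### The initial datum takes its values in the convex set `K` -/

lemma measureReal_cylinder {t : ℝ} (ht : 0 ≤ t) : volume.real (cylinder t) = 2 * t := by
  unfold cylinder cellT
  rw [Measure.real, Measure.volume_eq_prod, Measure.prod_prod, ENNReal.toReal_mul, Real.volume_Ioo,
    Real.volume_Ioo, ENNReal.toReal_ofReal (by linarith), ENNReal.toReal_ofReal (by norm_num)]
  ring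

lemma cylinder_subset {s t : ℝ} (h : s ≤ t) : cylinder s ⊆ cylinder t :=
  prod_mono (Ioo_subset_Ioo_right h) subset_rfl

lemma ae_fst_ne (b : ℝ) : ∀ᵐ z : ℝ × ℝ, z.1 ≠ b :=
  (Measure.quasiMeasurePreserving_fst (μ := (volume : Measure ℝ)) (ν := (volume : Measure ℝ))).ae
    (Measure.ae_ne volume b)

section Initial

variable {m : ℕ} {U K : Set (State m)} {g : State m → State m}
  {T : ℝ} {u₀ : ℝ → State m} {u : ℝ → ℝ → State m}

/-- Test with ψ(x) times a ramp falling from 1 to 0 on (0, δ), in the direction ℓ. The ramp turns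
the time term into an average of ψ ℓ(u), with ℓ(u) ≤ c, and the flux term is O(δ) since the test
function lives on (0, δ). Let δ tend to 0. -/
lemma IsWeakSolution.initial_halfspace (hu : IsWeakSolution U g T u₀ u)
    (hu₀ : IsInitialDatum U u₀) (hT : 0 < T) (hK : IsCompact K) (hg : ContinuousOn g K)
    (huK : ∀ᵐ z ∂(volume.restrict (cylinder T)), u z.1 z.2 ∈ K)
    (ℓ : State m →L[ℝ] ℝ) {c : ℝ} (hc : ∀ a ∈ K, ℓ a ≤ c)
    {ψ : ℝ → ℝ} {L : ℝ≥0} (hψ : LipschitzWith L ψ) (hψ0 : ∀ y, 0 ≤ ψ y)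
    (hψp : ∀ y, ψ (y + 2) = ψ y) {Cψ : ℝ} (hψb : ∀ y, ψ y ≤ Cψ) :
    ∫ x in cellT, ψ x * ℓ (u₀ x) ≤ c * ∫ x in cellT, ψ x := by
  have hint := integrable_of_ae_mem_compact hK hu.meas huK
  obtain ⟨C, hC⟩ := (hK.image_of_continuousOn (ℓ.continuous.comp_continuousOn hg)).isBounded.exists_norm_le
  have hC0 : ∀ a ∈ K, |ℓ (g a)| ≤ max C 0 := fun a ha =>
    (hC _ (mem_image_of_mem _ ha)).trans (le_max_left _ _)
  have hψb' : ∀ y, ‖ψ y‖ ≤ Cψ := fun y => by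
    rw [Real.norm_of_nonneg (hψ0 y)]; exact hψb y
  have key : ∀ δ ∈ Ioo 0 T, ∫ x in cellT, ψ x * ℓ (u₀ x) ≤
      c * (∫ x in cellT, ψ x) + L * max C 0 * (2 * δ) := by
    intro δ hδ
    set f : ℝ × ℝ → ℝ := fun z => cutoff 0 δ z.1 * ψ z.2 with hf
    have hcut := (lipschitzWith_cutoff hδ.1)
    obtain ⟨L', hfL⟩ : ∃ L', LipschitzWith L' f :=
      lipschitzWith_bilin (ContinuousLinearMap.mul ℝ ℝ) (hcut.comp LipschitzWith.prod_fst)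
        (hψ.comp LipschitzWith.prod_snd) (C₁ := 1) (C₂ := Cψ)
        (fun z => by
          rw [Real.norm_of_nonneg (cutoff_nonneg _ _ _)]
          exact cutoff_le_one _ _ _)
        (fun z => hψb' _)
    have hfper : ∀ t x, f (t, x + 2) = f (t, x) := fun t x => by simp only [hf, hψp]
    have hfsupp : ∀ t x, δ ≤ t → f (t, x) = 0 := fun t x ht => by
      simp only [hf, cutoff_eq_zero hδ.1 ht, zero_mul]
    let A : ℝ →L[ℝ] State m →L[ℝ] ℝ := (ContinuousLinearMap.id ℝ ℝ).smulRight ℓ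
    have hA : ∀ r v, A r v = r * ℓ v := fun r v => by simp [A]
    have hw := hu.weak_form_dual hu₀ hint (A.lipschitz.comp hfL)
      (fun t x => by simp only [Function.comp_apply, hfper]) hδ.2
      (fun t x ht => by simp only [Function.comp_apply, hfsupp t x ht, map_zero])
    have hFt := integral_cylinder_fderiv_time hfL hT.le
    have hdf : ∀ᵐ z : ℝ × ℝ, fderiv ℝ (⇑A ∘ f) z = A.comp (fderiv ℝ f z) := by
      filter_upwards [hfL.ae_differentiableAt] with z hz
      exact (A.hasFDerivAt.comp z hz.hasFDerivAt).fderiv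
    have hw' : (∫ z in cylinder T, (fderiv ℝ f z (1, 0) * ℓ (u z.1 z.2)
        + fderiv ℝ f z (0, 1) * ℓ (g (u z.1 z.2)))) + ∫ x in cellT, ψ x * ℓ (u₀ x) = 0 := by
      refine Eq.trans ?_ hw
      congr 1
      · refine integral_congr_ae (ae_restrict_of_ae ?_)
        filter_upwards [hdf] with z hz
        simp only [hz, ContinuousLinearMap.comp_apply, hA]
      · simp only [Function.comp_apply, hA, hf, cutoff_eq_one hδ.1 le_rfl, one_mul]
    have hi1 := integrable_fderiv_apply hfL (1, 0) T
    have hi2 := integrable_fderiv_apply hfL (0, 1) T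
    have hind : Integrable (indicator (cylinder δ) (fun _ => L * max C 0 : ℝ × ℝ → ℝ))
        (volume.restrict (cylinder T)) :=
      (integrable_const _).indicator (measurableSet_cylinder δ)
    -- Pointwise minorant: ∂ₜ f ≤ 0 reverses ℓ(u) ≤ c, and ∂ₓ f is bounded by L for t < δ and zero
    -- afterwards. The integral of c ∂ₜ f is known exactly.
    have hle : ∫ z in cylinder T, (c * fderiv ℝ f z (1, 0) -
          indicator (cylinder δ) (fun _ => L * max C 0 : ℝ × ℝ → ℝ) z) ≤
        ∫ z in cylinder T, (fderiv ℝ f z (1, 0) * ℓ (u z.1 z.2)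
        + fderiv ℝ f z (0, 1) * ℓ (g (u z.1 z.2))) := by
      refine integral_mono_ae ((hi1.const_mul c).sub hind) ?_ ?_
      · obtain ⟨C₁, hC₁⟩ := (hK.image_of_continuousOn ℓ.continuous.continuousOn).isBounded.exists_norm_le
        refine Integrable.add ?_ ?_
        · refine hi1.mul_bdd (c := C₁)
            (ℓ.continuous.comp_aestronglyMeasurable hint.aestronglyMeasurable) ?_
          filter_upwards [huK] with z hz using hC₁ _ (mem_image_of_mem _ hz)
        · refine hi2.mul_bdd (c := C)
            (ℓ.continuous.comp_aestronglyMeasurable hu.flux_integrable.aestronglyMeasurable) ?_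
          filter_upwards [huK] with z hz using hC _ (mem_image_of_mem _ hz)
      · filter_upwards [huK, ae_restrict_mem (measurableSet_cylinder T),
          ae_restrict_of_ae (hfL.ae_differentiableAt), ae_restrict_of_ae (ae_fst_ne δ)]
          with z hz hzT hzd hzδ
        have d1 := hasDerivAt_fst_of_hasFDerivAt (t := z.1) (x := z.2) hzd.hasFDerivAt
        have d2 := hasDerivAt_snd_of_hasFDerivAt (t := z.1) (x := z.2) hzd.hasFDerivAt
        have d1' := (hasDerivAt_cutoff hδ.1 hzT.1.1.ne' hzδ).mul_const (ψ z.2)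
        have e1 := d1.unique d1'
        have hneg : fderiv ℝ f z (1, 0) ≤ 0 := by
          rw [e1]
          refine mul_nonpos_of_nonpos_of_nonneg ?_ (hψ0 _)
          refine indicator_nonpos (fun _ _ => ?_) _
          have := hδ.1
          simp only [sub_zero, Left.neg_nonpos_iff]
          positivity
        have h1 : c * fderiv ℝ f z (1, 0) ≤ fderiv ℝ f z (1, 0) * ℓ (u z.1 z.2) := by
          rw [mul_comm]
          exact mul_le_mul_of_nonpos_left (hc _ hz) hneg
        have h2 : -indicator (cylinder δ) (fun _ => L * max C 0 : ℝ × ℝ → ℝ) z ≤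
            fderiv ℝ f z (0, 1) * ℓ (g (u z.1 z.2)) := by
          by_cases hzc : z.1 < δ
          · rw [indicator_of_mem (show z ∈ cylinder δ from ⟨⟨hzT.1.1, hzc⟩, hzT.2⟩)]
            have hl : LipschitzWith L (fun y => f (z.1, y)) := by
              refine LipschitzWith.of_dist_le_mul fun y y' => ?_
              simp only [hf]
              rw [Real.dist_eq, ← mul_sub, abs_mul, abs_of_nonneg (cutoff_nonneg _ _ _)]
              have := hψ.dist_le_mul y y'
              rw [Real.dist_eq] at this
              refine le_trans ?_ this
              exact mul_le_of_le_one_left (abs_nonneg _) (cutoff_le_one _ _ _)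
            have hb := norm_deriv_le_of_lipschitz (x₀ := z.2) hl
            rw [d2.deriv, Real.norm_eq_abs] at hb
            refine neg_le_of_abs_le ?_
            rw [abs_mul]
            exact mul_le_mul hb (hC0 _ hz) (abs_nonneg _) L.2
          · rw [indicator_of_notMem (fun hm => hzc hm.1.2)]
            have hzero : (fun y => f (z.1, y)) = fun _ => 0 := by
              funext y
              exact hfsupp _ _ (not_lt.1 hzc)
            rw [hzero] at d2
            rw [d2.unique (hasDerivAt_const _ _)]
            simp
        linarith
    have hindval : ∫ z in cylinder T, indicator (cylinder δ) (fun _ => L * max C 0 : ℝ × ℝ → ℝ) z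
        = L * max C 0 * (2 * δ) := by
      rw [setIntegral_indicator (measurableSet_cylinder δ),
        inter_eq_self_of_subset_right (cylinder_subset hδ.2.le), setIntegral_const,
        measureReal_cylinder hδ.1.le, smul_eq_mul, mul_comm]
    rw [integral_sub (hi1.const_mul c) hind, integral_const_mul, hFt, hindval] at hle
    have hF0 : ∫ x in cellT, (f (T, x) - f (0, x)) = - ∫ x in cellT, ψ x := by
      rw [← integral_neg]
      congr 1 with x
      simp only [hf, cutoff_eq_zero hδ.1 hδ.2.le, cutoff_eq_one hδ.1 le_rfl]
      ring
    rw [hF0] at hle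
    linarith
  have hlim : Tendsto (fun δ : ℝ => c * (∫ x in cellT, ψ x) + L * max C 0 * (2 * δ)) (𝓝[>] 0)
      (𝓝 (c * (∫ x in cellT, ψ x) + L * max C 0 * (2 * 0))) := by
    refine Tendsto.mono_left ?_ nhdsWithin_le_nhds
    exact Continuous.tendsto (by fun_prop) 0
  rw [mul_zero, mul_zero, add_zero] at hlim
  refine ge_of_tendsto hlim ?_
  filter_upwards [Ioo_mem_nhdsGT hT] with δ hδ using key δ hδ

/-- A shrinking sequence of bump functions on the line. -/
def lineBump (n : ℕ) : ContDiffBump (0 : ℝ) where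
  rIn := 1 / (n + 1)
  rOut := 2 / (n + 1)
  rIn_pos := by positivity
  rIn_lt_rOut := by
    have : (0 : ℝ) < n + 1 := by positivity
    gcongr
    norm_num

lemma tendsto_lineBump_rOut : Tendsto (fun n => (lineBump n).rOut) atTop (𝓝 0) := by
  have := (tendsto_one_div_add_atTop_nhds_zero_nat (𝕜 := ℝ)).const_mul 2
  simpa [lineBump, div_eq_mul_inv] using this

/-- Local averages of `u₀` satisfy every half-space inequality valid on `K`, hence lie in the closed
convex set `K` by Hahn-Banach; by Lebesgue differentiation they converge to `u₀` almost everywhere.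
-/
lemma IsWeakSolution.initial_mem (hu : IsWeakSolution U g T u₀ u)
    (hu₀ : IsInitialDatum U u₀) (hT : 0 < T) (hK : IsCompact K) (hKc : Convex ℝ K)
    (hg : ContinuousOn g K)
    (huK : ∀ᵐ z ∂(volume.restrict (cylinder T)), u z.1 z.2 ∈ K) :
    ∀ᵐ x ∂(volume.restrict cellT), u₀ x ∈ K := by
  set v : ℝ → State m := indicator cellT u₀ with hv
  have hvint : Integrable v := (integrable_indicator_iff measurableSet_cellT).2 hu₀.integrable
  have hconv := ContDiffBump.ae_convolution_tendsto_right_of_locallyIntegrable (K := 2)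
    (φ := lineBump) tendsto_lineBump_rOut (Eventually.of_forall fun n => by
      change 2 / ((n : ℝ) + 1) ≤ 2 * (1 / (n + 1))
      rw [mul_one_div]) hvint.locallyIntegrable
  filter_upwards [ae_restrict_of_ae hconv, ae_restrict_mem measurableSet_cellT] with x hx hxc
  have hvx : v x = u₀ x := indicator_of_mem hxc _
  rw [← hvx]
  refine hK.isClosed.mem_of_tendsto hx ?_
  -- Once the bump around `x` fits into the open cell, its 2-periodic extension agrees with it on
  -- the cell and is an admissible test weight of mass one.
  obtain ⟨r, hr, hball⟩ := Metric.isOpen_iff.1 (isOpen_Ioo (a := (-1 : ℝ)) (b := 1)) x hxc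
  filter_upwards [tendsto_lineBump_rOut.eventually (gt_mem_nhds hr)] with n hn
  set ρ := (lineBump n).normed (volume : Measure ℝ) with hρ
  set p := MeasureTheory.convolution ρ v (ContinuousLinearMap.lsmul ℝ ℝ) volume x with hp
  have hρ0 : ∀ y, 0 ≤ ρ y := fun y => ContDiffBump.nonneg_normed _ _
  have hsupp : ∀ y, y ∉ cellT → ρ (x - y) = 0 := by
    intro y hy
    rw [← Function.notMem_support, ContDiffBump.support_normed_eq]
    intro hmem
    refine hy (hball ?_)
    rw [mem_ball_zero_iff] at hmem
    rw [Metric.mem_ball, dist_comm, dist_eq_norm]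
    exact hmem.trans hn
  have hpv : p = ∫ y in cellT, ρ (x - y) • u₀ y := by
    rw [hp, convolution_eq_swap, ← integral_indicator measurableSet_cellT]
    congr 1 with y : 1
    by_cases hy : y ∈ cellT
    · simp [hv, hy]
    · simp [hv, hy]
  obtain ⟨L, hL⟩ := ((lineBump n).contDiff_normed (n := 1) (μ := volume)).lipschitzWith_of_hasCompactSupport
    (lineBump n).hasCompactSupport_normed one_ne_zero
  obtain ⟨Cρ, hCρ⟩ := (lineBump n).hasCompactSupport_normed (μ := volume)
    |>.exists_bound_of_continuous (lineBump n).continuous_normed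
  have hLx : LipschitzWith L (fun y => ρ (x - y)) := by
    refine LipschitzWith.of_dist_le_mul fun y z => ?_
    have := hL.dist_le_mul (x - y) (x - z)
    rwa [dist_sub_left] at this
  set ψ := periodize (fun y => ρ (x - y)) with hψ
  have hψL : LipschitzWith L ψ := lipschitzWith_periodize hLx.lipschitzOnWith (by
    rw [hsupp 1 (by simp [cellT]), hsupp (-1) (by simp [cellT])])
  have hψeq : ∀ y ∈ cellT, ψ y = ρ (x - y) := fun y hy =>
    periodize_eq _ ⟨hy.1.le, hy.2⟩
  have hψint : ∫ y in cellT, ψ y = 1 := by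
    rw [setIntegral_congr_fun measurableSet_cellT hψeq,
      setIntegral_eq_integral_of_forall_compl_eq_zero (fun y hy => hsupp y hy),
      integral_sub_left_eq_self ρ volume x]
    exact (lineBump n).integral_normed
  by_contra hpK
  obtain ⟨ℓ, c, h1, h2⟩ := geometric_hahn_banach_closed_point hKc hK.isClosed hpK
  have h3 := hu.initial_halfspace hu₀ hT hK hg huK ℓ (fun a ha => (h1 a ha).le) hψL
    (fun y => hρ0 _) (periodize_add_two _) (Cψ := Cρ)
    (fun y => (le_abs_self _).trans (hCρ _))
  rw [hψint, mul_one] at h3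
  have hint : IntegrableOn (fun y => ρ (x - y) • u₀ y) cellT := by
    refine hu₀.integrable.bdd_smul Cρ
      (hLx.continuous.aestronglyMeasurable) ?_
    exact Eventually.of_forall fun y => hCρ _
  have h4 : ∫ y in cellT, ψ y * ℓ (u₀ y) = ℓ p := by
    rw [hpv, ← ℓ.integral_comp_comm hint]
    refine setIntegral_congr_fun measurableSet_cellT fun y hy => ?_
    simp only [hψeq y hy, map_smul, smul_eq_mul]
  linarith

end Initial

/-! ### The relative entropy inequality -/

lemma exists_lipschitzWith_comp {X Y Z : Type*} [PseudoEMetricSpace X] [PseudoEMetricSpace Y]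
    [PseudoEMetricSpace Z] {K : Set Y} {f : Y → Z} {V : X → Y} {L : ℝ≥0}
    (hf : ∃ L, LipschitzOnWith L f K) (hV : LipschitzWith L V) (hVK : ∀ z, V z ∈ K) :
    ∃ L, LipschitzWith L (fun z => f (V z)) := by
  obtain ⟨L', hL'⟩ := hf
  refine ⟨L' * L, ?_⟩
  rw [← lipschitzOnWith_univ]
  exact hL'.comp hV.lipschitzOnWith (fun z _ => hVK z)

lemma exists_bound_comp {X Y Z : Type*} [TopologicalSpace Y] [NormedAddCommGroup Z] {K : Set Y}
    {f : Y → Z} (hK : IsCompact K) (hf : ContinuousOn f K) {V : X → Y} (hVK : ∀ z, V z ∈ K) :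
    ∃ C, ∀ z, ‖f (V z)‖ ≤ C := by
  obtain ⟨C, hC⟩ := (hK.image_of_continuousOn hf).isBounded.exists_norm_le
  exact ⟨C, fun z => hC _ (mem_image_of_mem _ (hVK z))⟩

section RelativeEntropy

variable {m : ℕ} {U K : Set (State m)} {g : State m → State m} {η q : State m → ℝ}
  {Cg cη Cη : ℝ} {T : ℝ} {u₀ : ℝ → State m} {u : ℝ → ℝ → State m}

/-- The integrand of the relative entropy inequality. -/
def relEntropyIntegrand (g : State m → State m) (η : State m → ℝ) (θ : ℝ → ℝ)
    (V : ℝ × ℝ → State m) (z : ℝ × ℝ) (a : State m) : ℝ :=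
  deriv θ z.1 * relEntropy η a (V z) - θ z.1 *
    (fderiv ℝ (fderiv ℝ η) (V z) (fderiv ℝ V z (1, 0)) (a - V z)
      + fderiv ℝ (fderiv ℝ η) (V z) (fderiv ℝ V z (0, 1)) (g a - g (V z)))

/-- Product rule. The four lines are the entropy integrand with test function θ, the weak form with
test field θ Dη(V), and two exact derivatives. In the last of these Dη Dg = Dq cancels all terms
except the Hessian one. -/
lemma relEntropyIntegrand_eq (hU : IsOpen U) (hg : ContDiffOn ℝ 2 g U)
    (hη : IsEntropyPair U g η q) (hKU : K ⊆ U) (hC : HessianBounds K g η Cg cη Cη)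
    {θ : ℝ → ℝ} {V : ℝ × ℝ → State m} {z : ℝ × ℝ} (hVK : V z ∈ K)
    (hV : DifferentiableAt ℝ V z) (hθ : DifferentiableAt ℝ θ z.1) (a : State m) :
    relEntropyIntegrand g η θ V z a =
      (η a * fderiv ℝ (fun z : ℝ × ℝ => θ z.1) z (1, 0)
        + q a * fderiv ℝ (fun z : ℝ × ℝ => θ z.1) z (0, 1))
      - (fderiv ℝ (fun z : ℝ × ℝ => θ z.1 • fderiv ℝ η (V z)) z (1, 0) a
        + fderiv ℝ (fun z : ℝ × ℝ => θ z.1 • fderiv ℝ η (V z)) z (0, 1) (g a))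
      - fderiv ℝ (fun z : ℝ × ℝ => θ z.1 * (η (V z) - fderiv ℝ η (V z) (V z))) z (1, 0)
      - fderiv ℝ (fun z : ℝ × ℝ => θ z.1 * (q (V z) - fderiv ℝ η (V z) (g (V z)))) z (0, 1) := by
  have hV' := hV.hasFDerivAt
  have hθ' : HasFDerivAt (fun z : ℝ × ℝ => θ z.1)
      (deriv θ z.1 • ContinuousLinearMap.fst ℝ ℝ ℝ) z :=
    hθ.hasDerivAt.comp_hasFDerivAt z hasFDerivAt_fst
  have hΦ : HasFDerivAt (fun z => fderiv ℝ η (V z))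
      ((fderiv ℝ (fderiv ℝ η) (V z)).comp (fderiv ℝ V z)) z :=
    (hC.hessian_exists _ hVK).hasFDerivAt.comp z hV'
  have hηV : HasFDerivAt (fun z => η (V z)) ((fderiv ℝ η (V z)).comp (fderiv ℝ V z)) z :=
    (hη.hasFDerivAt hU (hKU hVK)).comp z hV'
  have hqV : HasFDerivAt (fun z => q (V z)) ((fderiv ℝ q (V z)).comp (fderiv ℝ V z)) z :=
    (hη.hasFDerivAt_flux hU (hKU hVK)).comp z hV'
  have hgV : HasFDerivAt (fun z => g (V z)) ((fderiv ℝ g (V z)).comp (fderiv ℝ V z)) z :=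
    (hasFDerivAt_of_contDiffOn_two hU hg (hKU hVK)).comp z hV'
  rw [hθ'.fderiv, (hθ'.fun_smul hΦ).fderiv, (hθ'.fun_mul (hηV.fun_sub (hΦ.clm_apply hV'))).fderiv,
    (hθ'.fun_mul (hqV.fun_sub (hΦ.clm_apply hgV))).fderiv, ← hη.compatible _ (hKU hVK)]
  simp only [relEntropyIntegrand, relEntropy, add_apply, sub_apply, smul_apply, smul_eq_mul,
    ContinuousLinearMap.comp_apply, ContinuousLinearMap.coe_fst', ContinuousLinearMap.flip_apply,
    ContinuousLinearMap.smulRight_apply, map_sub]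
  ring

/-- The relative entropy inequality for an entropy solution `u` and a Lipschitz function `V`. -/
lemma IsEntropySolution.relEntropy_ineq (hU : IsOpen U) (hg : ContDiffOn ℝ 2 g U)
    (hη : IsEntropyPair U g η q) (hK : IsCompact K) (hKc : Convex ℝ K) (hKU : K ⊆ U)
    (hC : HessianBounds K g η Cg cη Cη) (hT : 0 < T) (hu₀ : IsInitialDatum U u₀)
    (hu : IsEntropySolution U g η q T u₀ u)
    (huK : ∀ᵐ z ∂(volume.restrict (cylinder T)), u z.1 z.2 ∈ K)
    {V : ℝ × ℝ → State m} {L : ℝ≥0} (hV : LipschitzWith L V)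
    (hVper : ∀ t x, V (t, x + 2) = V (t, x)) (hVK : ∀ z, V z ∈ K)
    {θ : ℝ → ℝ} {Lθ : ℝ≥0} (hθ : LipschitzWith Lθ θ) (hθ0 : ∀ t, 0 ≤ θ t) (hθ1 : ∀ t, θ t ≤ 1)
    {t₁ : ℝ} (ht₁ : t₁ < T) (hsupp : ∀ t, t₁ ≤ t → θ t = 0) :
    IntegrableOn (fun z : ℝ × ℝ => relEntropyIntegrand g η θ V z (u z.1 z.2)) (cylinder T) ∧
    0 ≤ (∫ z in cylinder T, relEntropyIntegrand g η θ V z (u z.1 z.2))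
      + θ 0 * ∫ x in cellT, relEntropy η (u₀ x) (V (0, x)) := by
  have hint := integrable_of_ae_mem_compact hK hu.meas huK
  have hgc : ContinuousOn g K := hg.continuousOn.mono hKU
  have hηc : ContinuousOn η K := hη.contDiff_entropy.continuousOn.mono hKU
  have hqc : ContinuousOn q K := hη.contDiff_flux.continuousOn.mono hKU
  have hΦlip := exists_lipschitzOnWith_fderiv_entropy hU hη hKc hKU hC
  have hΦc : ContinuousOn (fderiv ℝ η) K := by
    obtain ⟨L', h'⟩ := hΦlip
    exact h'.continuousOn
  have hglip : ∃ L, LipschitzOnWith L g K :=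
    (hg.mono hKU).exists_lipschitzOnWith two_ne_zero hKc hK
  have hηlip : ∃ L, LipschitzOnWith L η K :=
    (hη.contDiff_entropy.mono hKU).exists_lipschitzOnWith one_ne_zero hKc hK
  have hqlip : ∃ L, LipschitzOnWith L q K :=
    (hη.contDiff_flux.mono hKU).exists_lipschitzOnWith one_ne_zero hKc hK
  obtain ⟨L₁, h₁⟩ := exists_lipschitzWith_comp hΦlip hV hVK
  obtain ⟨C₁, b₁⟩ := exists_bound_comp hK hΦc hVK
  obtain ⟨L₂, h₂⟩ := exists_lipschitzWith_comp hglip hV hVK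
  obtain ⟨C₂, b₂⟩ := exists_bound_comp hK hgc hVK
  obtain ⟨L₃, h₃⟩ := exists_lipschitzWith_comp hηlip hV hVK
  obtain ⟨C₃, b₃⟩ := exists_bound_comp hK hηc hVK
  obtain ⟨L₄, h₄⟩ := exists_lipschitzWith_comp hqlip hV hVK
  obtain ⟨C₄, b₄⟩ := exists_bound_comp hK hqc hVK
  obtain ⟨C₅, b₅⟩ := exists_bound_comp hK (f := id) continuousOn_id hVK
  simp only [id] at b₅
  have hθ2 : LipschitzWith Lθ (fun z : ℝ × ℝ => θ z.1) := by
    have := hθ.comp (LipschitzWith.prod_fst (α := ℝ) (β := ℝ))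
    rwa [mul_one] at this
  have bθ : ∀ z : ℝ × ℝ, ‖θ z.1‖ ≤ 1 := fun z => by
    rw [Real.norm_of_nonneg (hθ0 _)]; exact hθ1 _
  have bapply : ∀ (A : State m →L[ℝ] ℝ) (v : State m) (C C' : ℝ), ‖A‖ ≤ C → ‖v‖ ≤ C' →
      ‖A v‖ ≤ C * C' := fun A v C C' hA hv =>
    (A.le_opNorm v).trans (mul_le_mul hA hv (norm_nonneg _) ((norm_nonneg _).trans hA))
  -- Every function differentiated in `relEntropyIntegrand_eq` must be Lipschitz; products are,
  -- because all factors are bounded on the compact set `K`.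
  obtain ⟨L₅, h₅⟩ : ∃ L, LipschitzWith L (fun z : ℝ × ℝ => θ z.1 • fderiv ℝ η (V z)) :=
    lipschitzWith_bilin (ContinuousLinearMap.lsmul ℝ ℝ) hθ2 h₁ bθ b₁
  obtain ⟨L₆, h₆⟩ : ∃ L, LipschitzWith L (fun z : ℝ × ℝ => fderiv ℝ η (V z) (V z)) :=
    lipschitzWith_bilin (ContinuousLinearMap.id ℝ (State m →L[ℝ] ℝ)) h₁ hV b₁ b₅
  obtain ⟨L₇, h₇⟩ : ∃ L, LipschitzWith L (fun z : ℝ × ℝ => fderiv ℝ η (V z) (g (V z))) :=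
    lipschitzWith_bilin (ContinuousLinearMap.id ℝ (State m →L[ℝ] ℝ)) h₁ h₂ b₁ b₂
  obtain ⟨L₈, h₈⟩ : ∃ L, LipschitzWith L
      (fun z : ℝ × ℝ => θ z.1 * (η (V z) - fderiv ℝ η (V z) (V z))) :=
    lipschitzWith_bilin (ContinuousLinearMap.mul ℝ ℝ) hθ2 (h₃.sub h₆) bθ
      (C₂ := C₃ + C₁ * C₅)
      (fun z => (norm_sub_le _ _).trans (add_le_add (b₃ z) (bapply _ _ _ _ (b₁ z) (b₅ z))))
  obtain ⟨L₉, h₉⟩ : ∃ L, LipschitzWith L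
      (fun z : ℝ × ℝ => θ z.1 * (q (V z) - fderiv ℝ η (V z) (g (V z)))) :=
    lipschitzWith_bilin (ContinuousLinearMap.mul ℝ ℝ) hθ2 (h₄.sub h₇) bθ
      (C₂ := C₄ + C₁ * C₂)
      (fun z => (norm_sub_le _ _).trans (add_le_add (b₄ z) (bapply _ _ _ _ (b₁ z) (b₂ z))))
  have hent := hu.entropy_ineq_lipschitz hθ2 (fun z => hθ0 _) (fun _ _ => rfl) ht₁
    (fun t _ ht => hsupp t ht)
  have hweak := hu.weak_form_dual hu₀ hint h₅ (fun t x => by simp only [hVper]) ht₁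
    (fun t x ht => by simp only [hsupp t ht, zero_smul])
  have htime := integral_cylinder_fderiv_time h₈ hT.le
  have hspace := integral_cylinder_fderiv_space h₉ (fun t x => by simp only [hVper]) T
  -- θ vanishes at time `T`, so the exact time derivative leaves only its contribution at time 0;
  -- the exact space derivative has integral zero by periodicity.
  simp only [hsupp T ht₁.le, zero_mul, zero_sub] at htime
  have hd : ∀ᵐ z : ℝ × ℝ, DifferentiableAt ℝ V z ∧ DifferentiableAt ℝ θ z.1 :=
    hV.ae_differentiableAt.and ((Measure.quasiMeasurePreserving_fst
      (μ := (volume : Measure ℝ)) (ν := (volume : Measure ℝ))).ae hθ.ae_differentiableAt_real)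
  have hcongr := (ae_restrict_of_ae (s := cylinder T) hd).mono fun z hz =>
    relEntropyIntegrand_eq hU hg hη hKU hC (hVK z) hz.1 hz.2 (u z.1 z.2)
  have bfd : ∀ {F : Type} [NormedAddCommGroup F] [NormedSpace ℝ F] {f : ℝ × ℝ → F} {L : ℝ≥0},
      LipschitzWith L f → ∀ v z, ‖fderiv ℝ f z v‖ ≤ L * ‖v‖ := fun hf v z =>
    (ContinuousLinearMap.le_opNorm _ _).trans
      (mul_le_mul_of_nonneg_right (norm_fderiv_le_of_lipschitz ℝ hf) (norm_nonneg _))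
  have i1 : IntegrableOn (fun z : ℝ × ℝ => η (u z.1 z.2) * fderiv ℝ (fun z : ℝ × ℝ => θ z.1) z (1, 0)
        + q (u z.1 z.2) * fderiv ℝ (fun z : ℝ × ℝ => θ z.1) z (0, 1)) (cylinder T) :=
    (hu.entropy_integrable.mul_bdd (integrable_fderiv_apply hθ2 _ T).aestronglyMeasurable
      (Eventually.of_forall (bfd hθ2 _))).add
    (hu.entropyFlux_integrable.mul_bdd (integrable_fderiv_apply hθ2 _ T).aestronglyMeasurable
      (Eventually.of_forall (bfd hθ2 _)))
  have iclm : ∀ (v : ℝ × ℝ) {f : ℝ × ℝ → State m}, IntegrableOn f (cylinder T) →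
      IntegrableOn (fun z => fderiv ℝ (fun z : ℝ × ℝ => θ z.1 • fderiv ℝ η (V z)) z v (f z))
        (cylinder T) := by
    intro v f hf
    refine (hf.norm.const_mul (L₅ * ‖v‖)).mono' (aestronglyMeasurable_clm_apply
      (integrable_fderiv_apply h₅ v T).aestronglyMeasurable hf.aestronglyMeasurable) ?_
    exact Eventually.of_forall fun z => (ContinuousLinearMap.le_opNorm _ _).trans
      (mul_le_mul_of_nonneg_right (bfd h₅ v z) (norm_nonneg _))
  have i2 := (iclm (1, 0) hint).fun_add (iclm (0, 1) hu.flux_integrable)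
  have i3 := integrable_fderiv_apply h₈ (1, 0) T
  have i4 := integrable_fderiv_apply h₉ (0, 1) T
  refine ⟨(((i1.sub i2).sub i3).sub i4).congr (hcongr.mono fun z hz => hz.symm), ?_⟩
  rw [integral_congr_ae hcongr, integral_sub ((i1.fun_sub i2).fun_sub i3) i4,
    integral_sub (i1.fun_sub i2) i3, integral_sub i1 i2, htime, hspace]
  have hcell : ∀ {f : ℝ → ℝ}, Continuous f → IntegrableOn f cellT := fun hf =>
    (hf.continuousOn.integrableOn_Icc).mono_set Ioo_subset_Icc_self
  have ev : Continuous (fun x : ℝ => ((0 : ℝ), x)) := by fun_prop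
  have j1 : IntegrableOn (fun x => η (V (0, x)) - fderiv ℝ η (V (0, x)) (V (0, x))) cellT :=
    hcell ((h₃.continuous.comp ev).sub (h₆.continuous.comp ev))
  have j2 : IntegrableOn (fun x => fderiv ℝ η (V (0, x)) (u₀ x)) cellT := by
    refine (hu₀.integrable.norm.const_mul C₁).mono' (aestronglyMeasurable_clm_apply
      (h₁.continuous.comp ev).aestronglyMeasurable hu₀.integrable.aestronglyMeasurable) ?_
    exact Eventually.of_forall fun x => (ContinuousLinearMap.le_opNorm _ _).trans
      (mul_le_mul_of_nonneg_right (b₁ _) (norm_nonneg _))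
  have hrel : ∫ x in cellT, relEntropy η (u₀ x) (V (0, x)) = (∫ x in cellT, η (u₀ x))
      - (∫ x in cellT, (η (V (0, x)) - fderiv ℝ η (V (0, x)) (V (0, x))))
      - ∫ x in cellT, fderiv ℝ η (V (0, x)) (u₀ x) := by
    rw [← integral_sub hu.initial_integrable j1, ← integral_sub (hu.initial_integrable.fun_sub j1) j2]
    congr 1 with x
    simp only [relEntropy, map_sub]
    ring
  simp only [smul_apply, smul_eq_mul, integral_const_mul] at hweak
  dsimp only at hent
  rw [integral_mul_const] at hent
  rw [integral_neg, integral_const_mul, hrel]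
  linarith

end RelativeEntropy

/-! ### Stability of Lipschitz functions with respect to entropy solutions -/

/-- If h(τ) > c(τ), continuity separates h and c by a constant on a short interval near τ,
contradicting the bound on averages. It converts estimates with a ramp in time into estimates at
each single time, both end points included. -/
lemma le_of_forall_integral_le {h c : ℝ → ℝ} {T : ℝ} (hT : 0 < T) (hh : ContinuousOn h (Icc 0 T))
    (hc : ContinuousOn c (Icc 0 T))
    (H : ∀ a b, 0 ≤ a → a < b → b < T → ∫ t in a..b, h t ≤ (b - a) * c b) {τ : ℝ}
    (hτ : τ ∈ Icc 0 T) : h τ ≤ c τ := by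
  by_contra! hlt
  obtain ⟨r, hr1, hr2⟩ := exists_between hlt
  have ev := ((hh τ hτ).eventually (lt_mem_nhds hr2)).and ((hc τ hτ).eventually (gt_mem_nhds hr1))
  rw [eventually_nhdsWithin_iff, Metric.eventually_nhds_iff] at ev
  obtain ⟨ε, hε, hev⟩ := ev
  -- The interval used is the left half of [a, e], so its right end is strictly below `T` even for τ
  -- = T.
  set a := max 0 (τ - ε / 2) with ha
  set e := min T (τ + ε / 2) with he
  have hae : a < e := by
    rw [ha, he, max_lt_iff, lt_min_iff, lt_min_iff]
    exact ⟨⟨hT, by linarith [hτ.1]⟩, by linarith [hτ.2], by linarith⟩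
  have ha0 : 0 ≤ a := le_max_left _ _
  have ha1 : τ - ε / 2 ≤ a := le_max_right _ _
  have he0 : e ≤ T := min_le_left _ _
  have he1 : e ≤ τ + ε / 2 := min_le_right _ _
  have hb : ∀ s ∈ Icc a ((a + e) / 2), r < h s ∧ c s < r := by
    intro s hs
    refine hev (y := s) ?_ ⟨ha0.trans hs.1, by linarith [hs.2]⟩
    rw [Real.dist_eq, abs_lt]
    constructor <;> linarith [hs.1, hs.2]
  have hab : a ≤ (a + e) / 2 := by linarith
  have h1 := H a ((a + e) / 2) ha0 (by linarith) (by linarith)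
  have h2 : ∫ _ in a..((a + e) / 2), r ≤ ∫ t in a..((a + e) / 2), h t := by
    refine intervalIntegral.integral_mono_on hab intervalIntegrable_const ?_
      (fun s hs => (hb s hs).1.le)
    refine (hh.mono ?_).intervalIntegrable
    rw [uIcc_of_le hab]
    exact Icc_subset_Icc ha0 (by linarith)
  rw [intervalIntegral.integral_const, smul_eq_mul] at h2
  have h3 := (hb ((a + e) / 2) ⟨hab, le_rfl⟩).2
  nlinarith

/-- The exponential integrating factor of Gronwall's inequality. -/
lemma exists_integrating_factor {T : ℝ} (hT : 0 < T) {b : ℝ → ℝ} (hb : ContinuousOn b (Icc 0 T))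
    (hb0 : ∀ s ∈ Icc 0 T, 0 ≤ b s) :
    ∃ E : ℝ → ℝ, (∃ L, LipschitzWith L E) ∧ (∀ t, 0 ≤ E t) ∧ (∀ t, E t ≤ 1) ∧
      (∀ t ∈ Icc 0 T, E t = Real.exp (-∫ s in (0 : ℝ)..t, b s)) ∧
      ∀ t ∈ Ioo 0 T, HasDerivAt E (-(b t) * E t) t := by
  -- Continuous extension of `b` makes the primitive C¹; clamping time to [0, T] then makes the
  -- weight globally Lipschitz and at most 1.
  set b' := IccExtend hT.le ((Icc 0 T).domRestrict b) with hb'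
  have hb'c : Continuous b' := (continuousOn_iff_continuous_domRestrict.1 hb).Icc_extend'
  have hb'eq : ∀ t ∈ Icc 0 T, b' t = b t := fun t ht => IccExtend_of_mem hT.le _ ht
  have hb'0 : ∀ t, 0 ≤ b' t := fun t => hb0 _ (projIcc 0 T hT.le t).2
  set B : ℝ → ℝ := fun t => ∫ s in (0 : ℝ)..t, b' s with hB
  have hBd : ∀ t, HasDerivAt B (b' t) t := fun t => hb'c.integral_hasStrictDerivAt 0 t |>.hasDerivAt
  have hBeq : ∀ t ∈ Icc 0 T, B t = ∫ s in (0 : ℝ)..t, b s := by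
    intro t ht
    refine intervalIntegral.integral_congr fun s hs => hb'eq s ?_
    rw [uIcc_of_le ht.1] at hs
    exact ⟨hs.1, hs.2.trans ht.2⟩
  have hexp : ContDiff ℝ 1 (fun t => Real.exp (-B t)) := by
    have : ContDiff ℝ 1 B := by
      rw [contDiff_one_iff_deriv]
      refine ⟨fun t => (hBd t).differentiableAt, ?_⟩
      rwa [show deriv B = b' from funext fun t => (hBd t).deriv]
    exact this.neg.exp
  have hproj : LipschitzWith 1 (fun t => (projIcc 0 T hT.le t : ℝ)) := by
    have := (LipschitzWith.subtype_val (Icc 0 T)).comp (LipschitzWith.projIcc hT.le)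
    rwa [mul_one] at this
  have hpeq : ∀ t ∈ Icc 0 T, (projIcc 0 T hT.le t : ℝ) = t := fun t ht => by
    rw [projIcc_of_mem hT.le ht]
  refine ⟨fun t => Real.exp (-B (projIcc 0 T hT.le t)), ?_, fun t => (Real.exp_pos _).le, ?_, ?_, ?_⟩
  · exact exists_lipschitzWith_comp (f := fun t => Real.exp (-B t))
      (V := fun t => (projIcc 0 T hT.le t : ℝ))
      (hexp.contDiffOn.exists_lipschitzOnWith one_ne_zero (convex_Icc 0 T) isCompact_Icc) hproj
      (fun t => (projIcc 0 T hT.le t).2)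
  · intro t
    rw [Real.exp_le_one_iff, neg_nonpos]
    exact intervalIntegral.integral_nonneg (projIcc 0 T hT.le t).2.1 (fun s _ => hb'0 s)
  · intro t ht
    simp only [hpeq t ht, hBeq t ht]
  · intro t ht
    have h1 : HasDerivAt (fun t => Real.exp (-B t)) (Real.exp (-B t) * -b' t) t := (hBd t).neg.exp
    have ht' : t ∈ Icc 0 T := Ioo_subset_Icc_self ht
    have h2 := h1.congr_of_eventuallyEq (f₁ := fun t => Real.exp (-B (projIcc 0 T hT.le t))) (by
      filter_upwards [Ioo_mem_nhds ht.1 ht.2] with s hs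
      rw [hpeq s (Ioo_subset_Icc_self hs)])
    convert! h2 using 1
    simp only [hpeq t ht', hb'eq t ht']
    ring

section Stability

variable {m : ℕ} {U K : Set (State m)} {g : State m → State m} {η q : State m → ℝ}
  {Cg cη Cη : ℝ} {T : ℝ} {u₀ : ℝ → State m} {u : ℝ → ℝ → State m}

/-- The residual of a Lipschitz function, expressed by its Fréchet derivative. -/
def fderivResidual (g : State m → State m) (V : ℝ × ℝ → State m) (z : ℝ × ℝ) : State m :=
  fderiv ℝ V z (1, 0) + fderiv ℝ g (V z) (fderiv ℝ V z (0, 1))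

lemma integrable_fderivResidual_sq (hU : IsOpen U) (hg : ContDiffOn ℝ 2 g U) (hK : IsCompact K)
    (hKU : K ⊆ U) {V : ℝ × ℝ → State m} {L : ℝ≥0} (hV : LipschitzWith L V) (hVK : ∀ z, V z ∈ K)
    (T : ℝ) : IntegrableOn (fun z => ‖fderivResidual g V z‖ ^ 2) (cylinder T) := by
  have hc : ContinuousOn (fderiv ℝ g) K :=
    (hg.continuousOn_fderiv_of_isOpen hU (by norm_num)).mono hKU
  obtain ⟨C, hC⟩ := exists_bound_comp hK hc hVK
  have hm : AEStronglyMeasurable (fderivResidual g V) (volume.restrict (cylinder T)) := by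
    refine (integrable_fderiv_apply hV (1, 0) T).aestronglyMeasurable.add
      (aestronglyMeasurable_clm_apply ?_ (integrable_fderiv_apply hV (0, 1) T).aestronglyMeasurable)
    exact ((measurable_fderiv ℝ g).comp hV.continuous.measurable).aestronglyMeasurable
  have hb : ∀ v z, ‖fderiv ℝ V z v‖ ≤ L * ‖v‖ := fun v z =>
    (ContinuousLinearMap.le_opNorm _ _).trans
      (mul_le_mul_of_nonneg_right (norm_fderiv_le_of_lipschitz ℝ hV) (norm_nonneg _))
  refine Integrable.of_bound
    (C := (L * ‖((1 : ℝ), (0 : ℝ))‖ + C * (L * ‖((0 : ℝ), (1 : ℝ))‖)) ^ 2) (hm.norm.pow 2)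
    (Eventually.of_forall fun z => ?_)
  rw [Real.norm_of_nonneg (sq_nonneg _)]
  refine pow_le_pow_left₀ (norm_nonneg _) ((norm_add_le _ _).trans (add_le_add (hb _ _) ?_)) 2
  exact (ContinuousLinearMap.le_opNorm _ _).trans
    (mul_le_mul (hC z) (hb _ _) (norm_nonneg _) ((norm_nonneg _).trans (hC z)))

lemma continuousOn_integral_cylinder {f : ℝ × ℝ → ℝ} (hT : 0 ≤ T) (hf : IntegrableOn f (cylinder T)) :
    ContinuousOn (fun t => ∫ z in cylinder t, f z) (Icc 0 T) := by
  have hf' : Integrable f ((volume.restrict (Ioo 0 T)).prod (volume.restrict cellT)) := by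
    rw [← restrict_cylinder]; exact hf
  have hprim : ContinuousOn (fun t => ∫ s in (0 : ℝ)..t, ∫ x in cellT, f (s, x)) (Icc 0 T) := by
    rw [← uIcc_of_le hT]
    refine intervalIntegral.continuousOn_primitive_interval ?_
    rw [uIcc_of_le hT, integrableOn_Icc_iff_integrableOn_Ioo]
    exact hf'.integral_prod_left
  refine hprim.congr fun t ht => ?_
  have hft : IntegrableOn f (cylinder t) := hf.mono_set (cylinder_subset ht.2)
  unfold IntegrableOn at hft
  rw [restrict_cylinder] at hft
  simp only
  rw [restrict_cylinder, integral_prod _ hft, intervalIntegral.integral_of_le ht.1,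
    integral_Ioc_eq_integral_Ioo]

end Stability

section Stability

variable {m : ℕ} {U K : Set (State m)} {g : State m → State m} {η q : State m → ℝ}
  {Cg cη Cη : ℝ} {T : ℝ} {u₀ : ℝ → State m} {u : ℝ → ℝ → State m}

/-- The quadratic upper bound gives the estimate; the lower bound gives nonnegativity, which spares
an integrability proof for the relative entropy. -/
lemma integral_relEntropy_initial_le (hU : IsOpen U) (hη : IsEntropyPair U g η q)
    (hKc : Convex ℝ K) (hKU : K ⊆ U) (hC : HessianBounds K g η Cg cη Cη)
    (hu₀ : IsInitialDatum U u₀) (hu₀K : ∀ᵐ x ∂(volume.restrict cellT), u₀ x ∈ K)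
    {v : ℝ → State m} (hv : Continuous v) (hvK : ∀ x, v x ∈ K) :
    ∫ x in cellT, relEntropy η (u₀ x) (v x) ≤ Cη / 2 * ∫ x in cellT, ‖u₀ x - v x‖ ^ 2 := by
  rw [← integral_const_mul]
  refine integral_mono_of_nonneg ?_ ?_ ?_
  · filter_upwards [hu₀K] with x hx
    exact (mul_nonneg (by linarith [hC.lower_pos]) (sq_nonneg _)).trans
      (le_relEntropy hU hη hKc hKU hC hx (hvK x))
  · refine Integrable.const_mul ?_ _
    obtain ⟨C, hCb⟩ := hu₀.bounded
    obtain ⟨C', hC'⟩ := (isCompact_Icc.image_of_continuousOn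
      (hv.continuousOn (s := Icc (-1 : ℝ) 1))).isBounded.exists_norm_le
    refine Integrable.of_bound (C := (C + C') ^ 2)
      ((hu₀.meas.sub hv.aestronglyMeasurable).norm.pow 2) ?_
    filter_upwards [hCb, ae_restrict_mem measurableSet_cellT] with x hx hxc
    rw [Real.norm_of_nonneg (sq_nonneg _)]
    refine pow_le_pow_left₀ (norm_nonneg _) ((norm_sub_le _ _).trans (add_le_add hx ?_)) 2
    exact hC' _ (mem_image_of_mem _ (Ioo_subset_Icc_self hxc))
  · filter_upwards [hu₀K] with x hx using relEntropy_le hU hη hKc hKU hC hx (hvK x)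

/-- Testing with a time slice: the integral over the cell is continuous in time. -/
lemma IsWeakSolution.continuousOn_integral_defect (hu : IsWeakSolution U g T u₀ u)
    {V : ℝ × ℝ → State m} {L : ℝ≥0} (hV : LipschitzWith L V) {ψ : ℝ → State m}
    (hψ : IntegrableOn ψ cellT) (hψ2 : IntegrableOn (fun x => ‖ψ x‖ ^ 2) cellT)
    {CV : ℝ} (hCV : ∀ z, ‖V z‖ ≤ CV) :
    ContinuousOn (fun t => ∫ x in cellT, (2 * inner ℝ (u t x - V (t, x)) (ψ x) - ‖ψ x‖ ^ 2))
      (Icc 0 T) := by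
  have hVc : Continuous (fun t => ∫ x in cellT, inner ℝ (V (t, x)) (ψ x)) := by
    refine continuous_of_dominated (bound := fun x => CV * ‖ψ x‖) (fun t => ?_)
      (fun t => Eventually.of_forall fun x => ?_) (hψ.norm.const_mul _)
      (Eventually.of_forall fun x => ?_)
    · exact (hV.continuous.comp (by fun_prop : Continuous fun x : ℝ => (t, x))).aestronglyMeasurable.inner
        hψ.aestronglyMeasurable
    · exact (norm_inner_le_norm _ _).trans (mul_le_mul_of_nonneg_right (hCV _) (norm_nonneg _))
    · exact (hV.continuous.comp (by fun_prop : Continuous fun t : ℝ => (t, x))).inner continuous_const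
  have h := ((((hu.weakStar_continuous ψ hψ).sub hVc.continuousOn).const_smul (2 : ℝ)).sub
    (continuousOn_const (c := ∫ x in cellT, ‖ψ x‖ ^ 2)))
  refine h.congr fun t ht => ?_
  obtain ⟨C, hC⟩ := hu.bounded
  have i1 : IntegrableOn (fun x => inner ℝ (u t x) (ψ x)) cellT := by
    refine (hψ.norm.const_mul C).mono' ((hu.meas_slice t ht).inner hψ.aestronglyMeasurable) ?_
    filter_upwards [hC t ht] with x hx
    exact (norm_inner_le_norm _ _).trans (mul_le_mul_of_nonneg_right hx (norm_nonneg _))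
  have i2 : IntegrableOn (fun x => inner ℝ (V (t, x)) (ψ x)) cellT := by
    refine (hψ.norm.const_mul CV).mono' ((hV.continuous.comp
      (by fun_prop : Continuous fun x : ℝ => (t, x))).aestronglyMeasurable.inner
        hψ.aestronglyMeasurable) ?_
    exact Eventually.of_forall fun x =>
      (norm_inner_le_norm _ _).trans (mul_le_mul_of_nonneg_right (hCV _) (norm_nonneg _))
  have e : ∀ x, 2 * inner ℝ (u t x - V (t, x)) (ψ x) - ‖ψ x‖ ^ 2 =
      2 * (inner ℝ (u t x) (ψ x) - inner ℝ (V (t, x)) (ψ x)) - ‖ψ x‖ ^ 2 := fun x => by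
    rw [inner_sub_left]
  simp only [e, Pi.sub_apply, Pi.smul_apply, smul_eq_mul]
  rw [integral_sub ((i1.fun_sub i2).const_mul 2) hψ2, integral_const_mul, integral_sub i1 i2]

/-- Stability estimate for a Lipschitz function `V` with values in `K` in terms of its residual. -/
theorem IsEntropySolution.stability (hU : IsOpen U) (hg : ContDiffOn ℝ 2 g U)
    (hη : IsEntropyPair U g η q) (hK : IsCompact K) (hKc : Convex ℝ K) (hKU : K ⊆ U)
    (hC : HessianBounds K g η Cg cη Cη) (hT : 0 < T) (hu₀ : IsInitialDatum U u₀)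
    (hu : IsEntropySolution U g η q T u₀ u)
    (huK : ∀ᵐ z ∂(volume.restrict (cylinder T)), u z.1 z.2 ∈ K)
    {V : ℝ × ℝ → State m} {L : ℝ≥0} (hV : LipschitzWith L V)
    (hVper : ∀ t x, V (t, x + 2) = V (t, x)) (hVK : ∀ z, V z ∈ K)
    {β : ℝ → ℝ} (hβ : ContinuousOn β (Icc 0 T)) (hβ0 : ∀ s ∈ Icc 0 T, 0 ≤ β s)
    (hβV : ∀ᵐ z ∂(volume.restrict (cylinder T)), ‖fderiv ℝ V z (0, 1)‖ ≤ β z.1)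
    {τ : ℝ} (hτ : τ ∈ Icc 0 T) :
    ∫ x in cellT, ‖u τ x - V (τ, x)‖ ^ 2 ≤
      cη⁻¹ * ((∫ z in cylinder τ, ‖fderivResidual g V z‖ ^ 2)
        + Cη * ∫ x in cellT, ‖u₀ x - V (0, x)‖ ^ 2)
        * Real.exp (∫ s in (0 : ℝ)..τ, (Cη * Cg * β s + Cη ^ 2) / cη) := by
  have hint := integrable_of_ae_mem_compact hK hu.meas huK
  have hgc : ContinuousOn g K := hg.continuousOn.mono hKU
  have hu₀K := hu.initial_mem hu₀ hT hK hKc hgc huK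
  have hcη := hC.lower_pos
  have hCη := hC.upper_pos
  have hCg := hC.flux_nonneg
  obtain ⟨CV, hCV⟩ := exists_bound_comp hK (f := id) continuousOn_id hVK
  simp only [id] at hCV
  set b : ℝ → ℝ := fun s => (Cη * Cg * β s + Cη ^ 2) / cη with hb
  have hbc : ContinuousOn b (Icc 0 T) :=
    ((continuousOn_const.mul hβ).add continuousOn_const).div_const _
  obtain ⟨E, ⟨LE, hEL⟩, hE0, hE1, hEeq, hEd⟩ := exists_integrating_factor hT hbc
    (fun s hs => by have := hβ0 s hs; simp only [hb]; positivity)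
  have hEcont := hEL.continuous
  set R : ℝ × ℝ → ℝ := fun z => ‖fderivResidual g V z‖ ^ 2 with hR
  have hRint : IntegrableOn R (cylinder T) := integrable_fderivResidual_sq hU hg hK hKU hV hVK T
  have ev : Continuous (fun x : ℝ => (τ, x)) := by fun_prop
  -- The defect at the fixed time τ serves as a frozen direction. The quantity `D` = 2⟨u - V, ψ⟩ -
  -- |ψ|² is at most |u - V|², with equality at time τ, and is affine in `u`; hence its integral
  -- over the cell is continuous in time although that of |u - V|² need not be.
  set ψ : ℝ → State m := fun x => u τ x - V (τ, x) with hψdef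
  obtain ⟨Cu, hCu⟩ := hu.bounded
  have hψm : AEStronglyMeasurable ψ (volume.restrict cellT) :=
    (hu.meas_slice τ hτ).sub (hV.continuous.comp ev).aestronglyMeasurable
  have hψb : ∀ᵐ x ∂(volume.restrict cellT), ‖ψ x‖ ≤ Cu + CV := by
    filter_upwards [hCu τ hτ] with x hx
    exact (norm_sub_le _ _).trans (add_le_add hx (hCV _))
  have hψ : IntegrableOn ψ cellT := Integrable.of_bound hψm _ hψb
  have hψ2 : IntegrableOn (fun x => ‖ψ x‖ ^ 2) cellT := by
    refine Integrable.of_bound (hψm.norm.pow 2) ((Cu + CV) ^ 2) ?_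
    filter_upwards [hψb] with x hx
    rw [Real.norm_of_nonneg (sq_nonneg _)]
    exact pow_le_pow_left₀ (norm_nonneg _) hx 2
  set D : ℝ × ℝ → ℝ := fun z => 2 * inner ℝ (u z.1 z.2 - V z) (ψ z.2) - ‖ψ z.2‖ ^ 2 with hD
  have hDint : IntegrableOn D (cylinder T) := by
    have hψs : AEStronglyMeasurable (fun z : ℝ × ℝ => ψ z.2) (volume.restrict (cylinder T)) := by
      rw [restrict_cylinder]; exact hψm.comp_snd
    have hψsb : ∀ᵐ z ∂(volume.restrict (cylinder T)), ‖ψ z.2‖ ≤ Cu + CV := by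
      rw [restrict_cylinder]; exact Measure.quasiMeasurePreserving_snd.ae hψb
    obtain ⟨CK, hCK⟩ := hK.isBounded.exists_norm_le
    refine Integrable.of_bound (C := 2 * ((CK + CV) * (Cu + CV)) + (Cu + CV) ^ 2)
      ((((hu.meas.sub hV.continuous.aestronglyMeasurable).inner hψs).const_mul 2).sub
        (hψs.norm.pow 2)) ?_
    filter_upwards [hψsb, huK] with z hz hzK
    have h1 : ‖u z.1 z.2 - V z‖ ≤ CK + CV :=
      (norm_sub_le _ _).trans (add_le_add (hCK _ hzK) (hCV _))
    have h2 : ‖(2 : ℝ) * inner ℝ (u z.1 z.2 - V z) (ψ z.2)‖ ≤ 2 * ((CK + CV) * (Cu + CV)) := by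
      rw [norm_mul, Real.norm_two]
      gcongr
      exact (norm_inner_le_norm _ _).trans
        (mul_le_mul h1 hz (norm_nonneg _) ((norm_nonneg _).trans h1))
    refine (norm_sub_le _ _).trans (add_le_add h2 ?_)
    rw [Real.norm_of_nonneg (sq_nonneg _)]
    exact pow_le_pow_left₀ (norm_nonneg _) hz 2
  set E₀ : ℝ := Cη / 2 * ∫ x in cellT, ‖u₀ x - V (0, x)‖ ^ 2 with hE₀
  have hrel0 : ∫ x in cellT, relEntropy η (u₀ x) (V (0, x)) ≤ E₀ :=
    integral_relEntropy_initial_le hU hη hKc hKU hC hu₀ hu₀K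
      (hV.continuous.comp (by fun_prop : Continuous fun x : ℝ => ((0 : ℝ), x))) (fun x => hVK _)
  set h : ℝ → ℝ := fun t => E t * (cη / 2) * ∫ x in cellT, D (t, x) with hh
  have hhc : ContinuousOn h (Icc 0 T) :=
    (hEcont.mul continuous_const).continuousOn.mul
      (hu.continuousOn_integral_defect hV hψ hψ2 hCV)
  set c : ℝ → ℝ := fun t => 1 / 2 * (∫ z in cylinder t, R z) + E₀ with hcdef
  have hcc : ContinuousOn c (Icc 0 T) :=
    (continuousOn_const.mul (continuousOn_integral_cylinder hT.le hRint)).add continuousOn_const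
  have key : ∀ a b', 0 ≤ a → a < b' → b' < T → ∫ t in a..b', h t ≤ (b' - a) * c b' := by
    intro a b' ha hab hbT
    have hba : 0 < b' - a := by linarith
    -- Ramp times Gronwall weight: the derivative -b E of the weight absorbs the term b η(u | V) of
    -- the production estimate.
    set θ : ℝ → ℝ := fun t => cutoff a b' t * E t with hθ
    obtain ⟨Lθ, hθL⟩ : ∃ L, LipschitzWith L θ :=
      lipschitzWith_bilin (ContinuousLinearMap.mul ℝ ℝ) (lipschitzWith_cutoff hab) hEL
        (C₁ := 1) (C₂ := 1)
        (fun t => by rw [Real.norm_of_nonneg (cutoff_nonneg _ _ _)]; exact cutoff_le_one _ _ _)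
        (fun t => by rw [Real.norm_of_nonneg (hE0 _)]; exact hE1 _)
    have hθ0 : ∀ t, 0 ≤ θ t := fun t => mul_nonneg (cutoff_nonneg _ _ _) (hE0 t)
    have hθ1 : ∀ t, θ t ≤ 1 := fun t =>
      mul_le_one₀ (cutoff_le_one _ _ _) (hE0 t) (hE1 t)
    have hθs : ∀ t, b' ≤ t → θ t = 0 := fun t ht => by
      simp only [hθ, cutoff_eq_zero hab ht, zero_mul]
    obtain ⟨hSint, hS⟩ := hu.relEntropy_ineq hU hg hη hK hKc hKU hC hT hu₀ huK hV hVper hVK hθL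
      hθ0 hθ1 hbT hθs
    have hθ00 : θ 0 = 1 := by
      simp only [hθ, cutoff_eq_one hab ha, one_mul]
      rw [hEeq 0 ⟨le_rfl, hT.le⟩]
      simp
    rw [hθ00, one_mul] at hS
    -- What remains of θ' is the slope -1/(b' - a) of the ramp. Being negative, it allows η(u | V)
    -- to be replaced by its lower bound (cη/2) D, and the time integral becomes minus the average
    -- of `h`.
    set κ : ℝ → ℝ := fun t => indicator (Ioo a b') (fun _ => -(b' - a)⁻¹) t * (E t * (cη / 2)) with hκ
    have hκm : Measurable κ :=
      (measurable_const.indicator measurableSet_Ioo).mul (hEcont.measurable.mul_const _)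
    have hκb : ∀ t, ‖κ t‖ ≤ (b' - a)⁻¹ * (1 * (cη / 2)) := by
      intro t
      simp only [hκ]
      rw [norm_mul, norm_mul, Real.norm_of_nonneg (hE0 t), Real.norm_of_nonneg (half_pos hcη).le]
      refine mul_le_mul ?_ (mul_le_mul_of_nonneg_right (hE1 t) (half_pos hcη).le)
        (mul_nonneg (hE0 t) (half_pos hcη).le) (inv_pos.2 hba).le
      refine (norm_indicator_le_norm_self _ _).trans ?_
      rw [norm_neg, Real.norm_of_nonneg (inv_pos.2 hba).le]
    have i1 : IntegrableOn (fun z : ℝ × ℝ => κ z.1 * D z) (cylinder T) :=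
      hDint.bdd_mul (hκm.comp measurable_fst).aestronglyMeasurable
        (Eventually.of_forall fun z => hκb z.1)
    have i2 : IntegrableOn (indicator (cylinder b') fun z => 1 / 2 * R z) (cylinder T) :=
      (hRint.const_mul _).indicator (measurableSet_cylinder b')
    have hle : ∫ z in cylinder T, relEntropyIntegrand g η θ V z (u z.1 z.2) ≤
        ∫ z in cylinder T, (κ z.1 * D z + indicator (cylinder b') (fun z => 1 / 2 * R z) z) := by
      refine integral_mono_ae hSint (i1.add i2) ?_
      filter_upwards [huK, ae_restrict_mem (measurableSet_cylinder T), hβV,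
        ae_restrict_of_ae (ae_fst_ne a), ae_restrict_of_ae (ae_fst_ne b')] with z hzK hzT hzβ hza hzb
      have hd := ((hasDerivAt_cutoff hab hza hzb).fun_mul (hEd z.1 hzT.1)).deriv
      have hprod := relEntropy_production_le hU hg hη hKc hKU hC hzK (hVK z)
        (fderiv ℝ V z (1, 0)) (fderiv ℝ V z (0, 1)) hzβ
      have hlow := le_relEntropy hU hη hKc hKU hC hzK (hVK z)
      have hDle : D z ≤ ‖u z.1 z.2 - V z‖ ^ 2 := by
        have := sq_nonneg ‖u z.1 z.2 - V z - ψ z.2‖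
        have e := norm_sub_sq_real (u z.1 z.2 - V z) (ψ z.2)
        simp only [hD]
        nlinarith [sq_nonneg ‖u z.1 z.2 - V z - ψ z.2‖]
      have hDrel : cη / 2 * D z ≤ relEntropy η (u z.1 z.2) (V z) :=
        (mul_le_mul_of_nonneg_left hDle (half_pos hcη).le).trans hlow
      have hind : indicator (Ioo a b') (fun _ => -(b' - a)⁻¹) z.1 ≤ 0 :=
        indicator_nonpos (fun _ _ => neg_nonpos.2 (inv_pos.2 hba).le) _
      -- θ is at most 1 and vanishes from b' on, so only the residual on (0, b') is charged.
      have hfin : θ z.1 * (1 / 2 * R z) ≤ indicator (cylinder b') (fun z => 1 / 2 * R z) z := by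
        by_cases hz : z.1 < b'
        · rw [indicator_of_mem (show z ∈ cylinder b' from ⟨⟨hzT.1.1, hz⟩, hzT.2⟩)]
          exact mul_le_of_le_one_left (mul_nonneg (by norm_num) (sq_nonneg _)) (hθ1 _)
        · rw [indicator_of_notMem (fun hm => hz hm.1.2), hθs _ (not_lt.1 hz), zero_mul]
      have h1 := mul_le_mul_of_nonneg_left hprod (hθ0 z.1)
      have h2 := mul_le_mul_of_nonpos_left hDrel
        (mul_nonpos_of_nonpos_of_nonneg hind (hE0 z.1))
      have hθz : θ z.1 = cutoff a b' z.1 * E z.1 := rfl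
      have hbz : b z.1 = (Cη * Cg * β z.1 + Cη ^ 2) / cη := rfl
      have hRz : R z = ‖fderiv ℝ V z (1, 0) + fderiv ℝ g (V z) (fderiv ℝ V z (0, 1))‖ ^ 2 := rfl
      have hκz : κ z.1 = indicator (Ioo a b') (fun _ => -(b' - a)⁻¹) z.1 * (E z.1 * (cη / 2)) := rfl
      rw [← hbz, ← hRz] at h1
      unfold relEntropyIntegrand
      rw [show deriv θ z.1 = _ from hd, hκz]
      rw [hθz] at h1 hfin ⊢
      linarith
    rw [integral_add i1 i2] at hle
    have e2 : ∫ z in cylinder T, indicator (cylinder b') (fun z => 1 / 2 * R z) z =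
        1 / 2 * ∫ z in cylinder b', R z := by
      rw [setIntegral_indicator (measurableSet_cylinder b'),
        inter_eq_self_of_subset_right (cylinder_subset hbT.le), integral_const_mul]
    have e1 : ∫ z in cylinder T, κ z.1 * D z = -(b' - a)⁻¹ * ∫ t in a..b', h t := by
      unfold IntegrableOn at i1
      rw [restrict_cylinder] at i1 ⊢
      rw [integral_prod _ i1]
      have : ∀ t, ∫ x in cellT, κ t * D (t, x) =
          indicator (Ioo a b') (fun t => -(b' - a)⁻¹ * h t) t := by
        intro t
        rw [integral_const_mul]
        by_cases ht : t ∈ Ioo a b'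
        · simp only [hκ, indicator_of_mem ht, hh]; ring
        · simp only [hκ, indicator_of_notMem ht]; ring
      simp only [this]
      rw [setIntegral_indicator measurableSet_Ioo,
        inter_eq_self_of_subset_right (Ioo_subset_Ioo ha hbT.le), integral_const_mul,
        intervalIntegral.integral_of_le hab.le, integral_Ioc_eq_integral_Ioo]
    rw [e1, e2] at hle
    have hfinal : (b' - a)⁻¹ * ∫ t in a..b', h t ≤ c b' := by
      simp only [hcdef]
      linarith
    rwa [inv_mul_le_iff₀ hba] at hfinal
  -- All averages of `h` are controlled; now shrink to τ, where `D` is |u - V|². Dividing by the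
  -- weight at τ produces the exponential, and the factors 1/2 cancel.
  have hmain := le_of_forall_integral_le hT hhc hcc key hτ
  have hDτ : ∫ x in cellT, D (τ, x) = ∫ x in cellT, ‖ψ x‖ ^ 2 := by
    congr 1 with x
    have : inner ℝ (u τ x - V (τ, x)) (ψ x) = ‖ψ x‖ ^ 2 := real_inner_self_eq_norm_sq _
    simp only [hD, this]
    ring
  simp only [hh, hcdef, hDτ, hE₀] at hmain
  rw [hEeq τ hτ, Real.exp_neg] at hmain
  set B := Real.exp (∫ s in (0 : ℝ)..τ, b s)
  have hB : 0 < B := Real.exp_pos _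
  set Y := ∫ x in cellT, ‖ψ x‖ ^ 2
  set I₁ := ∫ z in cylinder τ, R z
  set I₂ := ∫ x in cellT, ‖u₀ x - V (0, x)‖ ^ 2
  have h3 : B⁻¹ * cη * Y ≤ I₁ + Cη * I₂ := by linarith
  calc Y = (cη⁻¹ * B) * (B⁻¹ * cη * Y) := by field_simp
    _ ≤ (cη⁻¹ * B) * (I₁ + Cη * I₂) := mul_le_mul_of_nonneg_left h3 (by positivity)
    _ = _ := by ring

end Stability

open Polynomial

/-! ### Meshes and piecewise polynomials -/

section Partition

variable {x : ℕ → ℝ} {M : ℕ} {a b : ℝ}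

lemma IsPartition.mono (hx : IsPartition x M a b) {i j : ℕ} (hij : i ≤ j) (hj : j ≤ M) :
    x i ≤ x j := by
  induction j, hij using Nat.le_induction with
  | base => exact le_rfl
  | succ j _ ih => exact (ih (by omega)).trans (hx.lt_succ j (by omega)).le

lemma IsPartition.mem_Icc (hx : IsPartition x M a b) {i : ℕ} (hi : i ≤ M) : x i ∈ Icc a b := by
  rw [← hx.left, ← hx.right]
  exact ⟨hx.mono (Nat.zero_le i) hi, hx.mono hi le_rfl⟩

lemma IsPartition.Icc_subset (hx : IsPartition x M a b) {i : ℕ} (hi : i < M) :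
    Icc (x i) (x (i + 1)) ⊆ Icc a b :=
  Icc_subset_Icc (hx.mem_Icc hi.le).1 (hx.mem_Icc hi).2

lemma IsPartition.exists_mem_Icc (hx : IsPartition x M a b) (hab : a < b) {y : ℝ}
    (hy : y ∈ Icc a b) : ∃ i < M, y ∈ Icc (x i) (x (i + 1)) := by
  have key : ∀ i ≤ M, 0 < i → y ≤ x i → ∃ j < M, y ∈ Icc (x j) (x (j + 1)) := by
    intro i
    induction i with
    | zero => intro _ h; omega
    | succ i ih =>
      intro hi _ hyi
      rcases le_total (x i) y with h | h
      · exact ⟨i, hi, h, hyi⟩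
      · rcases Nat.eq_zero_or_pos i with h0 | h0
        · refine ⟨i, hi, ?_, hyi⟩
          rw [h0, hx.left]; exact hy.1
        · exact ih (by omega) h0 h
  refine key M le_rfl ?_ (by rw [hx.right]; exact hy.2)
  by_contra h
  have h0 : M = 0 := by omega
  have h1 := hx.left
  have h2 := hx.right
  rw [h0] at h2
  linarith

lemma mem_meshInterior {y : ℝ} : y ∈ meshInterior x M ↔ ∃ i < M, y ∈ Ioo (x i) (x (i + 1)) := by
  simp only [meshInterior, mem_iUnion, Finset.mem_range, exists_prop]

lemma isOpen_meshInterior : IsOpen (meshInterior x M) :=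
  isOpen_biUnion fun _ _ => isOpen_Ioo

lemma IsPartition.meshInterior_subset (hx : IsPartition x M (-1) 1) :
    meshInterior x M ⊆ cellT := by
  intro y hy
  obtain ⟨i, hi, h⟩ := mem_meshInterior.1 hy
  exact ⟨(hx.mem_Icc hi.le).1.trans_lt h.1, h.2.trans_le (hx.mem_Icc hi).2⟩

lemma IsPartition.ae_mem_meshInterior (hx : IsPartition x M (-1) 1) :
    ∀ᵐ y ∂(volume.restrict cellT), y ∈ meshInterior x M := by
  have h : ∀ᵐ y : ℝ, ∀ i, y ≠ x i := ae_all_iff.2 fun i => Measure.ae_ne volume (x i)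
  filter_upwards [ae_restrict_of_ae h, ae_restrict_mem measurableSet_cellT] with y hy hyc
  obtain ⟨i, hi, h1⟩ := hx.exists_mem_Icc (by norm_num) (Ioo_subset_Icc_self hyc)
  exact mem_meshInterior.2 ⟨i, hi, h1.1.lt_of_ne (hy i).symm, h1.2.lt_of_ne (hy _)⟩

/-- The cells of a partition are disjoint. -/
lemma IsPartition.cell_unique (hx : IsPartition x M a b) {i j : ℕ} (hi : i < M) (hj : j < M) {y : ℝ}
    (hyi : y ∈ Ioo (x i) (x (i + 1))) (hyj : y ∈ Ioo (x j) (x (j + 1))) : i = j := by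
  rcases lt_trichotomy i j with h | h | h
  · have := hx.mono (show i + 1 ≤ j from h) hj.le
    linarith [hyi.2, hyj.1]
  · exact h
  · have := hx.mono (show j + 1 ≤ i from h) hi.le
    linarith [hyj.2, hyi.1]

end Partition

/-! ### Nodal representation of piecewise polynomials -/

section Lagrange

variable {m : ℕ} {x : ℕ → ℝ} {M n : ℕ} {a b : ℝ}

/-- Equidistant interpolation nodes inside the mesh cells. -/
def node (x : ℕ → ℝ) (n i j : ℕ) : ℝ := x i + (x (i + 1) - x i) * ((j + 1) / (n + 1))

/-- The Lagrange basis polynomials of a mesh cell. -/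
def cellBasis (x : ℕ → ℝ) (n i j : ℕ) : ℝ[X] := Lagrange.basis (Finset.range n) (node x n i) j

/-- The polynomial which interpolates `v` in the nodes of a mesh cell. -/
def cellExt (x : ℕ → ℝ) (n i : ℕ) (v : ℝ → State m) (y : ℝ) : State m :=
  ∑ j ∈ Finset.range n, (cellBasis x n i j).eval y • v (node x n i j)

/-- The nodes must be strictly inside the cell, hence (j + 1)/(n + 1): membership in the DG space
says nothing about values at mesh points. -/
lemma node_mem (hx : IsPartition x M a b) {i j : ℕ} (hi : i < M) (hj : j < n) :
    node x n i j ∈ Ioo (x i) (x (i + 1)) := by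
  have h := hx.lt_succ i hi
  have h0 : 0 < x (i + 1) - x i := by linarith
  have h1 : (0 : ℝ) < ((j : ℝ) + 1) / (n + 1) := by positivity
  have h2 : ((j : ℝ) + 1) / (n + 1) < 1 := by
    rw [div_lt_one (by positivity)]
    have : (j : ℝ) < n := by exact_mod_cast hj
    linarith
  unfold node
  constructor <;> nlinarith

lemma node_mem_meshInterior (hx : IsPartition x M a b) {i j : ℕ} (hi : i < M) (hj : j < n) :
    node x n i j ∈ meshInterior x M :=
  mem_meshInterior.2 ⟨i, hi, node_mem hx hi hj⟩

lemma node_injOn (hx : IsPartition x M a b) {i : ℕ} (hi : i < M) :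
    Set.InjOn (node x n i) (Finset.range n) := by
  intro j _ j' _ h
  have h0 : x (i + 1) - x i ≠ 0 := by linarith [hx.lt_succ i hi]
  unfold node at h
  have h1 := mul_left_cancel₀ h0 (add_left_cancel h)
  have h2 : ((n : ℝ) + 1) ≠ 0 := by positivity
  rw [div_left_inj' h2] at h1
  exact_mod_cast add_right_cancel h1

lemma eval_eq_sum_cellBasis (hx : IsPartition x M a b) {i : ℕ} (hi : i < M) {p : ℝ[X]}
    (hp : p.degree < n) (y : ℝ) :
    p.eval y = ∑ j ∈ Finset.range n, (cellBasis x n i j).eval y * p.eval (node x n i j) := by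
  have h := Lagrange.eq_interpolate (f := p) (node_injOn (n := n) hx hi) (by simpa using hp)
  conv_lhs => rw [h, Lagrange.interpolate_apply, eval_finsetSum]
  refine Finset.sum_congr rfl fun j _ => ?_
  rw [eval_mul, eval_C, mul_comm]
  rfl

/-- The basis depends on the mesh alone, so a piecewise polynomial is a fixed linear expression in
finitely many point values. Regularity in time at points therefore yields regularity of traces and
space derivatives. -/
lemma eq_cellExt (hx : IsPartition x M a b) {v : ℝ → State m} (hv : v ∈ dgSpace x M n) {i : ℕ}
    (hi : i < M) {y : ℝ} (hy : y ∈ Ioo (x i) (x (i + 1))) : v y = cellExt x n i v y := by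
  obtain ⟨p, hp, hpv⟩ := hv i hi
  ext l
  rw [hpv y hy l, eval_eq_sum_cellBasis hx hi (hp l)]
  simp only [cellExt, PiLp.smul_apply, WithLp.ofLp_sum, Finset.sum_apply, smul_eq_mul]
  refine Finset.sum_congr rfl fun j hj => ?_
  rw [hpv _ (node_mem hx hi (Finset.mem_range.1 hj))]

lemma continuous_cellExt (x : ℕ → ℝ) (n i : ℕ) (v : ℝ → State m) : Continuous (cellExt x n i v) :=
  continuous_finsetSum _ fun j _ => (cellBasis x n i j).continuous.smul continuous_const

lemma hasDerivAt_cellExt (x : ℕ → ℝ) (n i : ℕ) (v : ℝ → State m) (y : ℝ) :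
    HasDerivAt (cellExt x n i v)
      (∑ j ∈ Finset.range n, (derivative (cellBasis x n i j)).eval y • v (node x n i j)) y :=
  HasDerivAt.fun_sum fun j _ => ((cellBasis x n i j).hasDerivAt y).smul_const _

end Lagrange

/-! ### One-sided limits from continuous representatives on a cell -/

section OneSidedLimits

variable {E : Type*} [TopologicalSpace E] {v φ : ℝ → E} {a b : ℝ}

lemma rightLim_eq_of_eqOn [T2Space E] (hφ : Continuous φ) (h : EqOn v φ (Ioo a b)) {y : ℝ}
    (hy : y ∈ Ico a b) : Function.rightLim v y = φ y := by
  refine rightLim_eq_of_tendsto ?_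
  refine ((hφ.tendsto y).mono_left nhdsWithin_le_nhds).congr' ?_
  filter_upwards [Ioo_mem_nhdsGT hy.2] with z hz
  exact (h ⟨hy.1.trans_lt hz.1, hz.2⟩).symm

lemma leftLim_eq_of_eqOn [T2Space E] (hφ : Continuous φ) (h : EqOn v φ (Ioo a b)) (hab : a < b) :
    Function.leftLim v b = φ b := by
  refine leftLim_eq_of_tendsto ?_
  refine ((hφ.tendsto b).mono_left nhdsWithin_le_nhds).congr' ?_
  filter_upwards [Ioo_mem_nhdsLT hab] with z hz
  exact (h hz).symm

lemma mem_of_eqOn_of_continuous {K : Set E} (hK : IsClosed K) (hφ : Continuous φ)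
    (h : EqOn v φ (Ioo a b)) (hv : ∀ y ∈ Ioo a b, v y ∈ K) (hab : a < b) {y : ℝ}
    (hy : y ∈ Icc a b) : φ y ∈ K := by
  rw [← closure_Ioo hab.ne] at hy
  exact closure_minimal (fun z hz => by
    rw [mem_preimage, ← h hz]; exact hv z hz) (hK.preimage hφ) hy

end OneSidedLimits

/-! ### Reconstruction of a polynomial from its end point values -/

/-- Vanishing at both ends means e = (y - a)(y - b) r with deg r < k. Testing with r gives the
integral of (y - a)(y - b) r², which is nonzero unless r = 0. -/
lemma eq_zero_of_orthogonal {a b : ℝ} (hab : a < b) {k : ℕ} {e : ℝ[X]} (he : e.degree < (k + 2 : ℕ))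
    (horth : ∀ r : ℝ[X], r.degree < k → ∫ y in a..b, e.eval y * r.eval y = 0)
    (ha : e.eval a = 0) (hb : e.eval b = 0) : e = 0 := by
  obtain ⟨e₁, he₁⟩ := dvd_iff_isRoot.2 (show e.IsRoot a from ha)
  have hb₁ : e₁.eval b = 0 := by
    rw [he₁] at hb
    simp only [eval_mul, eval_sub, eval_X, eval_C, mul_eq_zero] at hb
    exact hb.resolve_left (by linarith)
  obtain ⟨r, hr⟩ := dvd_iff_isRoot.2 (show e₁.IsRoot b from hb₁)
  by_contra hne
  have hr0 : r ≠ 0 := by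
    rintro rfl
    rw [mul_zero] at hr
    rw [hr, mul_zero] at he₁
    exact hne he₁
  have hdeg : r.degree < k := by
    rw [he₁, hr, degree_mul, degree_mul, degree_X_sub_C, degree_X_sub_C,
      degree_eq_natDegree hr0] at he
    rw [degree_eq_natDegree hr0]
    have : 1 + (1 + r.natDegree) < k + 2 := by exact_mod_cast he
    exact_mod_cast (by omega : r.natDegree < k)
  have h0 := horth r hdeg
  have hpos : 0 < ∫ y in a..b, (y - a) * (b - y) * (r.eval y) ^ 2 := by
    refine intervalIntegral.integral_pos hab (by fun_prop) (fun y hy => ?_) ?_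
    · exact mul_nonneg (mul_nonneg (by linarith [hy.1]) (by linarith [hy.2])) (sq_nonneg _)
    · obtain ⟨y, hy, hyr⟩ : ∃ y ∈ Ioo a b, r.eval y ≠ 0 := by
        by_contra! hall
        exact hr0 (eq_zero_of_infinite_isRoot r ((Ioo_infinite hab).mono fun y hy => hall y hy))
      refine ⟨y, Ioo_subset_Icc_self hy, ?_⟩
      have h1 : 0 < y - a := by linarith [hy.1]
      have h2 : 0 < b - y := by linarith [hy.2]
      positivity
  have hneg : ∫ y in a..b, (y - a) * (b - y) * (r.eval y) ^ 2 =
      -∫ y in a..b, e.eval y * r.eval y := by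
    rw [← intervalIntegral.integral_neg]
    congr 1 with y
    rw [he₁, hr]
    simp only [eval_mul, eval_sub, eval_X, eval_C]
    ring
  rw [hneg, h0] at hpos
  simp at hpos

/-- By `eq_zero_of_orthogonal` the end point evaluation is injective on polynomials of degree ≤ k +
1 orthogonal to those of degree < k. A linear left inverse, applied to (1, 0) and (0, 1), gives `A`
and `B`; no dimension count is needed. -/
lemma exists_endpoint_basis {a b : ℝ} (hab : a < b) (k : ℕ) :
    ∃ A B : ℝ[X], ∀ e : ℝ[X], e.degree < (k + 2 : ℕ) →
      (∀ r : ℝ[X], r.degree < k → ∫ y in a..b, e.eval y * r.eval y = 0) →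
      e = e.eval a • A + e.eval b • B := by
  have hi : ∀ p r : ℝ[X], IntervalIntegrable (fun y => p.eval y * r.eval y) volume a b := fun p r =>
    (p.continuous.mul r.continuous).intervalIntegrable _ _
  let W : Submodule ℝ ℝ[X] :=
    { carrier := {e | e.degree < (k + 2 : ℕ) ∧
        ∀ r : ℝ[X], r.degree < k → ∫ y in a..b, e.eval y * r.eval y = 0}
      add_mem' := fun {p q} hp hq => ⟨(degree_add_le _ _).trans_lt (max_lt hp.1 hq.1), fun r hr => by
        simp only [eval_add, add_mul]
        rw [intervalIntegral.integral_add (hi p r) (hi q r), hp.2 r hr, hq.2 r hr, add_zero]⟩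
      zero_mem' := ⟨by rw [degree_zero]; exact WithBot.bot_lt_coe _, fun r _ => by simp⟩
      smul_mem' := fun c p hp => ⟨(degree_smul_le _ _).trans_lt hp.1, fun r hr => by
        simp only [eval_smul, smul_eq_mul, mul_assoc]
        rw [intervalIntegral.integral_const_mul, hp.2 r hr, mul_zero]⟩ }
  let Λ : W →ₗ[ℝ] ℝ × ℝ := ((leval a).comp W.subtype).prod ((leval b).comp W.subtype)
  have hker : LinearMap.ker Λ = ⊥ := by
    rw [LinearMap.ker_eq_bot']
    intro e he
    have h1 : (e : ℝ[X]).eval a = 0 := congrArg Prod.fst he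
    have h2 : (e : ℝ[X]).eval b = 0 := congrArg Prod.snd he
    exact Subtype.ext (eq_zero_of_orthogonal hab e.2.1 e.2.2 h1 h2)
  obtain ⟨Γ, hΓ⟩ := LinearMap.exists_leftInverse_of_injective Λ hker
  refine ⟨Γ (1, 0), Γ (0, 1), fun e h1 h2 => ?_⟩
  let e' : W := ⟨e, h1, h2⟩
  have h3 : Γ (Λ e') = e' := LinearMap.congr_fun hΓ e'
  have h4 : Λ e' = e.eval a • ((1 : ℝ), (0 : ℝ)) + e.eval b • ((0 : ℝ), (1 : ℝ)) := by
    change (e.eval a, e.eval b) = _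
    simp
  rw [h4, map_add, map_smul, map_smul] at h3
  exact (congrArg Subtype.val h3).symm

/-! ### Lipschitz continuity in time of the reconstructions -/

/-- Lipschitz continuity on `[0, T]`. -/
def IsLipOn {E : Type*} [PseudoEMetricSpace E] (T : ℝ) (f : ℝ → E) : Prop :=
  ∃ L, LipschitzOnWith L f (Icc 0 T)

lemma IsLipOn.comp₂ {X Y Z : Type*} [PseudoEMetricSpace X] [PseudoEMetricSpace Y]
    [PseudoEMetricSpace Z] {W : X → Y → Z} {S : Set (X × Y)} {T : ℝ} {f : ℝ → X} {h : ℝ → Y}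
    (hW : ∃ L, LipschitzOnWith L (fun z : X × Y => W z.1 z.2) S) (hf : IsLipOn T f)
    (hh : IsLipOn T h) (hS : ∀ s ∈ Icc 0 T, (f s, h s) ∈ S) :
    IsLipOn T (fun s => W (f s) (h s)) := by
  obtain ⟨L₁, h₁⟩ := hf
  obtain ⟨L₂, h₂⟩ := hh
  obtain ⟨L₃, h₃⟩ := hW
  exact ⟨_, h₃.comp (h₁.prodMk h₂) hS⟩

section IsLipOn

variable {E F : Type*} [SeminormedAddCommGroup E] [SeminormedAddCommGroup F]
  {T : ℝ} {f h : ℝ → E}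

lemma IsLipOn.congr (hf : IsLipOn T f) (H : EqOn h f (Icc 0 T)) : IsLipOn T h := by
  obtain ⟨L, hL⟩ := hf
  exact ⟨L, fun s hs t ht => by rw [H hs, H ht]; exact hL hs ht⟩

lemma IsLipOn.add (hf : IsLipOn T f) (hh : IsLipOn T h) : IsLipOn T (fun s => f s + h s) := by
  obtain ⟨L, hL⟩ := hf
  obtain ⟨L', hL'⟩ := hh
  exact ⟨_, hL.add hL'⟩

lemma IsLipOn.sub (hf : IsLipOn T f) (hh : IsLipOn T h) : IsLipOn T (fun s => f s - h s) := by
  obtain ⟨L, hL⟩ := hf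
  obtain ⟨L', hL'⟩ := hh
  exact ⟨_, hL.sub hL'⟩

lemma IsLipOn.const_smul [NormedSpace ℝ E] (c : ℝ) (hf : IsLipOn T f) : IsLipOn T (fun s => c • f s) := by
  obtain ⟨L, hL⟩ := hf
  exact ⟨_, (lipschitzWith_smul c).comp_lipschitzOnWith hL⟩

lemma IsLipOn.sum {ι : Type*} (S : Finset ι) {f : ι → ℝ → E} (hf : ∀ j ∈ S, IsLipOn T (f j)) :
    IsLipOn T (fun s => ∑ j ∈ S, f j s) := by
  classical
  induction S using Finset.induction_on with
  | empty => exact ⟨0, fun s _ t _ => by simp⟩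
  | insert j S hj ih =>
    simp only [Finset.sum_insert hj]
    exact (hf j (Finset.mem_insert_self j S)).add
      (ih fun i hi => hf i (Finset.mem_insert_of_mem hi))

lemma IsPartition.isLipOn {t : ℕ → ℝ} {N : ℕ} (ht : IsPartition t N 0 T)
    (h : ∀ n < N, ∃ L, LipschitzOnWith L f (Icc (t n) (t (n + 1)))) : IsLipOn T f := by
  choose! L hL using h
  refine ⟨(Finset.range N).sup L, ht.lipschitzOnWith fun n hn => (hL n hn).weaken ?_⟩
  exact Finset.le_sup (f := L) (Finset.mem_range.2 hn)

end IsLipOn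

section Reconstruction

variable {m : ℕ} {x : ℕ → ℝ} {M k n : ℕ} {T a b : ℝ}

lemma dgSpace_congr {v v' : ℝ → State m} (hv : v ∈ dgSpace x M n)
    (h : ∀ y ∈ meshInterior x M, v' y = v y) : v' ∈ dgSpace x M n := by
  intro i hi
  obtain ⟨p, hp, hpv⟩ := hv i hi
  refine ⟨p, hp, fun y hy j => ?_⟩
  rw [h y (mem_meshInterior.2 ⟨i, hi, hy⟩)]
  exact hpv y hy j

lemma IsTimePolynomial.mem_dgSpace {deg : ℕ} {P : ℝ → ℝ → State m}
    (hP : IsTimePolynomial x M k deg P) (s : ℝ) : P s ∈ dgSpace x M (k + 1) := by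
  obtain ⟨c, hc, hPc⟩ := hP
  intro i hi
  choose p hp hpc using fun l => hc l i hi
  refine ⟨fun j => ∑ l ∈ Finset.range (deg + 1), (s ^ l) • p l j, fun j => ?_, fun y hy j => ?_⟩
  · rw [← mem_degreeLT]
    exact Submodule.sum_mem _ fun l _ => Submodule.smul_mem _ _ (mem_degreeLT.2 (hp l j))
  · rw [hPc, eval_finsetSum, WithLp.ofLp_sum, Finset.sum_apply]
    refine Finset.sum_congr rfl fun l _ => ?_
    rw [eval_smul, PiLp.smul_apply, hpc l y hy j]

lemma IsTimePolynomial.exists_lipschitzOnWith {deg : ℕ} {P : ℝ → ℝ → State m}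
    (hP : IsTimePolynomial x M k deg P) (y s₀ s₁ : ℝ) :
    ∃ L, LipschitzOnWith L (fun s => P s y) (Icc s₀ s₁) := by
  obtain ⟨c, -, hPc⟩ := hP
  have : ContDiff ℝ 1 (fun s => P s y) := by
    simp only [hPc]
    fun_prop
  exact this.contDiffOn.exists_lipschitzOnWith one_ne_zero (convex_Icc _ _) isCompact_Icc

section Time

variable {t : ℕ → ℝ} {N p d r : ℕ} {F : ℕ → ℕ → ℝ → State m} {ut : ℝ → ℝ → State m}

lemma IsTimeReconstruction.mem_dgSpace (hT : 0 < T) (ht : IsPartition t N 0 T)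
    (hut : IsTimeReconstruction x M k t N p d r F ut) {s : ℝ} (hs : s ∈ Icc 0 T) :
    ut s ∈ dgSpace x M (k + 1) := by
  obtain ⟨n, hn, hsn⟩ := ht.exists_mem_Icc hT hs
  obtain ⟨P, hP, h1, -⟩ := hut n hn
  exact dgSpace_congr (hP.mem_dgSpace s) (h1 s hsn)

/-- On each closed time slab the function coincides with a polynomial in time, so neighbouring
pieces agree at the common level and the Lipschitz pieces glue. -/
lemma IsTimeReconstruction.isLipOn (ht : IsPartition t N 0 T)
    (hut : IsTimeReconstruction x M k t N p d r F ut) {y : ℝ} (hy : y ∈ meshInterior x M) :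
    IsLipOn T (fun s => ut s y) := by
  refine ht.isLipOn fun n hn => ?_
  obtain ⟨P, hP, h1, -⟩ := hut n hn
  obtain ⟨L, hL⟩ := hP.exists_lipschitzOnWith y (t n) (t (n + 1))
  exact ⟨L, fun s hs s' hs' => by
    simp only [h1 s hs y hy, h1 s' hs' y hy]
    exact hL hs hs'⟩

end Time

lemma isLipOn_cellExt (hx : IsPartition x M a b) {v : ℝ → ℝ → State m}
    (hv : ∀ y ∈ meshInterior x M, IsLipOn T (fun s => v s y)) {i : ℕ} (hi : i < M) (y : ℝ) :
    IsLipOn T (fun s => cellExt x n i (v s) y) :=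
  IsLipOn.sum _ fun _ hj =>
    (hv _ (node_mem_meshInterior hx hi (Finset.mem_range.1 hj))).const_smul _

lemma rightLim_eq_cellExt (hx : IsPartition x M a b) {v : ℝ → State m} (hv : v ∈ dgSpace x M n)
    {i : ℕ} (hi : i < M) {y : ℝ} (hy : y ∈ Ico (x i) (x (i + 1))) :
    Function.rightLim v y = cellExt x n i v y :=
  rightLim_eq_of_eqOn (continuous_cellExt x n i v) (fun _ hz => eq_cellExt hx hv hi hz) hy

lemma leftLim_eq_cellExt (hx : IsPartition x M a b) {v : ℝ → State m} (hv : v ∈ dgSpace x M n)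
    {i : ℕ} (hi : i < M) : Function.leftLim v (x (i + 1)) = cellExt x n i v (x (i + 1)) :=
  leftLim_eq_of_eqOn (continuous_cellExt x n i v) (fun _ hz => eq_cellExt hx hv hi hz)
    (hx.lt_succ i hi)

lemma cellExt_mem (hx : IsPartition x M a b) {K : Set (State m)} (hK : IsClosed K)
    {v : ℝ → State m} (hv : v ∈ dgSpace x M n) (hvK : ∀ y ∈ meshInterior x M, v y ∈ K)
    {i : ℕ} (hi : i < M) {y : ℝ} (hy : y ∈ Icc (x i) (x (i + 1))) : cellExt x n i v y ∈ K :=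
  mem_of_eqOn_of_continuous hK (continuous_cellExt x n i v)
    (fun _ hz => eq_cellExt hx hv hi hz)
    (fun y hy => hvK y (mem_meshInterior.2 ⟨i, hi, hy⟩)) (hx.lt_succ i hi) hy

lemma exists_traceL_eq {i : ℕ} (hi : i < M) :
    ∃ i' < M, ∀ v : ℝ → State m, traceL x M v i = Function.leftLim v (x (i' + 1)) := by
  rcases Nat.eq_zero_or_pos i with h | h
  · refine ⟨M - 1, by omega, fun v => ?_⟩
    rw [traceL, if_pos h, Nat.sub_add_cancel (by omega)]
  · refine ⟨i - 1, by omega, fun v => ?_⟩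
    rw [traceL, if_neg h.ne', Nat.sub_add_cancel h]

/-- The trace index of the right end point of a cell. -/
def nextNode (M i : ℕ) : ℕ := if i + 1 = M then 0 else i + 1

lemma nextNode_lt {i : ℕ} (hi : i < M) : nextNode M i < M := by
  unfold nextNode
  split_ifs <;> omega

lemma leftLim_eq_traceL (v : ℝ → State m) (i : ℕ) :
    Function.leftLim v (x (i + 1)) = traceL x M v (nextNode M i) := by
  unfold nextNode traceL
  split_ifs with h h' <;> simp_all

/-! ### The space-time reconstruction in terms of its interface values -/

section SpaceTime

variable {K U : Set (State m)} {w : State m → State m → State m} {ut ust : ℝ → ℝ → State m}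

lemma IsFluxState.exists_lipschitzOnWith (hw : IsFluxState U w) (hK : IsCompact K) (hKU : K ⊆ U) :
    ∃ L, LipschitzOnWith L (fun z : State m × State m => w z.1 z.2) (K ×ˢ K) :=
  (hw.locallyLipschitz.mono (prod_mono hKU hKU)).exists_lipschitzOnWith_of_compact (hK.prod hK)

/-- The interface values of the reconstruction are Lipschitz continuous in time. -/
lemma isLipOn_interface (hx : IsPartition x M a b) (hw : IsFluxState U w) (hK : IsCompact K)
    (hKU : K ⊆ U) (hmem : ∀ s ∈ Icc 0 T, ut s ∈ dgSpace x M n)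
    (hlip : ∀ y ∈ meshInterior x M, IsLipOn T (fun s => ut s y))
    (hutK : ∀ s ∈ Icc 0 T, ∀ y ∈ meshInterior x M, ut s y ∈ K) {i : ℕ} (hi : i < M) :
    IsLipOn T (fun s => w (traceL x M (ut s) i) (traceR x (ut s) i)) := by
  obtain ⟨i', hi', htr⟩ := exists_traceL_eq (m := m) (x := x) hi
  have eL : ∀ s ∈ Icc 0 T, traceL x M (ut s) i = cellExt x n i' (ut s) (x (i' + 1)) := fun s hs => by
    rw [htr, leftLim_eq_cellExt hx (hmem s hs) hi']
  have eR : ∀ s ∈ Icc 0 T, traceR x (ut s) i = cellExt x n i (ut s) (x i) := fun s hs =>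
    rightLim_eq_cellExt hx (hmem s hs) hi ⟨le_rfl, hx.lt_succ i hi⟩
  have h₁ : IsLipOn T (fun s => traceL x M (ut s) i) :=
    (isLipOn_cellExt hx hlip hi' _).congr eL
  have h₂ : IsLipOn T (fun s => traceR x (ut s) i) :=
    (isLipOn_cellExt hx hlip hi _).congr eR
  refine IsLipOn.comp₂ (hw.exists_lipschitzOnWith hK hKU) h₁ h₂ fun s hs => ⟨?_, ?_⟩
  · simp only [eL s hs]
    exact cellExt_mem hx hK.isClosed (hmem s hs) (hutK s hs) hi'
      ⟨(hx.lt_succ i' hi').le, le_rfl⟩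
  · simp only [eR s hs]
    exact cellExt_mem hx hK.isClosed (hmem s hs) (hutK s hs) hi
      ⟨le_rfl, (hx.lt_succ i hi).le⟩

/-- On each cell the reconstruction is determined by its end point values. -/
lemma exists_reconstruction_formula (hx : IsPartition x M (-1) 1) {i : ℕ} (hi : i < M) :
    ∃ A B : ℝ[X], ∀ v v' : ℝ → State m, v ∈ dgSpace x M (k + 2) → v' ∈ dgSpace x M (k + 1) →
      (∀ ψ ∈ dgSpace (m := m) x M k, ∫ y in cellT, inner ℝ (v y - v' y) (ψ y) = 0) →
      ∀ y ∈ Ioo (x i) (x (i + 1)), v y = v' y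
        + A.eval y • (Function.rightLim v (x i) - Function.rightLim v' (x i))
        + B.eval y • (Function.leftLim v (x (i + 1)) - Function.leftLim v' (x (i + 1))) := by
  have hlt := hx.lt_succ i hi
  obtain ⟨A, B, hAB⟩ := exists_endpoint_basis hlt k
  refine ⟨A, B, fun v v' hv hv' horth y hy => ?_⟩
  obtain ⟨p, hp, hpv⟩ := hv i hi
  obtain ⟨p', hp', hpv'⟩ := hv' i hi
  have hval : ∀ (p : Fin m → ℝ[X]) (v : ℝ → State m),
      (∀ y ∈ Ioo (x i) (x (i + 1)), ∀ j, v y j = (p j).eval y) →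
      Function.rightLim v (x i) = WithLp.toLp 2 (fun j => (p j).eval (x i)) ∧
      Function.leftLim v (x (i + 1)) = WithLp.toLp 2 (fun j => (p j).eval (x (i + 1))) := by
    intro p v hpv
    have hc : Continuous (fun y => (WithLp.toLp 2 (fun j => (p j).eval y) : State m)) := by fun_prop
    have heq : EqOn v (fun y => (WithLp.toLp 2 (fun j => (p j).eval y) : State m))
        (Ioo (x i) (x (i + 1))) := fun y hy => by
      ext j
      exact hpv y hy j
    exact ⟨rightLim_eq_of_eqOn hc heq ⟨le_rfl, hlt⟩, leftLim_eq_of_eqOn hc heq hlt⟩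
  have h1 := hval p v hpv
  have h2 := hval p' v' hpv'
  ext j
  have hdeg : (p j - p' j).degree < (k + 2 : ℕ) := by
    refine (degree_sub_le _ _).trans_lt (max_lt (hp j) ((hp' j).trans ?_))
    exact_mod_cast Nat.lt_succ_self (k + 1)
  have hint : ∀ r : ℝ[X], r.degree < k →
      ∫ y in x i..x (i + 1), (p j - p' j).eval y * r.eval y = 0 := by
    intro r hr
    classical
    -- Test functions may be discontinuous: supporting ψ in one cell and one component reduces
    -- orthogonality on the torus to the scalar condition on that cell.
    set ψ : ℝ → State m := fun y =>
      if y ∈ Ioo (x i) (x (i + 1)) then EuclideanSpace.single j (r.eval y) else 0 with hψ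
    have hψm : ψ ∈ dgSpace x M k := by
      intro i' hi'
      by_cases h : i' = i
      · subst h
        refine ⟨fun j' => if j' = j then r else 0, fun j' => ?_, fun y hy j' => ?_⟩
        · simp only
          split_ifs
          · exact hr
          · rw [degree_zero]; exact WithBot.bot_lt_coe k
        · simp only [hψ, if_pos hy, PiLp.single_apply]
          split_ifs <;> simp
      · refine ⟨fun _ => 0, fun j' => by rw [degree_zero]; exact WithBot.bot_lt_coe k,
          fun y hy j' => ?_⟩
        simp only [hψ, if_neg (fun hy' => h (hx.cell_unique hi' hi hy hy'))]
        simp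
    rw [← horth ψ hψm, intervalIntegral.integral_of_le hlt.le, integral_Ioc_eq_integral_Ioo]
    have hsub : Ioo (x i) (x (i + 1)) ⊆ cellT :=
      Ioo_subset_Ioo (hx.mem_Icc hi.le).1 (hx.mem_Icc hi).2
    have hind : ∀ y, inner ℝ (v y - v' y) (ψ y) = indicator (Ioo (x i) (x (i + 1)))
        (fun y => (p j - p' j).eval y * r.eval y) y := by
      intro y
      by_cases hy : y ∈ Ioo (x i) (x (i + 1))
      · simp only [hψ, if_pos hy, indicator_of_mem hy, EuclideanSpace.inner_single_right,
          PiLp.sub_apply, hpv y hy, hpv' y hy, eval_sub]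
        simp [mul_comm]
      · simp only [hψ, if_neg hy, indicator_of_notMem hy, inner_zero_right]
    simp only [hind]
    rw [setIntegral_indicator measurableSet_Ioo, inter_eq_self_of_subset_right hsub]
  have h3 := congrArg (eval y) (hAB _ hdeg hint)
  simp only [eval_add, eval_smul, eval_sub, smul_eq_mul] at h3
  rw [h1.1, h1.2, h2.1, h2.2]
  simp only [PiLp.add_apply, PiLp.smul_apply, PiLp.sub_apply, hpv y hy j, hpv' y hy j, smul_eq_mul]
  linarith

/-- In the cell formula `A`, `B` do not depend on time, the traces of `ust` are values of `w`, and
those of `ut` are linear in its nodal values; each of these is Lipschitz in time. -/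
lemma IsSpaceTimeReconstruction.isLipOn (hx : IsPartition x M (-1) 1) (hw : IsFluxState U w)
    (hK : IsCompact K) (hKU : K ⊆ U) (hmem : ∀ s ∈ Icc 0 T, ut s ∈ dgSpace x M (k + 1))
    (hlip : ∀ y ∈ meshInterior x M, IsLipOn T (fun s => ut s y))
    (hutK : ∀ s ∈ Icc 0 T, ∀ y ∈ meshInterior x M, ut s y ∈ K)
    (hust : IsSpaceTimeReconstruction x M k T w ut ust) {y : ℝ} (hy : y ∈ meshInterior x M) :
    IsLipOn T (fun s => ust s y) := by
  obtain ⟨i, hi, hyi⟩ := mem_meshInterior.1 hy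
  obtain ⟨A, B, hAB⟩ := exists_reconstruction_formula (m := m) (k := k) hx hi
  have hif := fun {i : ℕ} (hi : i < M) => isLipOn_interface hx hw hK hKU hmem hlip hutK hi
  refine IsLipOn.congr (((hlip y hy).add
    (((hif hi).sub (isLipOn_cellExt (n := k + 1) hx hlip hi (x i))).const_smul (A.eval y))).add
    (((hif (nextNode_lt hi)).sub
      (isLipOn_cellExt (n := k + 1) hx hlip hi (x (i + 1)))).const_smul (B.eval y))) fun s hs => ?_
  rw [hAB _ _ (hust.mem s hs) (hmem s hs) (hust.orthogonal s hs) y hyi,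
    leftLim_eq_traceL (M := M) (ust s), hust.trace_left s hs _ (nextNode_lt hi),
    leftLim_eq_cellExt hx (hmem s hs) hi,
    rightLim_eq_cellExt hx (hmem s hs) hi ⟨le_rfl, hx.lt_succ i hi⟩,
    ← hust.trace_right s hs i hi]
  rfl

end SpaceTime

end Reconstruction

/-! ### The Lipschitz continuous extension of the space-time reconstruction -/

section Uniform

variable {m : ℕ} {x : ℕ → ℝ} {M n : ℕ} {T a b : ℝ}

lemma exists_uniform_bound {M n : ℕ} {P : ℝ≥0 → ℕ → ℕ → Prop}
    (hP : ∀ i < M, ∀ j < n, ∃ L, P L i j) (hmono : ∀ L L' i j, L ≤ L' → P L i j → P L' i j) :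
    ∃ L, ∀ i < M, ∀ j < n, P L i j := by
  choose! L hL using hP
  refine ⟨(Finset.range M ×ˢ Finset.range n).sup (fun p => L p.1 p.2), fun i hi j hj =>
    hmono _ _ i j ?_ (hL i hi j hj)⟩
  exact Finset.le_sup (f := fun p : ℕ × ℕ => L p.1 p.2)
    (Finset.mem_product.2 ⟨Finset.mem_range.2 hi, Finset.mem_range.2 hj⟩ :
      (i, j) ∈ Finset.range M ×ˢ Finset.range n)

lemma exists_lipschitz_space (hx : IsPartition x M a b) (pol : ℕ → ℕ → ℝ[X]) {C : ℝ} (hC : 0 ≤ C) :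
    ∃ L : ℝ≥0, ∀ v : ℝ → State m, (∀ y ∈ meshInterior x M, ‖v y‖ ≤ C) → ∀ i < M,
      LipschitzOnWith L (fun y => ∑ j ∈ Finset.range n, (pol i j).eval y • v (node x n i j))
        (Icc a b) := by
  obtain ⟨Λ, hΛ⟩ := exists_uniform_bound (M := M) (n := n)
    (P := fun L i j => LipschitzOnWith L (fun y => (pol i j).eval y) (Icc a b))
    (fun i _ j _ => ((pol i j).contDiff_aeval (𝕜 := ℝ) 1).contDiffOn.exists_lipschitzOnWith one_ne_zero
      (convex_Icc a b) isCompact_Icc)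
    (fun L L' i j hL h => h.weaken hL)
  refine ⟨n * (Λ * C.toNNReal), fun v hv i hi => LipschitzOnWith.of_dist_le_mul fun y hy z hz => ?_⟩
  rw [dist_eq_norm, ← Finset.sum_sub_distrib]
  have h1 : ∀ j ∈ Finset.range n, ‖(pol i j).eval y • v (node x n i j)
      - (pol i j).eval z • v (node x n i j)‖ ≤ Λ * C * dist y z := by
    intro j hj
    have hj' := Finset.mem_range.1 hj
    have h2 := (hΛ i hi j hj').dist_le_mul y hy z hz
    rw [dist_eq_norm] at h2
    rw [← sub_smul, norm_smul]
    calc _ ≤ (Λ * dist y z) * C :=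
          mul_le_mul h2 (hv _ (node_mem_meshInterior hx hi hj')) (norm_nonneg _) (by positivity)
      _ = _ := by ring
  refine (norm_sum_le_of_le _ h1).trans (le_of_eq ?_)
  rw [Finset.sum_const, Finset.card_range, nsmul_eq_mul]
  push_cast
  rw [Real.coe_toNNReal _ hC]
  ring

/-- The coefficients `pol` are arbitrary so that one statement serves both the cell bases and their
derivatives; the constant is uniform in the cell and the point. -/
lemma exists_lipschitz_time (hx : IsPartition x M a b) (pol : ℕ → ℕ → ℝ[X]) {v : ℝ → ℝ → State m}
    (hv : ∀ y ∈ meshInterior x M, IsLipOn T (fun s => v s y)) :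
    ∃ L : ℝ≥0, ∀ i < M, ∀ y ∈ Icc a b, LipschitzOnWith L
      (fun s => ∑ j ∈ Finset.range n, (pol i j).eval y • v s (node x n i j)) (Icc 0 T) := by
  obtain ⟨Λ, hΛ⟩ := exists_uniform_bound (M := M) (n := n)
    (P := fun L i j => LipschitzOnWith L (fun s => v s (node x n i j)) (Icc 0 T))
    (fun i hi j hj => hv _ (node_mem_meshInterior hx hi hj))
    (fun L L' i j hL h => h.weaken hL)
  obtain ⟨B, hB⟩ := exists_uniform_bound (M := M) (n := n)
    (P := fun L i j => ∀ y ∈ Icc a b, ‖(pol i j).eval y‖ ≤ L)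
    (fun i _ j _ => by
      obtain ⟨C, hC⟩ := (isCompact_Icc (a := a) (b := b)).exists_bound_of_continuousOn
        (pol i j).continuous.continuousOn
      exact ⟨C.toNNReal, fun y hy => (hC y hy).trans (Real.le_coe_toNNReal C)⟩)
    (fun L L' i j hL h y hy => (h y hy).trans (NNReal.coe_le_coe.2 hL))
  refine ⟨n * (B * Λ), fun i hi y hy => LipschitzOnWith.of_dist_le_mul fun s hs s' hs' => ?_⟩
  rw [dist_eq_norm, ← Finset.sum_sub_distrib]
  have h1 : ∀ j ∈ Finset.range n, ‖(pol i j).eval y • v s (node x n i j)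
      - (pol i j).eval y • v s' (node x n i j)‖ ≤ B * Λ * dist s s' := by
    intro j hj
    have hj' := Finset.mem_range.1 hj
    have h2 := (hΛ i hi j hj').dist_le_mul s hs s' hs'
    rw [dist_eq_norm] at h2
    rw [← smul_sub, norm_smul]
    calc _ ≤ B * (Λ * dist s s') :=
          mul_le_mul (hB i hi j hj' y hy) h2 (norm_nonneg _) B.2
      _ = _ := by ring
  refine (norm_sum_le_of_le _ h1).trans (le_of_eq ?_)
  rw [Finset.sum_const, Finset.card_range, nsmul_eq_mul]
  push_cast
  ring

end Uniform

section Extension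

variable {m : ℕ} {x : ℕ → ℝ} {M n : ℕ} {T : ℝ}

/-- The continuous extension of a piecewise polynomial to `[-1, 1]`. -/
def nodalExt (v : ℝ → State m) (y : ℝ) : State m :=
  if y = 1 then Function.rightLim v (-1) else Function.rightLim v y

/-- At the right end of a cell the right limit comes from the next cell (from the first one at 1).
Equality of the two traces makes it agree with the polynomial of the present cell, which is
continuity across the interfaces. -/
lemma nodalExt_eq_cellExt (hx : IsPartition x M (-1) 1) {v : ℝ → State m} (hv : v ∈ dgSpace x M n)
    (htr : ∀ i < M, traceL x M v i = traceR x v i) {i : ℕ} (hi : i < M) {y : ℝ}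
    (hy : y ∈ Icc (x i) (x (i + 1))) : nodalExt v y = cellExt x n i v y := by
  unfold nodalExt
  rcases hy.2.lt_or_eq with h | h
  · rw [if_neg (h.trans_le (hx.mem_Icc hi).2).ne, rightLim_eq_cellExt hx hv hi ⟨hy.1, h⟩]
  · rw [h, ← leftLim_eq_cellExt hx hv hi, leftLim_eq_traceL (M := M), htr _ (nextNode_lt hi), traceR,
      nextNode]
    by_cases hM : i + 1 = M
    · rw [if_pos (by rw [hM, hx.right]), if_pos hM, hx.left]
    · have h1 : x (i + 1) < 1 :=
        (hx.lt_succ (i + 1) (by omega)).trans_le (hx.mem_Icc (by omega)).2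
      rw [if_neg h1.ne, if_neg hM]

/-- The periodic extension to the plane, constant in time outside of `[0, T]`. -/
def extension (hT : 0 < T) (v : ℝ → ℝ → State m) (z : ℝ × ℝ) : State m :=
  periodize (nodalExt (v (projIcc 0 T hT.le z.1))) z.2

lemma extension_periodic (hT : 0 < T) (v : ℝ → ℝ → State m) (s y : ℝ) :
    extension hT v (s, y + 2) = extension hT v (s, y) :=
  periodize_add_two _ _

variable {v : ℝ → ℝ → State m} {K : Set (State m)}

/-- The cell and the point `y'` in it depend on `y` only, so time regularity can be read off from
one fixed formula. -/
lemma exists_extension_eq (hx : IsPartition x M (-1) 1) (hT : 0 < T)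
    (hv : ∀ s ∈ Icc 0 T, v s ∈ dgSpace x M n)
    (htr : ∀ s ∈ Icc 0 T, ∀ i < M, traceL x M (v s) i = traceR x (v s) i) (y : ℝ) :
    ∃ i < M, ∃ y' ∈ Icc (x i) (x (i + 1)), ∀ s, extension hT v (s, y) =
      cellExt x n i (v (projIcc 0 T hT.le s)) y' := by
  have hy := toIcoMod_mem_Ico (two_pos : (0 : ℝ) < 2) (-1) y
  rw [show (-1 : ℝ) + 2 = 1 by norm_num] at hy
  obtain ⟨i, hi, hyi⟩ := hx.exists_mem_Icc (by norm_num) (Ico_subset_Icc_self hy)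
  exact ⟨i, hi, _, hyi, fun s => nodalExt_eq_cellExt hx (hv _ (projIcc 0 T hT.le s).2)
    (htr _ (projIcc 0 T hT.le s).2) hi hyi⟩

lemma extension_eq (hx : IsPartition x M (-1) 1) (hT : 0 < T)
    (hv : ∀ s ∈ Icc 0 T, v s ∈ dgSpace x M n) {s y : ℝ} (hs : s ∈ Icc 0 T)
    (hy : y ∈ meshInterior x M) : extension hT v (s, y) = v s y := by
  have hyc := hx.meshInterior_subset hy
  obtain ⟨i, hi, hyi⟩ := mem_meshInterior.1 hy
  unfold extension
  rw [periodize_eq _ ⟨hyc.1.le, hyc.2⟩, projIcc_of_mem hT.le hs, nodalExt, if_neg hyc.2.ne,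
    rightLim_eq_cellExt hx (hv s hs) hi ⟨hyi.1.le, hyi.2⟩, ← eq_cellExt hx (hv s hs) hi hyi]

lemma extension_mem (hx : IsPartition x M (-1) 1) (hT : 0 < T) (hK : IsClosed K)
    (hv : ∀ s ∈ Icc 0 T, v s ∈ dgSpace x M n)
    (htr : ∀ s ∈ Icc 0 T, ∀ i < M, traceL x M (v s) i = traceR x (v s) i)
    (hvK : ∀ s ∈ Icc 0 T, ∀ y ∈ meshInterior x M, v s y ∈ K) (z : ℝ × ℝ) :
    extension hT v z ∈ K := by
  obtain ⟨i, hi, y', hy', h⟩ := exists_extension_eq hx hT hv htr z.2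
  have := h z.1
  rw [Prod.mk.eta] at this
  rw [this]
  exact cellExt_mem hx hK (hv _ (projIcc 0 T hT.le _).2) (hvK _ (projIcc 0 T hT.le _).2) hi hy'

/-- Lipschitz in each variable, uniformly in the other, implies jointly Lipschitz. In space the
constant is uniform because values stay in the compact set `K`, which bounds all nodal values. -/
lemma exists_lipschitzWith_extension (hx : IsPartition x M (-1) 1) (hT : 0 < T)
    (hK : IsCompact K) (hv : ∀ s ∈ Icc 0 T, v s ∈ dgSpace x M n)
    (htr : ∀ s ∈ Icc 0 T, ∀ i < M, traceL x M (v s) i = traceR x (v s) i)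
    (hvK : ∀ s ∈ Icc 0 T, ∀ y ∈ meshInterior x M, v s y ∈ K)
    (hlip : ∀ y ∈ meshInterior x M, IsLipOn T (fun s => v s y)) :
    ∃ L, LipschitzWith L (extension hT v) := by
  obtain ⟨C, hC0, hC⟩ := hK.isBounded.exists_pos_norm_le
  obtain ⟨L₁, h₁⟩ := exists_lipschitz_space (m := m) (n := n) hx (cellBasis x n) hC0.le
  obtain ⟨L₂, h₂⟩ := exists_lipschitz_time (n := n) hx (cellBasis x n) hlip
  have hspace : ∀ s, LipschitzWith L₁ (fun y => extension hT v (s, y)) := by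
    intro s
    have hs := (projIcc 0 T hT.le s).2
    have hglue : LipschitzOnWith L₁ (nodalExt (v (projIcc 0 T hT.le s))) (Icc (-1) 1) := by
      refine hx.lipschitzOnWith fun i hi y hy z hz => ?_
      rw [nodalExt_eq_cellExt hx (hv _ hs) (htr _ hs) hi hy,
        nodalExt_eq_cellExt hx (hv _ hs) (htr _ hs) hi hz]
      exact h₁ _ (fun y hy => hC _ (hvK _ hs y hy)) i hi (hx.Icc_subset hi hy)
        (hx.Icc_subset hi hz)
    refine lipschitzWith_periodize hglue ?_
    unfold nodalExt
    rw [if_pos rfl, if_neg (by norm_num)]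
  have htime : ∀ y, LipschitzWith L₂ (fun s => extension hT v (s, y)) := by
    intro y
    obtain ⟨i, hi, y', hy', h⟩ := exists_extension_eq hx hT hv htr y
    simp only [h]
    have hproj : LipschitzWith 1 (fun t => (projIcc 0 T hT.le t : ℝ)) := by
      have := (LipschitzWith.subtype_val (Icc 0 T)).comp (LipschitzWith.projIcc hT.le)
      rwa [mul_one] at this
    have := (h₂ i hi y' (hx.Icc_subset hi hy')).comp (hproj.lipschitzOnWith (s := univ))
      (fun s _ => (projIcc 0 T hT.le s).2)
    rw [mul_one, lipschitzOnWith_univ] at this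
    exact this
  exact ⟨_, LipschitzWith.uncurry (f := fun s y => extension hT v (s, y)) htime hspace⟩

end Extension

/-! ### The norm of `L^∞(𝕋)` -/

section Linf

variable {m : ℕ} {f f' : ℝ → State m} {C : ℝ}

lemma linf_nonneg (f : ℝ → State m) : 0 ≤ linf f := ENNReal.toReal_nonneg

lemma linf_le (hC : 0 ≤ C) (h : ∀ᵐ y ∂(volume.restrict cellT), ‖f y‖ ≤ C) : linf f ≤ C := by
  unfold linf
  rw [eLpNorm_exponent_top]
  exact ENNReal.toReal_le_of_le_ofReal hC (eLpNormEssSup_le_of_ae_bound h)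

/-- The a priori bound makes the essential supremum finite; at infinity `toReal` would return 0 and
the conclusion could fail. -/
lemma ae_le_linf (h : ∀ᵐ y ∂(volume.restrict cellT), ‖f y‖ ≤ C) :
    ∀ᵐ y ∂(volume.restrict cellT), ‖f y‖ ≤ linf f := by
  have hfin : eLpNormEssSup f (volume.restrict cellT) ≠ ⊤ :=
    (eLpNormEssSup_lt_top_of_ae_bound h).ne
  filter_upwards [enorm_ae_le_eLpNormEssSup f (volume.restrict cellT)] with y hy
  have := ENNReal.toReal_mono hfin hy
  rwa [toReal_enorm, ← eLpNorm_exponent_top] at this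

/-- A point of violation would come with a nonempty open set of them, which has positive measure. -/
lemma le_linf_of_continuousOn {O : Set ℝ} (hO : IsOpen O) (hOc : O ⊆ cellT) (hf : ContinuousOn f O)
    (h : ∀ᵐ y ∂(volume.restrict cellT), ‖f y‖ ≤ C) {y : ℝ} (hy : y ∈ O) : ‖f y‖ ≤ linf f := by
  by_contra! hlt
  have hopen : IsOpen (O ∩ (fun y => ‖f y‖) ⁻¹' Ioi (linf f)) :=
    hf.norm.isOpen_inter_preimage hO isOpen_Ioi
  have hpos := hopen.measure_pos volume ⟨y, hy, hlt⟩
  have hzero := ae_le_linf h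
  rw [ae_restrict_iff' measurableSet_cellT] at hzero
  refine hpos.ne' (measure_mono_null (fun z hz => ?_) hzero)
  exact fun hz' => absurd (hz' (hOc hz.1)) (not_le.2 hz.2)

lemma linf_le_linf_add {r : ℝ} (hr : 0 ≤ r) (h : ∀ᵐ y ∂(volume.restrict cellT), ‖f' y‖ ≤ C)
    (hd : ∀ᵐ y ∂(volume.restrict cellT), ‖f y - f' y‖ ≤ r) : linf f ≤ linf f' + r := by
  refine linf_le (add_nonneg (linf_nonneg _) hr) ?_
  filter_upwards [ae_le_linf h, hd] with y h1 h2
  linarith [norm_le_norm_sub_add (f y) (f' y)]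

end Linf

/-! ### Spatial derivatives of the reconstruction -/

section Derivative

variable {m : ℕ} {x : ℕ → ℝ} {M n : ℕ} {T : ℝ} {v : ℝ → ℝ → State m} {K : Set (State m)}

lemma hasDerivAt_of_mem_dgSpace (hx : IsPartition x M (-1) 1) {v : ℝ → State m}
    (hv : v ∈ dgSpace x M n) {i : ℕ} (hi : i < M) {y : ℝ} (hy : y ∈ Ioo (x i) (x (i + 1))) :
    HasDerivAt v
      (∑ j ∈ Finset.range n, (derivative (cellBasis x n i j)).eval y • v (node x n i j)) y := by
  refine (hasDerivAt_cellExt x n i v y).congr_of_eventuallyEq ?_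
  filter_upwards [Ioo_mem_nhds hy.1 hy.2] with z hz using eq_cellExt hx hv hi hz

lemma exists_bound_deriv (hx : IsPartition x M (-1) 1) (hK : IsCompact K)
    (hv : ∀ s ∈ Icc 0 T, v s ∈ dgSpace x M n)
    (hvK : ∀ s ∈ Icc 0 T, ∀ y ∈ meshInterior x M, v s y ∈ K) :
    ∃ C, ∀ s ∈ Icc 0 T, ∀ y ∈ meshInterior x M, ‖deriv (v s) y‖ ≤ C := by
  obtain ⟨C, hC0, hC⟩ := hK.isBounded.exists_pos_norm_le
  obtain ⟨L, hL⟩ := exists_lipschitz_space (m := m) (n := n) hx (cellBasis x n) hC0.le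
  refine ⟨L, fun s hs y hy => ?_⟩
  obtain ⟨i, hi, hyi⟩ := mem_meshInterior.1 hy
  rw [(hasDerivAt_of_mem_dgSpace hx (hv s hs) hi hyi).deriv, ← (hasDerivAt_cellExt x n i (v s) y).deriv]
  have hyc := hx.meshInterior_subset hy
  exact norm_deriv_le_of_lipschitzOn (Icc_mem_nhds hyc.1 hyc.2)
    (hL (v s) (fun y hy => hC _ (hvK s hs y hy)) i hi)

/-- A bound at every point of the open cells avoids having to assemble the null sets of the single
time slices into a null set of space-time. -/
lemma norm_deriv_le_linf (hx : IsPartition x M (-1) 1) (hK : IsCompact K)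
    (hv : ∀ s ∈ Icc 0 T, v s ∈ dgSpace x M n)
    (hvK : ∀ s ∈ Icc 0 T, ∀ y ∈ meshInterior x M, v s y ∈ K) {s y : ℝ} (hs : s ∈ Icc 0 T)
    (hy : y ∈ meshInterior x M) : ‖deriv (v s) y‖ ≤ linf (deriv (v s)) := by
  obtain ⟨C, hC⟩ := exists_bound_deriv hx hK hv hvK
  refine le_linf_of_continuousOn isOpen_meshInterior hx.meshInterior_subset (fun z hz => ?_)
    (hx.ae_mem_meshInterior.mono fun z hz => hC s hs z hz) hy
  obtain ⟨i, hi, hzi⟩ := mem_meshInterior.1 hz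
  have hc : Continuous fun y =>
      ∑ j ∈ Finset.range n, (derivative (cellBasis x n i j)).eval y • v s (node x n i j) :=
    continuous_finsetSum _ fun j _ => (derivative (cellBasis x n i j)).continuous.smul
      continuous_const
  refine (hc.continuousAt.congr ?_).continuousWithinAt
  filter_upwards [Ioo_mem_nhds hzi.1 hzi.2] with y' hy'
  exact (hasDerivAt_of_mem_dgSpace hx (hv s hs) hi hy').deriv.symm

/-- On each cell the derivative is linear in the nodal values, which are Lipschitz in time. This
makes the Gronwall coefficient continuous, as the integrating factor requires. -/
lemma continuousOn_linf_deriv (hx : IsPartition x M (-1) 1) (hK : IsCompact K)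
    (hv : ∀ s ∈ Icc 0 T, v s ∈ dgSpace x M n)
    (hvK : ∀ s ∈ Icc 0 T, ∀ y ∈ meshInterior x M, v s y ∈ K)
    (hlip : ∀ y ∈ meshInterior x M, IsLipOn T (fun s => v s y)) :
    ContinuousOn (fun s => linf (deriv (v s))) (Icc 0 T) := by
  obtain ⟨C, hC⟩ := exists_bound_deriv hx hK hv hvK
  obtain ⟨L, hL⟩ := exists_lipschitz_time (n := n) hx (fun i j => derivative (cellBasis x n i j)) hlip
  refine (LipschitzOnWith.of_le_add_mul L fun s hs s' hs' => ?_).continuousOn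
  refine linf_le_linf_add (by positivity) (hx.ae_mem_meshInterior.mono fun z hz => hC s' hs' z hz) ?_
  filter_upwards [hx.ae_mem_meshInterior] with y hy
  obtain ⟨i, hi, hyi⟩ := mem_meshInterior.1 hy
  rw [(hasDerivAt_of_mem_dgSpace hx (hv s hs) hi hyi).deriv,
    (hasDerivAt_of_mem_dgSpace hx (hv s' hs') hi hyi).deriv, ← dist_eq_norm]
  exact (hL i hi y (Ioo_subset_Icc_self (hx.meshInterior_subset hy))).dist_le_mul s hs s' hs'

end Derivative

/-! ### The a posteriori error bound -/

section Bound

variable {m : ℕ} {x : ℕ → ℝ} {M n : ℕ} {T : ℝ}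

lemma ae_cylinder_of_ae_cellT {P : ℝ → Prop} (h : ∀ᵐ y ∂(volume.restrict cellT), P y) (T : ℝ) :
    ∀ᵐ z ∂(volume.restrict (cylinder T)), P z.2 := by
  rw [restrict_cylinder]
  exact Measure.quasiMeasurePreserving_snd.ae h

lemma integrableOn_norm_sub_sq_of_mem_dgSpace (hx : IsPartition x M (-1) 1) {v φ : ℝ → State m}
    (hv : v ∈ dgSpace x M n) (hφ : Continuous φ) :
    IntegrableOn (fun y => ‖φ y - v y‖ ^ 2) cellT := by
  have h : IntegrableOn (fun y => ‖φ y - v y‖ ^ 2) (meshInterior x M) := by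
    refine (integrableOn_finset_iUnion).2 fun i hi => ?_
    have hc : Continuous fun y => ‖φ y - cellExt x n i v y‖ ^ 2 :=
      ((hφ.sub (continuous_cellExt x n i v)).norm).pow 2
    refine ((hc.integrableOn_Icc (a := x i) (b := x (i + 1))).mono_set Ioo_subset_Icc_self).congr_fun
      (fun y hy => ?_) measurableSet_Ioo
    simp only [eq_cellExt hx hv (Finset.mem_range.1 hi) hy]
  refine h.mono_set_ae ?_
  exact (ae_restrict_iff' measurableSet_cellT).1 hx.ae_mem_meshInterior

lemma integrableOn_norm_sub_sq_of_bounded {f φ : ℝ → State m}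
    (hf : AEStronglyMeasurable f (volume.restrict cellT)) {C C' : ℝ}
    (hC : ∀ᵐ y ∂(volume.restrict cellT), ‖f y‖ ≤ C) (hφ : Continuous φ) (hC' : ∀ y, ‖φ y‖ ≤ C') :
    IntegrableOn (fun y => ‖f y - φ y‖ ^ 2) cellT := by
  have hfin : IsFiniteMeasure (volume.restrict cellT) :=
    ⟨by rw [Measure.restrict_apply_univ, cellT]; exact measure_Ioo_lt_top⟩
  refine Integrable.of_bound ((hf.sub hφ.aestronglyMeasurable).norm.pow 2) ((C + C') ^ 2) ?_
  filter_upwards [hC] with y hy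
  have h1 : ‖f y - φ y‖ ≤ C + C' := (norm_sub_le _ _).trans (add_le_add hy (hC' y))
  rw [norm_pow, norm_norm]
  gcongr

lemma norm_sub_sq_le_two_mul {E : Type*} [SeminormedAddCommGroup E] (a b c : E) :
    ‖a - c‖ ^ 2 ≤ 2 * ‖b - c‖ ^ 2 + 2 * ‖a - b‖ ^ 2 := by
  have h1 : ‖a - c‖ ≤ ‖a - b‖ + ‖b - c‖ := norm_sub_le_norm_sub_add_norm_sub a b c
  have h2 : ‖a - c‖ ^ 2 ≤ (‖a - b‖ + ‖b - c‖) ^ 2 := by gcongr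
  nlinarith [sq_nonneg (‖a - b‖ - ‖b - c‖)]

lemma fderiv_extension_space (hx : IsPartition x M (-1) 1) (hT : 0 < T) {v : ℝ → ℝ → State m}
    (hv : ∀ s ∈ Icc 0 T, v s ∈ dgSpace x M n) {z : ℝ × ℝ} (hs : z.1 ∈ Icc 0 T)
    (hy : z.2 ∈ meshInterior x M) (hd : DifferentiableAt ℝ (extension hT v) z) :
    HasDerivAt (v z.1) (fderiv ℝ (extension hT v) z (0, 1)) z.2 := by
  refine (hasDerivAt_snd_of_hasFDerivAt (t := z.1) (x := z.2)
    hd.hasFDerivAt).congr_of_eventuallyEq ?_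
  filter_upwards [isOpen_meshInterior.mem_nhds hy] with y hy
  exact (extension_eq hx hT hv hs hy).symm

lemma fderiv_extension_time (hx : IsPartition x M (-1) 1) (hT : 0 < T) {v : ℝ → ℝ → State m}
    (hv : ∀ s ∈ Icc 0 T, v s ∈ dgSpace x M n) {z : ℝ × ℝ} (hs : z.1 ∈ Ioo 0 T)
    (hy : z.2 ∈ meshInterior x M) (hd : DifferentiableAt ℝ (extension hT v) z) :
    HasDerivAt (fun s => v s z.2) (fderiv ℝ (extension hT v) z (1, 0)) z.1 := by
  refine (hasDerivAt_fst_of_hasFDerivAt (t := z.1) (x := z.2)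
    hd.hasFDerivAt).congr_of_eventuallyEq ?_
  filter_upwards [isOpen_Ioo.mem_nhds hs] with s hs
  exact (extension_eq hx hT hv (Ioo_subset_Icc_self hs) hy).symm

lemma residual_eq_fderivResidual (hx : IsPartition x M (-1) 1) (hT : 0 < T)
    {g : State m → State m} {v : ℝ → ℝ → State m}
    (hv : ∀ s ∈ Icc 0 T, v s ∈ dgSpace x M n) {z : ℝ × ℝ} (hs : z.1 ∈ Ioo 0 T)
    (hy : z.2 ∈ meshInterior x M) (hd : DifferentiableAt ℝ (extension hT v) z)
    (hg : DifferentiableAt ℝ g (v z.1 z.2)) :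
    residual g v z = fderivResidual g (extension hT v) z := by
  have hs' := Ioo_subset_Icc_self hs
  have he : extension hT v z = v z.1 z.2 := extension_eq hx hT hv hs' hy
  have h := hg.hasFDerivAt.comp_hasDerivAt z.2 (fderiv_extension_space hx hT hv hs' hy hd)
  unfold residual fderivResidual
  rw [(fderiv_extension_time hx hT hv hs hy hd).deriv, he]
  congr 1
  exact h.deriv

end Bound

end DGRec

end

/-! ### The error bound: stability of the extended reconstruction and the triangle inequality -/

theorem theorem3 (m : ℕ) (U K : Set (DGRec.State m)) (hU : IsOpen U)
    -- flux and entropy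
    (g : DGRec.State m → DGRec.State m) (hg : ContDiffOn ℝ 2 g U)
    (η q : DGRec.State m → ℝ) (hη : DGRec.IsEntropyPair U g η q)
    -- the compact convex set and the constants belonging to it
    (hK : IsCompact K) (hKconv : Convex ℝ K) (hKU : K ⊆ U)
    (Cg cη Cη : ℝ) (hC : DGRec.HessianBounds K g η Cg cη Cη)
    -- the entropy solution
    (T : ℝ) (hT : 0 < T) (u₀ : ℝ → DGRec.State m) (hu₀ : DGRec.IsInitialDatum U u₀)
    (u : ℝ → ℝ → DGRec.State m) (hu : DGRec.IsEntropySolution U g η q T u₀ u)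
    (huK : ∀ᵐ z ∂(volume.restrict (DGRec.cylinder T)), u z.1 z.2 ∈ K)
    -- space and time meshes, the DG scheme
    (M : ℕ) (x : ℕ → ℝ) (hx : DGRec.IsPartition x M (-1) 1)
    (N : ℕ) (t : ℕ → ℝ) (ht : DGRec.IsPartition t N 0 T)
    (w : DGRec.State m → DGRec.State m → DGRec.State m) (hw : DGRec.IsFluxState U w)
    (G : DGRec.State m → DGRec.State m → DGRec.State m)
    (hG : DGRec.IsNumericalFlux U g w (DGRec.meshSize x M) G)
    (k : ℕ) (uh : ℕ → ℝ → DGRec.State m)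
    (huh : ∀ n ≤ N, uh n ∈ DGRec.dgSpace x M (k + 1))
    -- the reconstructions in time and in space-time
    (F : ℕ → ℕ → ℝ → DGRec.State m) (hF : DGRec.IsHermiteData x M k N g G uh F)
    (p d r : ℕ) (ut : ℝ → ℝ → DGRec.State m)
    (hut : DGRec.IsTimeReconstruction x M k t N p d r F ut)
    (hutK : ∀ s ∈ Icc 0 T, ∀ y ∈ DGRec.meshInterior x M, ut s y ∈ K)
    (ust : ℝ → ℝ → DGRec.State m)
    (hust : DGRec.IsSpaceTimeReconstruction x M k T w ut ust)
    (hustK : ∀ s ∈ Icc 0 T, ∀ y ∈ DGRec.meshInterior x M, ust s y ∈ K) :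
    ∀ n ≤ N,
      DGRec.l2sq (fun y => u (t n) y - uh n y) ≤
        2 * DGRec.l2sq (fun y => ust (t n) y - uh n y)
        + 2 * cη⁻¹ *
          ((∫ z in DGRec.cylinder (t n), ‖DGRec.residual g ust z‖ ^ 2)
            + Cη * DGRec.l2sq (fun y => u₀ y - ust 0 y))
          * Real.exp (∫ s in (0 : ℝ)..(t n),
              (Cη * Cg * DGRec.linf (deriv (ust s)) + Cη ^ 2) / cη) := by
  open DGRec in
  intro n hn
  have hmem := fun s (hs : s ∈ Icc 0 T) => hut.mem_dgSpace hT ht hs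
  have hlip : ∀ y ∈ meshInterior x M, IsLipOn T (fun s => ust s y) := fun y hy =>
    hust.isLipOn hx hw hK hKU hmem (fun y hy => hut.isLipOn ht hy) hutK hy
  have htr : ∀ s ∈ Icc 0 T, ∀ i < M, traceL x M (ust s) i = traceR x (ust s) i :=
    fun s hs i hi => (hust.trace_left s hs i hi).trans (hust.trace_right s hs i hi).symm
  -- `V` is the globally Lipschitz periodic extension of `ust`. For times in [0, T] they agree off
  -- the mesh points, a null set, so the integrals below are unchanged.
  obtain ⟨L, hL⟩ := exists_lipschitzWith_extension hx hT hK hust.mem htr hustK hlip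
  have hVK := extension_mem hx hT hK.isClosed hust.mem htr hustK
  have hτ : t n ∈ Icc 0 T := ht.mem_Icc hn
  have h0 : (0 : ℝ) ∈ Icc 0 T := ⟨le_rfl, hT.le⟩
  have hgen : ∀ᵐ z ∂(volume.restrict (cylinder T)), z.1 ∈ Ioo 0 T ∧ z.2 ∈ meshInterior x M ∧
      DifferentiableAt ℝ (extension hT ust) z := by
    filter_upwards [ae_restrict_mem (measurableSet_cylinder T),
      ae_cylinder_of_ae_cellT hx.ae_mem_meshInterior T,
      ae_restrict_of_ae hL.ae_differentiableAt] with z h1 h2 h3 using ⟨h1.1, h2, h3⟩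
  have hβV : ∀ᵐ z ∂(volume.restrict (cylinder T)),
      ‖fderiv ℝ (extension hT ust) z (0, 1)‖ ≤ linf (deriv (ust z.1)) := by
    filter_upwards [hgen] with z hz
    have hs := Ioo_subset_Icc_self hz.1
    rw [← (fderiv_extension_space hx hT hust.mem hs hz.2.1 hz.2.2).deriv]
    exact norm_deriv_le_linf hx hK hust.mem hustK hs hz.2.1
  have key := hu.stability hU hg hη hK hKconv hKU hC hT hu₀ huK hL (extension_periodic hT ust) hVK
    (continuousOn_linf_deriv hx hK hust.mem hustK hlip) (fun s _ => linf_nonneg _) hβV hτ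
  have hres : ∫ z in cylinder (t n), ‖fderivResidual g (extension hT ust) z‖ ^ 2
      = ∫ z in cylinder (t n), ‖residual g ust z‖ ^ 2 := by
    refine integral_congr_ae (ae_mono (Measure.restrict_mono (cylinder_subset hτ.2) le_rfl) ?_)
    filter_upwards [hgen] with z hz
    have ha := hustK _ (Ioo_subset_Icc_self hz.1) _ hz.2.1
    have hgd : DifferentiableAt ℝ g (ust z.1 z.2) :=
      (hg.contDiffAt (hU.mem_nhds (hKU ha))).differentiableAt two_ne_zero
    simp only [residual_eq_fderivResidual hx hT hust.mem hz.1 hz.2.1 hz.2.2 hgd]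
  have hinit : ∫ y in cellT, ‖u₀ y - extension hT ust (0, y)‖ ^ 2 =
      l2sq (fun y => u₀ y - ust 0 y) := by
    refine integral_congr_ae (hx.ae_mem_meshInterior.mono fun y hy => ?_)
    simp only [extension_eq hx hT hust.mem h0 hy]
  have hrec : ∫ y in cellT, ‖extension hT ust (t n, y) - uh n y‖ ^ 2 =
      l2sq (fun y => ust (t n) y - uh n y) := by
    refine integral_congr_ae (hx.ae_mem_meshInterior.mono fun y hy => ?_)
    simp only [extension_eq hx hT hust.mem hτ hy]
  have hcont : Continuous fun y => extension hT ust (t n, y) := hL.continuous.comp (by fun_prop)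
  obtain ⟨C, hCu⟩ := hu.bounded
  obtain ⟨C', hC'⟩ := hK.isBounded.exists_norm_le
  have i₁ := integrableOn_norm_sub_sq_of_bounded (hu.meas_slice _ hτ) (hCu _ hτ) hcont
    (fun y => hC' _ (hVK _))
  have i₂ := integrableOn_norm_sub_sq_of_mem_dgSpace hx (huh n hn) hcont
  -- The two factors 2 come from (a + b)² ≤ 2a² + 2b². The intermediate function is the extension,
  -- whose continuity makes both right-hand integrands integrable.
  have htri : l2sq (fun y => u (t n) y - uh n y) ≤
      2 * (∫ y in cellT, ‖extension hT ust (t n, y) - uh n y‖ ^ 2)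
      + 2 * ∫ y in cellT, ‖u (t n) y - extension hT ust (t n, y)‖ ^ 2 := by
    rw [← integral_const_mul, ← integral_const_mul, ← integral_add (i₂.const_mul 2) (i₁.const_mul 2)]
    exact integral_mono_of_nonneg (ae_of_all _ fun y => sq_nonneg _)
      ((i₂.const_mul 2).add (i₁.const_mul 2)) (ae_of_all _ fun y => norm_sub_sq_le_two_mul _ _ _)
  rw [hres, hinit] at key
  rw [hrec] at htri
  linarith
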